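/- **Notation.** For positive definite $L$, $L^q$ ($q\in\mathbb R$) is the usual power; $\|\cdot\|$ is the operator norm of complex matrices; "$\ge 0$" for matrices means positive semidefinite. For $L>0$, $F$ Hermitian and $q\in[0,1]$, let $F_{q,L}=\frac{d}{d\epsilon}(L+\epsilon F)^q|_{\epsilon=0}$ and $$K_{q,L,F}=\frac{\sin \pi q}{\pi}\int_0^\infty t^q (t+L)^{-1}F(t+L)^{-1}F(t+L)^{-1}\,dt .$$ For $A,B>0$ and $X,Z$ Hermitian put $S=\frac{A+B}2$, $\Theta=S^{-1/2}\frac{A-B}{2}S^{-1/2}$, $E_1=-S^{-1/2}\frac{X+Z}2S^{-1/2}$, $E_2=S^{-1/2}\frac{X-Z}2S^{-1/2}$, $T=E_2+\Theta E_1$, and for $s>0$, $\widetilde\Theta(s)=\sum_{k\ge0}(1+s)^{-k}\Theta^{2k}$, $\Omega(s)=(1+s)^{-1/2}T+(1+s)^{-3/2}\Theta T\Theta$, and $$\mathrm{Cross}_{A,B}(X,Z)=\frac1\pi S^{1/2}\Big[\int_0^\infty \frac{s^{1/2}}{1+s}\,\widetilde\Theta\,\Omega\,\widetilde\Theta\,\Omega^*\,\widetilde\Theta\,ds+\Theta\Big(\int_0^\infty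 \frac{s^{1/2}}{(1+s)^{3}}\,\widetilde\Theta\, TT^*\,\widetilde\Theta\,ds\Big)\Theta\Big]S^{1/2}.$$ Let $\Psi>0$ and $V$ Hermitian be $N\times N$, and $\Phi>0$ and $W$ Hermitian be $M\times M$. Put $G_{q,r}(\epsilon)=(\Psi+\epsilon V)^q\otimes(\Phi+\epsilon W)^r$. Let $p\in[0,1]$. For $x=l/2^k\in[0,1]$ in lowest terms ($0=0/2^0$, $1=1/2^0$, otherwise $k\ge1$ and $l$ odd) define $\mathrm{Source}_x=\mathrm{Source}_{px,\,p(1-x)}$ by $\mathrm{Source}_0=I\otimes K_{p,\Phi,W}$, $\mathrm{Source}_1=K_{p,\Psi,V}\otimes I$, and for $k\ge1$, with $x_\pm=(l\pm1)/2^k$ and $(q_\pm,r_\pm)=p(x_\pm,1-x_\pm)$, by $\mathrm{Source}_x=\mathrm{Cross}_{A,B}(X,Z)$ where $$A=\Psi^{q_-}\otimes\Phi^{r_-},\quad B=\Psi^{q_+}\otimes\Phi^{r_+},\quad X=V_{q_-,\Psi}\otimes\Phi^{r_-}+\Psi^{q_-}\otimes W_{r_-,\Phi},\quad Z=V_{q_+,\Psi}\otimes\Phi^{r_+}+\Psi^{q_+}\otimes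 W_{r_+,\Phi}.$$ For $\delta\in\mathbb R$ let $K_\delta=\Psi^\delta\otimes\Phi^{-\delta}$ and $D_\delta(F)=\int_0^\infty e^{-sK_\delta}Fe^{-sK_\delta}\,ds$ (the solution $Q$ of $K_\delta Q+QK_\delta=F$). For $x=l/2^k$ with $k\ge1$ and $l<2^k$ odd, let $\mathcal A(x)$ be the set of $x_0=l_0/2^{k_0}\in[0,1]$ in lowest terms with $k_0\le k$ and $|x_0-x|<2^{-k_0}$. For $x_0\in\mathcal A(x)$ let $$Y_{x,x_0,p}=\sum D_{c_jp2^{-m_j}}\big(\cdots D_{c_1p2^{-m_1}}(\mathrm{Source}_{x_0})\big),$$ the sum being over all finite sequences $(m_1,c_1),\dots,(m_j,c_j)$, $j\ge0$, with integers $k_0<m_1<\dots<m_j\le k$, $c_i=\pm1$ and $x_0-x=\sum_i c_i2^{-m_i}$ (so $Y_{x,x,p}=\mathrm{Source}_x$, from the empty sequence). For positive definite $N\times N$ matrices $A_1,A_2$ and $M\times M$ matrices $B_1,B_2$ put $H_{q,r}(t)=(tA_1+(1-t)A_2)^q\otimes(tB_1+(1-t)B_2)^r$. For $t_0\in[0,1]$,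 the objects above belonging to $t_0$ are those with $\Psi=t_0A_1+(1-t_0)A_2$, $V=A_1-A_2$, $\Phi=t_0B_1+(1-t_0)B_2$, $W=B_1-B_2$. **Theorem.** 1. For $q,r\ge0$, $q+r\le1$ and $t_0\in[0,1]$, $H_{q,r}$ is $C^2$ near $t_0$ and $H''_{q,r}(t_0)=G''_{q,r}(0)$. 2. (Dyadic exponents.) Let $p\in[0,1]$, $t_0\in[0,1]$, $x=l/2^k$ with $k\ge1$ and $l<2^k$ odd, and $(q,r)=p(x,1-x)$. Then every $Y_{x,x_0,p}$, $x_0\in\mathcal A(x)$, is positive semidefinite, and $$0\ \ge\ \tfrac12H''_{q,r}(t_0)=\tfrac12 G''_{q,r}(0)=-\sum_{x_0\in\mathcal A(x)}Y_{x,x_0,p}.$$ 3. For all $\Psi,\Phi>0$ and Hermitian $V,W$ there is a constant $C=C(\Psi,\Phi,V,W)>0$ such that for all $p\in[0,1]$, all $x=l/2^k$ as in 2 and all $x_0=l_0/2^{k_0}\in\mathcal A(x)$, $$\Big\|Y_{x,x_0,p}-\Big(1-\Big|l_0-\frac{l}{2^{k-k_0}}\Big|\Big)\mathrm{Source}_{x_0}\Big\|\le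 C\,2^{-k_0}\,\|\mathrm{Source}_{x_0}\|.$$ 4. (Other exponents.) Let $q,r\ge0$, $q+r=p\le1$, with $q$ not of the form $pl/2^k$. Then there is a unique sequence of positive integers $l_1<l_2<\cdots$ with $q=p\sum_{k\ge1}2^{-l_k}$, and for every $t_0\in[0,1]$ $$G''_{q,r}(0)=H''_{q,r}(t_0)=\lim_{n\to\infty}H''_{p\sum_{k=1}^n2^{-l_k},\;p(1-\sum_{k=1}^n2^{-l_k})}(t_0)\le0 .$$ 5. Let $q,r\ge0$, $q+r\le1$, let $K$ be a complex $N\times M$ matrix, and let $h(t)=\mathrm{Tr}\big(K^*(tA_1+(1-t)A_2)^qK(tB_1+(1-t)B_2)^r\big)$. Let $V_K\in\mathbb C^{NM}$ be the vector of the entries $K_{ij}$ of $K$, and let $\widehat H_{q,r}$ be $H_{q,r}$ with $B_1,B_2$ replaced by their transposes $B_1^{T},B_2^{T}$. For $t\in[0,1]$ the number $h(t)$ is real, $h(t)=\langle V_K,\widehat H_{q,r}(t)V_K\rangle$, $h$ is $C^2$ near $t$, and $$h''(t)=\langle V_K,\widehat H''_{q,r}(t)V_K\rangle\le0 .$$ Hence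 $h$ is concave on $[0,1]$, and for $t\in(0,1)$ $$h(t)-(1-t)h(0)-th(1)=-t\int_0^1\int_{t\lambda}^{\lambda}\langle V_K,\widehat H''_{q,r}(\sigma)V_K\rangle\,d\sigma\,d\lambda\ \ge0 .$$ -/

import Mathlib

open scoped Matrix Kronecker ComplexOrder Matrix.Norms.L2Operator

namespace LiebConcavity

noncomputable section

section OneMatrix

variable {ι : Type*} [Fintype ι] [DecidableEq ι]

/-- The real power `A ^ q` of a Hermitian matrix, by the functional calculus; it is used for
positive definite `A`, where it is the usual power. -/
def mpow (A : Matrix ι ι ℂ) (q : ℝ) : Matrix ι ι ℂ :=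
  cfc (fun x : ℝ => x ^ q) A

/-- `t A₁ + (1 - t) A₂`. -/
def seg (A₁ A₂ : Matrix ι ι ℂ) (t : ℝ) : Matrix ι ι ℂ :=
  t • A₁ + (1 - t) • A₂

/-- The matrix `F_{q,L}`: the coefficient of `ε` in the expansion of `(L + ε F) ^ q`. -/
def firstOrder (q : ℝ) (L F : Matrix ι ι ℂ) : Matrix ι ι ℂ :=
  deriv (fun ε : ℝ => mpow (L + ε • F) q) 0

/-- The matrix `K_{q,L,F} = (sin (π q) / π) ∫₀^∞ t^q (t+L)⁻¹ F (t+L)⁻¹ F (t+L)⁻¹ dt`. -/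
def secondOrder (q : ℝ) (L F : Matrix ι ι ℂ) : Matrix ι ι ℂ :=
  (Real.sin (Real.pi * q) / Real.pi) •
    ∫ t in Set.Ioi (0 : ℝ), (t ^ q) •
      ((t • (1 : Matrix ι ι ℂ) + L)⁻¹ * F * (t • (1 : Matrix ι ι ℂ) + L)⁻¹ * F *
        (t • (1 : Matrix ι ι ℂ) + L)⁻¹)

/-- `((A + B) / 2) ^ (-1/2)`. -/
def meanInvSqrt (A B : Matrix ι ι ℂ) : Matrix ι ι ℂ :=
  mpow ((1 / 2 : ℝ) • (A + B)) (-1 / 2)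

/-- `((A + B) / 2)^(-1/2) ((A - B) / 2) ((A + B) / 2)^(-1/2)`. -/
def crossPsi (A B : Matrix ι ι ℂ) : Matrix ι ι ℂ :=
  meanInvSqrt A B * ((1 / 2 : ℝ) • (A - B)) * meanInvSqrt A B

/-- `E₁ = -((A + B) / 2)^(-1/2) ((X + Z) / 2) ((A + B) / 2)^(-1/2)`. -/
def crossE₁ (A B X Z : Matrix ι ι ℂ) : Matrix ι ι ℂ :=
  -(meanInvSqrt A B * ((1 / 2 : ℝ) • (X + Z)) * meanInvSqrt A B)

/-- `E₂ = ((A + B) / 2)^(-1/2) ((X - Z) / 2) ((A + B) / 2)^(-1/2)`. -/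
def crossE₂ (A B X Z : Matrix ι ι ℂ) : Matrix ι ι ℂ :=
  meanInvSqrt A B * ((1 / 2 : ℝ) • (X - Z)) * meanInvSqrt A B

/-- `T = E₂ + Ψ E₁`, where `Ψ = crossPsi A B`. -/
def crossT (A B X Z : Matrix ι ι ℂ) : Matrix ι ι ℂ :=
  crossE₂ A B X Z + crossPsi A B * crossE₁ A B X Z

/-- `Ψ̃(s) = ∑ₖ (1 + s)^(-k) Ψ^(2k)`. -/
def crossPsiTilde (A B : Matrix ι ι ℂ) (s : ℝ) : Matrix ι ι ℂ :=
  ∑' k : ℕ, ((1 + s)⁻¹ ^ k) • crossPsi A B ^ (2 * k)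

/-- `Ω(s) = (1 + s)^(-1/2) T + (1 + s)^(-3/2) Ψ T Ψ`. -/
def crossOmega (A B X Z : Matrix ι ι ℂ) (s : ℝ) : Matrix ι ι ℂ :=
  ((1 + s) ^ (-1 / 2 : ℝ)) • crossT A B X Z +
    ((1 + s) ^ (-3 / 2 : ℝ)) • (crossPsi A B * crossT A B X Z * crossPsi A B)

/-- `Cross_{A,B}(X,Z)`: minus one half of the second derivative at `ε = 0` of the geometric mean of
`A + ε X` and `B + ε Z`, as an explicit integral of positive semidefinite matrices. -/
def cross (A B X Z : Matrix ι ι ℂ) : Matrix ι ι ℂ :=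
  (1 / Real.pi : ℝ) •
    (mpow ((1 / 2 : ℝ) • (A + B)) (1 / 2) *
      ((∫ s in Set.Ioi (0 : ℝ), (s ^ (1 / 2 : ℝ) * (1 + s)⁻¹) •
          (crossPsiTilde A B s * crossOmega A B X Z s * crossPsiTilde A B s *
            (crossOmega A B X Z s)ᴴ * crossPsiTilde A B s)) +
        crossPsi A B *
          (∫ s in Set.Ioi (0 : ℝ), (s ^ (1 / 2 : ℝ) * (1 + s)⁻¹ ^ 3) •
            (crossPsiTilde A B s * crossT A B X Z * (crossT A B X Z)ᴴ * crossPsiTilde A B s)) *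
          crossPsi A B) *
      mpow ((1 / 2 : ℝ) • (A + B)) (1 / 2))

end OneMatrix

section TwoMatrices

variable {n m : Type*} [Fintype n] [DecidableEq n] [Fintype m] [DecidableEq m]

/-- `H_{q,r}(t) = (t A₁ + (1-t) A₂)^q ⊗ (t B₁ + (1-t) B₂)^r`. -/
def H (A₁ A₂ : Matrix n n ℂ) (B₁ B₂ : Matrix m m ℂ) (q r t : ℝ) : Matrix (n × m) (n × m) ℂ :=
  mpow (seg A₁ A₂ t) q ⊗ₖ mpow (seg B₁ B₂ t) r

/-- `G_{q,r}(ε) = (Ψ + ε V)^q ⊗ (Φ + ε W)^r`. -/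
def G (Ψ V : Matrix n n ℂ) (Φ W : Matrix m m ℂ) (q r ε : ℝ) : Matrix (n × m) (n × m) ℂ :=
  mpow (Ψ + ε • V) q ⊗ₖ mpow (Φ + ε • W) r

/-- The first-order coefficient `V_{q,Ψ} ⊗ Φ^r + Ψ^q ⊗ W_{r,Φ}` of `G_{q,r}`. -/
def firstOrderG (Ψ V : Matrix n n ℂ) (Φ W : Matrix m m ℂ) (q r : ℝ) :
    Matrix (n × m) (n × m) ℂ :=
  firstOrder q Ψ V ⊗ₖ mpow Φ r + mpow Ψ q ⊗ₖ firstOrder r Φ W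

/-- `Source_{q,r}` for `(q, r) = p (x, 1 - x)`, where `x = l / 2^k` is written in lowest terms:
`x = 0` is `k = 0, l = 0`, and `x = 1` is `k = 0, l = 1`. For `k ≥ 1` it is `Cross_{A,B}(X,Z)`
at the two neighbours `(l - 1) / 2^k` and `(l + 1) / 2^k` of `x`. -/
def source (Ψ V : Matrix n n ℂ) (Φ W : Matrix m m ℂ) (p : ℝ) :
    ℕ → ℕ → Matrix (n × m) (n × m) ℂ
  | 0, 0 => (1 : Matrix n n ℂ) ⊗ₖ secondOrder p Φ W
  | 0, _ + 1 => secondOrder p Ψ V ⊗ₖ (1 : Matrix m m ℂ)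
  | k + 1, l =>
    let x₁ : ℝ := ((l : ℝ) - 1) / 2 ^ (k + 1)
    let x₂ : ℝ := ((l : ℝ) + 1) / 2 ^ (k + 1)
    cross (mpow Ψ (p * x₁) ⊗ₖ mpow Φ (p * (1 - x₁))) (mpow Ψ (p * x₂) ⊗ₖ mpow Φ (p * (1 - x₂)))
      (firstOrderG Ψ V Φ W (p * x₁) (p * (1 - x₁)))
      (firstOrderG Ψ V Φ W (p * x₂) (p * (1 - x₂)))

/-- `K_δ = Ψ^δ ⊗ Φ^(-δ)`. -/
def Kmat (Ψ : Matrix n n ℂ) (Φ : Matrix m m ℂ) (δ : ℝ) : Matrix (n × m) (n × m) ℂ :=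
  mpow Ψ δ ⊗ₖ mpow Φ (-δ)

/-- `D_δ(F) = ∫₀^∞ e^(-s K_δ) F e^(-s K_δ) ds`. -/
def Dop (Ψ : Matrix n n ℂ) (Φ : Matrix m m ℂ) (δ : ℝ) (F : Matrix (n × m) (n × m) ℂ) :
    Matrix (n × m) (n × m) ℂ :=
  ∫ s in Set.Ioi (0 : ℝ),
    NormedSpace.exp (-(s • Kmat Ψ Φ δ)) * F * NormedSpace.exp (-(s • Kmat Ψ Φ δ))

/-- The finite sequences `(m₁, c₁), …, (m_j, c_j)` with `k₀ < m₁ < ⋯ < m_j ≤ k`, `c_i = ±1` and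
`l₀ / 2^k₀ - l / 2^k = ∑ c_i 2^(-m_i)`. -/
def stepSequences (k l k₀ l₀ : ℕ) : Set (List (ℕ × ℤ)) :=
  {w | w.Pairwise (fun x y => x.1 < y.1) ∧
    (∀ x ∈ w, k₀ < x.1 ∧ x.1 ≤ k ∧ (x.2 = 1 ∨ x.2 = -1)) ∧
    (l₀ : ℝ) / 2 ^ k₀ - (l : ℝ) / 2 ^ k = (w.map fun x => (x.2 : ℝ) / 2 ^ x.1).sum}

theorem stepSequences_finite (k l k₀ l₀ : ℕ) : (stepSequences k l k₀ l₀).Finite := by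
  refine Set.Finite.of_finite_image (f := List.toFinset)
    (((Finset.range (k + 1) ×ˢ ({1, -1} : Finset ℤ)).powerset.finite_toSet).subset ?_) ?_
  · rintro _ ⟨w, hw, rfl⟩
    simp only [Finset.coe_powerset, Set.mem_preimage, Set.mem_powerset_iff]
    intro x hx
    have hx' : x ∈ w := by simpa using hx
    obtain ⟨_, h2, h3⟩ := hw.2.1 x hx'
    simp only [Finset.coe_product, Set.mem_prod, Finset.mem_coe, Finset.mem_range,
      Finset.mem_insert, Finset.mem_singleton]
    exact ⟨by omega, h3⟩
  · intro w hw v hv h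
    have hnd : ∀ u ∈ stepSequences k l k₀ l₀, u.Nodup := fun u hu =>
      hu.1.imp (fun {a b} hab => by rintro rfl; exact lt_irrefl _ hab)
    have hp : w.Perm v := List.perm_of_nodup_nodup_toFinset_eq (hnd w hw) (hnd v hv) h
    exact hp.eq_of_pairwise (fun a b _ _ hab hba => absurd hab (lt_asymm hba)) hw.1 hv.1

/-- The term `Y`: the sum, over the sequences above, of
`D_{c_j p 2^(-m_j)} (⋯ (D_{c₁ p 2^(-m₁)} (Source)))`. -/
def Y (Ψ V : Matrix n n ℂ) (Φ W : Matrix m m ℂ) (p : ℝ) (k l k₀ l₀ : ℕ) :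
    Matrix (n × m) (n × m) ℂ :=
  ∑ w ∈ (stepSequences_finite k l k₀ l₀).toFinset,
    w.foldl (fun F x => Dop Ψ Φ ((x.2 : ℝ) * p / 2 ^ x.1) F) (source Ψ V Φ W p k₀ l₀)

open Classical in
/-- The pairs `(k₀, l₀)` with `k₀ ≤ k`, `l₀ / 2^k₀ ∈ [0, 1]` in lowest terms, and
`|l₀ / 2^k₀ - l / 2^k| < 2^(-k₀)`. -/
def ancestors (k l : ℕ) : Finset (ℕ × ℕ) :=
  (Finset.range (k + 1) ×ˢ Finset.range (2 ^ k + 1)).filter fun x =>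
    x.2 ≤ 2 ^ x.1 ∧ (1 ≤ x.1 → Odd x.2) ∧
      |(x.2 : ℝ) / 2 ^ x.1 - (l : ℝ) / 2 ^ k| < 1 / 2 ^ x.1

/-- The complex number `Tr (K* (t A₁ + (1-t) A₂)^q K (t B₁ + (1-t) B₂)^r)`. -/
def traceFun (K : Matrix n m ℂ) (A₁ A₂ : Matrix n n ℂ) (B₁ B₂ : Matrix m m ℂ) (q r t : ℝ) : ℂ :=
  (Kᴴ * mpow (seg A₁ A₂ t) q * K * mpow (seg B₁ B₂ t) r).trace

/-- The real-valued function `h(t) = Tr (K* (t A₁ + (1-t) A₂)^q K (t B₁ + (1-t) B₂)^r)`. -/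
def h (K : Matrix n m ℂ) (A₁ A₂ : Matrix n n ℂ) (B₁ B₂ : Matrix m m ℂ) (q r t : ℝ) : ℝ :=
  (traceFun K A₁ A₂ B₁ B₂ q r t).re

/-- `⟨V_K, Q V_K⟩`, where `V_K` is the vector of the entries of `K`. -/
def quadForm (K : Matrix n m ℂ) (Q : Matrix (n × m) (n × m) ℂ) : ℂ :=
  star (fun x : n × m => K x.1 x.2) ⬝ᵥ (Q *ᵥ fun x : n × m => K x.1 x.2)

end TwoMatrices

end

end LiebConcavity

/-!
Write `P(x)` for minus one half of the second derivative at `0` of `G_{px, p(1-x)}` (`curvature`).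
Everything rests on a recursion for `P` along the dyadic tree. With `δ = p / 2^(k+1)`, the matrix
families at three neighbouring points `x₋ < x < x₊`, at distance `2^(-(k+1))` from each other, are
`A`, `C = K A = A K` and `B = K A K`, where `K = G_{δ,-δ}`. Hence
`B + K₀ A K₀ - K₀ C - C K₀ = (K - K₀) A (K - K₀)` for the value `K₀ = K(0)`, and the right-hand
side is quadratically small. Differentiating twice (`lyapunov_iteratedDeriv_two`) gives a Lyapunov
equation for `P(x)`, which says `P(x) = D_δ(K' A₀ K') + D_δ(P(x₊)) + D_{-δ}(P(x₋))`
(`curvature_midpoint`).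

The explicit integral `cross` solves the Lyapunov equation with right-hand side `K' A₀ K'`: in an
eigenbasis of `A₀` and `K₀` it is an identity between entries, and each entry is a sum of scalar
integrals (`cross_lyapunov`, `cross_eq_lyap`). So the first term is `source`, and it is positive
semidefinite.

At the two end points of `[0, 1]` one tensor factor is constant, and `P` is `secondOrder` of the
other one, because the integral representation of `x ^ p` for `0 < p < 1` may be differentiated
twice under the integral sign (`iteratedDeriv_two_mpow`).

The sums `Y` obey the recursion of `P` with a single source switched on (`Y_self`, `Y_succ_even`,
`Y_succ_odd`), so induction on the level gives `P(x) = ∑ Y` (`curvature_eq_sum_ancestors`), with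
positive semidefinite terms. Since `D_δ` differs from multiplication by `1 / 2` by `O(δ)`
(`exists_norm_Dop_sub_le`), and the recursion with factors `1 / 2` is solved by the tent function,
the same induction bounds the distance of `Y` from its tent multiple of the source
(`norm_Y_sub_le`).

For arbitrary exponents, `G_{q,r}(ε)` is jointly smooth in `(q, r, ε)`, so the second derivative is
continuous in `(q, r)`, and negativity passes to the limit from dyadic points
(`posSemidef_curvature`). Finally the trace function is the value at `H` of a continuous
real-linear functional that is nonnegative on positive semidefinite matrices.
-/

namespace LiebConcavity

/-! ### Simultaneous diagonalization -/

section Diagonalization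

variable {ι κ : Type*} [Fintype ι] [DecidableEq ι] [Fintype κ] [DecidableEq κ]

/-- The star algebra automorphism `M ↦ U M Uᴴ`. -/
noncomputable abbrev conj (U : Matrix.unitaryGroup ι ℂ) : Matrix ι ι ℂ ≃⋆ₐ[ℂ] Matrix ι ι ℂ :=
  Unitary.conjStarAlgAut ℂ (Matrix ι ι ℂ) U

/-- The matrix `U diag(d) Uᴴ`, as a homomorphism of real algebras in `d`. -/
noncomputable def conjDiag (U : Matrix.unitaryGroup ι ℂ) : (ι → ℝ) →ₐ[ℝ] Matrix ι ι ℂ :=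
  ((conj U).toAlgEquiv.toAlgHom.restrictScalars ℝ).comp
    ((Matrix.diagonalAlgHom ℝ).comp (Complex.ofRealAm.compLeft ι))

theorem conjDiag_apply (U : Matrix.unitaryGroup ι ℂ) (d : ι → ℝ) :
    conjDiag U d = conj U (Matrix.diagonal fun i => (d i : ℂ)) := rfl

theorem conjDiag_isHermitian (U : Matrix.unitaryGroup ι ℂ) (d : ι → ℝ) :
    (conjDiag U d).IsHermitian := by
  have h : IsSelfAdjoint (Matrix.diagonal fun i => (d i : ℂ)) := by
    rw [isSelfAdjoint_iff, Matrix.star_eq_conjTranspose, Matrix.diagonal_conjTranspose]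
    congr 1
    ext i
    simp
  exact h.map (conj U)

theorem spectrum_conjDiag_subset (U : Matrix.unitaryGroup ι ℂ) (d : ι → ℝ) :
    spectrum ℝ (conjDiag U d) ⊆ Set.range d := by
  refine (AlgHom.spectrum_apply_subset (conjDiag U) d).trans ?_
  rw [Pi.spectrum_eq]
  intro x hx
  obtain ⟨i, hi⟩ := Set.mem_iUnion.1 hx
  rw [spectrum.mem_iff, isUnit_iff_ne_zero, not_not] at hi
  exact ⟨i, (sub_eq_zero.1 hi).symm⟩

theorem cfc_conjDiag (U : Matrix.unitaryGroup ι ℂ) (d : ι → ℝ) (f : ℝ → ℝ) :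
    cfc f (conjDiag U d) = conjDiag U (f ∘ d) := by
  classical
  -- On the finite spectrum `f` agrees with an interpolation polynomial.
  set s : Finset ℝ := Finset.univ.image d
  set p := Lagrange.interpolate s id f
  have hp : ∀ i, p.eval (d i) = f (d i) := fun i =>
    Lagrange.eval_interpolate_at_node (v := id) f Function.injective_id.injOn
      (Finset.mem_image_of_mem d (Finset.mem_univ i))
  have h1 : cfc f (conjDiag U d) = cfc p.eval (conjDiag U d) := by
    refine cfc_congr fun x hx => ?_
    obtain ⟨i, rfl⟩ := spectrum_conjDiag_subset U d hx
    exact (hp i).symm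
  rw [h1, cfc_polynomial p _ (conjDiag_isHermitian U d).isSelfAdjoint,
    Polynomial.aeval_algHom_apply]
  congr 1
  ext i
  simp [Polynomial.aeval_pi, ← hp i, Polynomial.aeval_def, Polynomial.eval₂_eq_eval_map]

theorem mpow_conjDiag (U : Matrix.unitaryGroup ι ℂ) (d : ι → ℝ) (q : ℝ) :
    mpow (conjDiag U d) q = conjDiag U fun i => d i ^ q :=
  cfc_conjDiag U d _

theorem exists_conjDiag {A : Matrix ι ι ℂ} (hA : A.IsHermitian) :
    ∃ (U : Matrix.unitaryGroup ι ℂ) (d : ι → ℝ), A = conjDiag U d :=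
  ⟨hA.eigenvectorUnitary, hA.eigenvalues, hA.spectral_theorem⟩

theorem posSemidef_conj {M : Matrix ι ι ℂ} (U : Matrix.unitaryGroup ι ℂ) (hM : M.PosSemidef) :
    (conj U M).PosSemidef := by
  simpa [Matrix.star_eq_conjTranspose] using hM.mul_mul_conjTranspose_same (U : Matrix ι ι ℂ)

theorem conj_symm_conj (U : Matrix.unitaryGroup ι ℂ) (M : Matrix ι ι ℂ) :
    conj (star U) (conj U M) = M := by
  rw [← Unitary.conjStarAlgAut_mul_apply]; simp

theorem conj_conj_symm (U : Matrix.unitaryGroup ι ℂ) (M : Matrix ι ι ℂ) :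
    conj U (conj (star U) M) = M := by
  rw [← Unitary.conjStarAlgAut_mul_apply]; simp

theorem posSemidef_conjDiag_iff (U : Matrix.unitaryGroup ι ℂ) (d : ι → ℝ) :
    (conjDiag U d).PosSemidef ↔ ∀ i, 0 ≤ d i := by
  have h : (Matrix.diagonal fun i => (d i : ℂ)).PosSemidef ↔ ∀ i, 0 ≤ d i := by
    rw [Matrix.posSemidef_diagonal_iff]; simp
  rw [← h]
  refine ⟨fun H => ?_, posSemidef_conj U⟩
  simpa only [conjDiag_apply, conj_symm_conj] using posSemidef_conj (star U) H

theorem isUnit_conjDiag {U : Matrix.unitaryGroup ι ℂ} {d : ι → ℝ} (hd : ∀ i, d i ≠ 0) :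
    IsUnit (conjDiag U d) :=
  (Pi.isUnit_iff.2 fun i => isUnit_iff_ne_zero.2 (hd i)).map (conjDiag U)

theorem posDef_conjDiag_iff (U : Matrix.unitaryGroup ι ℂ) (d : ι → ℝ) :
    (conjDiag U d).PosDef ↔ ∀ i, 0 < d i := by
  constructor
  · intro H i
    refine lt_of_le_of_ne ((posSemidef_conjDiag_iff U d).1 H.posSemidef i) fun h0 => ?_
    have h1 : IsUnit (Matrix.diagonal fun i => (d i : ℂ)) := by
      have := H.isUnit.map (conj (star U))
      rwa [conjDiag_apply, conj_symm_conj] at this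
    rw [Matrix.isUnit_diagonal, Pi.isUnit_iff] at h1
    exact (h1 i).ne_zero (by simp [← h0])
  · intro H
    exact ((posSemidef_conjDiag_iff U d).2 fun i => (H i).le).posDef_iff_isUnit.2
      (isUnit_conjDiag fun i => (H i).ne')

theorem exists_conjDiag_pos {A : Matrix ι ι ℂ} (hA : A.PosDef) :
    ∃ (U : Matrix.unitaryGroup ι ℂ) (d : ι → ℝ), (∀ i, 0 < d i) ∧ A = conjDiag U d := by
  obtain ⟨U, d, rfl⟩ := exists_conjDiag hA.isHermitian
  exact ⟨U, d, (posDef_conjDiag_iff U d).1 hA, rfl⟩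

theorem inv_conjDiag {U : Matrix.unitaryGroup ι ℂ} {d : ι → ℝ} (hd : ∀ i, d i ≠ 0) :
    (conjDiag U d)⁻¹ = conjDiag U fun i => (d i)⁻¹ := by
  refine Matrix.inv_eq_right_inv ?_
  rw [← map_mul, ← map_one (conjDiag U)]
  congr 1
  ext i
  simp [hd i]

theorem norm_conj (U : Matrix.unitaryGroup ι ℂ) (M : Matrix ι ι ℂ) : ‖conj U M‖ = ‖M‖ :=
  NonUnitalStarAlgHom.norm_map (conj U) (conj U).injective M

theorem norm_conjDiag_le {U : Matrix.unitaryGroup ι ℂ} {d : ι → ℝ} {c : ℝ} (hc : 0 ≤ c)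
    (hd : ∀ i, |d i| ≤ c) : ‖conjDiag U d‖ ≤ c := by
  rw [conjDiag_apply, norm_conj, Matrix.l2_opNorm_diagonal, pi_norm_le_iff_of_nonneg hc]
  intro i
  simpa using hd i

theorem abs_le_norm_conjDiag (U : Matrix.unitaryGroup ι ℂ) (d : ι → ℝ) (i : ι) :
    |d i| ≤ ‖conjDiag U d‖ := by
  rw [conjDiag_apply, norm_conj, Matrix.l2_opNorm_diagonal]
  simpa using norm_le_pi_norm (fun i => (d i : ℂ)) i

/-- The Kronecker product of two unitary matrices. -/
noncomputable def kronUnitary (U : Matrix.unitaryGroup ι ℂ) (V : Matrix.unitaryGroup κ ℂ) :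
    Matrix.unitaryGroup (ι × κ) ℂ :=
  ⟨(U : Matrix ι ι ℂ) ⊗ₖ (V : Matrix κ κ ℂ), Matrix.kronecker_mem_unitary U.2 V.2⟩

theorem conj_kronecker (U : Matrix.unitaryGroup ι ℂ) (V : Matrix.unitaryGroup κ ℂ)
    (M : Matrix ι ι ℂ) (N : Matrix κ κ ℂ) :
    conj U M ⊗ₖ conj V N = conj (kronUnitary U V) (M ⊗ₖ N) := by
  simp only [Unitary.conjStarAlgAut_apply, kronUnitary, Matrix.star_eq_conjTranspose,
    Matrix.conjTranspose_kronecker, Matrix.mul_kronecker_mul]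

theorem conjDiag_kronecker (U : Matrix.unitaryGroup ι ℂ) (V : Matrix.unitaryGroup κ ℂ)
    (d : ι → ℝ) (e : κ → ℝ) :
    conjDiag U d ⊗ₖ conjDiag V e = conjDiag (kronUnitary U V) fun x => d x.1 * e x.2 := by
  rw [conjDiag_apply, conjDiag_apply, conj_kronecker, Matrix.diagonal_kronecker_diagonal,
    conjDiag_apply]
  simp

theorem mpow_add {A : Matrix ι ι ℂ} (hA : A.PosDef) (q r : ℝ) :
    mpow A (q + r) = mpow A q * mpow A r := by
  obtain ⟨U, d, hd, rfl⟩ := exists_conjDiag_pos hA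
  rw [mpow_conjDiag, mpow_conjDiag, mpow_conjDiag, ← map_mul]
  congr 1
  ext i
  exact Real.rpow_add (hd i) q r

theorem posDef_mpow {A : Matrix ι ι ℂ} (hA : A.PosDef) (q : ℝ) : (mpow A q).PosDef := by
  obtain ⟨U, d, hd, rfl⟩ := exists_conjDiag_pos hA
  rw [mpow_conjDiag, posDef_conjDiag_iff]
  exact fun i => Real.rpow_pos_of_pos (hd i) q

theorem mpow_zero {A : Matrix ι ι ℂ} (hA : A.PosDef) : mpow A 0 = 1 := by
  obtain ⟨U, d, hd, rfl⟩ := exists_conjDiag_pos hA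
  rw [mpow_conjDiag, ← map_one (conjDiag U)]
  congr 1
  ext i
  simp

theorem mpow_one {A : Matrix ι ι ℂ} (hA : A.IsHermitian) : mpow A 1 = A := by
  obtain ⟨U, d, rfl⟩ := exists_conjDiag hA
  rw [mpow_conjDiag]
  simp

theorem mpow_kronecker_mul {Ψ : Matrix ι ι ℂ} {Φ : Matrix κ κ ℂ} (hΨ : Ψ.PosDef) (hΦ : Φ.PosDef)
    (q r q' r' : ℝ) :
    (mpow Ψ q ⊗ₖ mpow Φ r) * (mpow Ψ q' ⊗ₖ mpow Φ r') =
      mpow Ψ (q + q') ⊗ₖ mpow Φ (r + r') := by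
  rw [← Matrix.mul_kronecker_mul, mpow_add hΨ, mpow_add hΦ]

end Diagonalization

/-! ### Scalar integrals -/

section ScalarIntegrals

open MeasureTheory Set Filter Topology

/-- `∫₀^∞ f(s) √s ds` as an integral in `x = √s`. -/
theorem integral_sqrt_mul (f : ℝ → ℝ) :
    ∫ s in Ioi (0 : ℝ), s ^ (1 / 2 : ℝ) * f s = ∫ x in Ioi (0 : ℝ), 2 * x ^ 2 * f (x ^ 2) := by
  rw [← integral_comp_rpow_Ioi_of_pos (g := fun s : ℝ => s ^ (1 / 2 : ℝ) * f s) two_pos]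
  refine setIntegral_congr_fun measurableSet_Ioi fun x (hx : 0 < x) => ?_
  have h1 : (x ^ 2) ^ (1 / 2 : ℝ) = x := by
    rw [← Real.sqrt_eq_rpow, Real.sqrt_sq hx.le]
  have h2 : x ^ (2 - 1 : ℝ) = x := by norm_num
  simp only [smul_eq_mul, h2, Real.rpow_two, h1]
  ring

theorem hasDerivAt_arctan_div {a : ℝ} (ha : 0 < a) (x : ℝ) :
    HasDerivAt (fun x => Real.arctan (x / a)) (a / (x ^ 2 + a ^ 2)) x := by
  have h := ((hasDerivAt_id x).div_const a).arctan
  refine h.congr_deriv ?_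
  rw [id_eq]
  field_simp
  ring

theorem tendsto_arctan_div {a : ℝ} (ha : 0 < a) :
    Tendsto (fun x : ℝ => Real.arctan (x / a)) atTop (𝓝 (Real.pi / 2)) :=
  (Real.tendsto_arctan_atTop.mono_right nhdsWithin_le_nhds).comp (tendsto_id.atTop_div_const ha)

theorem integral_Ioi_div_sq_add_sq {a : ℝ} (ha : 0 < a) :
    IntegrableOn (fun x : ℝ => (x ^ 2 + a ^ 2)⁻¹) (Ioi 0) ∧
      ∫ x in Ioi (0 : ℝ), (x ^ 2 + a ^ 2)⁻¹ = Real.pi / (2 * a) := by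
  have hd : ∀ x ∈ Ici (0 : ℝ), HasDerivAt (fun x => Real.arctan (x / a) / a)
      ((x ^ 2 + a ^ 2)⁻¹) x := fun x _ => by
    refine ((hasDerivAt_arctan_div ha x).div_const a).congr_deriv ?_
    rw [div_div_cancel_left' ha.ne']
  have hp : ∀ x ∈ Ioi (0 : ℝ), 0 ≤ (x ^ 2 + a ^ 2)⁻¹ := fun x _ => by positivity
  have hl := (tendsto_arctan_div ha).div_const a
  refine ⟨integrableOn_Ioi_deriv_of_nonneg' hd hp hl, ?_⟩
  rw [integral_Ioi_of_hasDerivAt_of_nonneg' hd hp hl]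
  simp
  field_simp

theorem tendsto_div_sq_add_sq (a : ℝ) :
    Tendsto (fun x : ℝ => x / (x ^ 2 + a ^ 2)) atTop (𝓝 0) := by
  refine squeeze_zero' (g := fun x : ℝ => x⁻¹) ?_ ?_ tendsto_inv_atTop_zero
  · filter_upwards [eventually_gt_atTop 0] with x hx
    positivity
  · filter_upwards [eventually_gt_atTop 0] with x hx
    rw [div_le_iff₀ (by positivity), inv_mul_eq_div, le_div_iff₀ hx]
    nlinarith [sq_nonneg a]

theorem integral_Ioi_sq_div {a b : ℝ} (ha : 0 < a) (hb : 0 < b) :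
    IntegrableOn (fun x : ℝ => x ^ 2 / ((x ^ 2 + a ^ 2) * (x ^ 2 + b ^ 2))) (Ioi 0) ∧
      ∫ x in Ioi (0 : ℝ), x ^ 2 / ((x ^ 2 + a ^ 2) * (x ^ 2 + b ^ 2)) =
        Real.pi / (2 * (a + b)) := by
  rcases eq_or_ne a b with rfl | hab
  · have hd : ∀ x ∈ Ici (0 : ℝ), HasDerivAt
        (fun x => Real.arctan (x / a) / (2 * a) - x / (x ^ 2 + a ^ 2) / 2)
        (x ^ 2 / ((x ^ 2 + a ^ 2) * (x ^ 2 + a ^ 2))) x := fun x _ => by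
      have h1 : HasDerivAt (fun x : ℝ => x ^ 2 + a ^ 2) (2 * x) x := by
        simpa using (hasDerivAt_pow 2 x).add_const (a ^ 2)
      have h2 : x ^ 2 + a ^ 2 ≠ 0 := by positivity
      refine (((hasDerivAt_arctan_div ha x).div_const (2 * a)).sub
        (((hasDerivAt_id x).div h1 h2).div_const 2)).congr_deriv ?_
      rw [id_eq]
      field_simp
      ring
    have hp : ∀ x ∈ Ioi (0 : ℝ), 0 ≤ x ^ 2 / ((x ^ 2 + a ^ 2) * (x ^ 2 + a ^ 2)) :=
      fun x _ => by positivity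
    have hl := ((tendsto_arctan_div ha).div_const (2 * a)).sub
      ((tendsto_div_sq_add_sq a).div_const 2)
    refine ⟨integrableOn_Ioi_deriv_of_nonneg' hd hp hl, ?_⟩
    rw [integral_Ioi_of_hasDerivAt_of_nonneg' hd hp hl]
    simp
    field_simp
    ring
  · have hne : a ^ 2 - b ^ 2 ≠ 0 := by
      rw [sq_sub_sq]
      exact mul_ne_zero (by positivity) (sub_ne_zero.2 hab)
    have hne' : a - b ≠ 0 := sub_ne_zero.2 hab
    have he : ∀ x : ℝ, x ^ 2 / ((x ^ 2 + a ^ 2) * (x ^ 2 + b ^ 2)) =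
        (a ^ 2 / (a ^ 2 - b ^ 2)) * (x ^ 2 + a ^ 2)⁻¹ -
          (b ^ 2 / (a ^ 2 - b ^ 2)) * (x ^ 2 + b ^ 2)⁻¹ := fun x => by
      have : x ^ 2 + a ^ 2 ≠ 0 := by positivity
      have : x ^ 2 + b ^ 2 ≠ 0 := by positivity
      field_simp
      ring
    obtain ⟨h1, h1'⟩ := integral_Ioi_div_sq_add_sq ha
    obtain ⟨h2, h2'⟩ := integral_Ioi_div_sq_add_sq hb
    simp only [he]
    refine ⟨(h1.const_mul _).sub (h2.const_mul _), ?_⟩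
    rw [integral_sub (h1.const_mul _) (h2.const_mul _), integral_const_mul, integral_const_mul,
      h1', h2']
    have : a + b ≠ 0 := by positivity
    rw [sq_sub_sq]
    field_simp

theorem integral_Ioi_sq_div_mul {a b c : ℝ} (ha : 0 < a) (hb : 0 < b) (hc : 0 < c) :
    ∫ x in Ioi (0 : ℝ), x ^ 2 / ((x ^ 2 + a ^ 2) * (x ^ 2 + b ^ 2) * (x ^ 2 + c ^ 2)) =
        Real.pi / (2 * ((a + b) * (b + c) * (c + a))) := by
  -- If two parameters differ, partial fractions reduce to the integral with two factors.
  have key : ∀ {a b c : ℝ}, 0 < a → 0 < b → 0 < c → a ≠ b →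
      ∫ x in Ioi (0 : ℝ), x ^ 2 / ((x ^ 2 + a ^ 2) * (x ^ 2 + b ^ 2) * (x ^ 2 + c ^ 2)) =
        Real.pi / (2 * ((a + b) * (b + c) * (c + a))) := by
    intro a b c ha hb hc hab
    have hne' : a - b ≠ 0 := sub_ne_zero.2 hab
    have hne : a ^ 2 - b ^ 2 ≠ 0 := by
      rw [sq_sub_sq]
      exact mul_ne_zero (by positivity) hne'
    have he : ∀ x : ℝ, x ^ 2 / ((x ^ 2 + a ^ 2) * (x ^ 2 + b ^ 2) * (x ^ 2 + c ^ 2)) =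
        (a ^ 2 - b ^ 2)⁻¹ * (x ^ 2 / ((x ^ 2 + b ^ 2) * (x ^ 2 + c ^ 2))) -
          (a ^ 2 - b ^ 2)⁻¹ * (x ^ 2 / ((x ^ 2 + a ^ 2) * (x ^ 2 + c ^ 2))) := fun x => by
      have : x ^ 2 + a ^ 2 ≠ 0 := by positivity
      have : x ^ 2 + b ^ 2 ≠ 0 := by positivity
      have : x ^ 2 + c ^ 2 ≠ 0 := by positivity
      field_simp
      ring
    obtain ⟨h1, h1'⟩ := integral_Ioi_sq_div hb hc
    obtain ⟨h2, h2'⟩ := integral_Ioi_sq_div ha hc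
    simp only [he]
    rw [integral_sub (h1.const_mul _) (h2.const_mul _), integral_const_mul, integral_const_mul,
      h1', h2', sq_sub_sq]
    have : a + b ≠ 0 := by positivity
    field_simp
    ring
  by_cases hab : a = b
  · by_cases hbc : b = c
    · subst hab hbc
      have hd : ∀ x ∈ Ici (0 : ℝ), HasDerivAt
          (fun x => Real.arctan (x / a) / (8 * a ^ 3) +
            (x / (x ^ 2 + a ^ 2)) / (8 * a ^ 2) - (x / (x ^ 2 + a ^ 2)) * (x ^ 2 + a ^ 2)⁻¹ / 4)
          (x ^ 2 / ((x ^ 2 + a ^ 2) * (x ^ 2 + a ^ 2) * (x ^ 2 + a ^ 2))) x := fun x _ => by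
        have h1 : HasDerivAt (fun x : ℝ => x ^ 2 + a ^ 2) (2 * x) x := by
          simpa using (hasDerivAt_pow 2 x).add_const (a ^ 2)
        have h2 : x ^ 2 + a ^ 2 ≠ 0 := by positivity
        have h3 := (hasDerivAt_id' x).fun_div h1 h2
        refine ((((hasDerivAt_arctan_div ha x).div_const (8 * a ^ 3)).fun_add
          (h3.div_const (8 * a ^ 2))).fun_sub
          ((h3.fun_mul (h1.fun_inv h2)).div_const 4)).congr_deriv ?_
        field_simp
        ring
      have hp : ∀ x ∈ Ioi (0 : ℝ),
          0 ≤ x ^ 2 / ((x ^ 2 + a ^ 2) * (x ^ 2 + a ^ 2) * (x ^ 2 + a ^ 2)) :=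
        fun x _ => by positivity
      have h0 : Tendsto (fun x : ℝ => (x ^ 2 + a ^ 2)⁻¹) atTop (𝓝 0) :=
        (tendsto_atTop_add_const_right _ _ (tendsto_pow_atTop two_ne_zero)).inv_tendsto_atTop
      have hl := (((tendsto_arctan_div ha).div_const (8 * a ^ 3)).add
        ((tendsto_div_sq_add_sq a).div_const (8 * a ^ 2))).sub
        (((tendsto_div_sq_add_sq a).mul h0).div_const 4)
      rw [integral_Ioi_of_hasDerivAt_of_nonneg' hd hp hl]
      simp
      field_simp
      ring
    · rw [show (a + b) * (b + c) * (c + a) = (b + c) * (c + a) * (a + b) by ring,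
        ← key hb hc ha hbc]
      refine integral_congr_ae (ae_of_all _ fun x => ?_)
      ring
  · exact key ha hb hc hab

theorem integrableOn_sqrt_mul {f : ℝ → ℝ}
    (h : IntegrableOn (fun x : ℝ => 2 * x ^ 2 * f (x ^ 2)) (Ioi 0)) :
    IntegrableOn (fun s : ℝ => s ^ (1 / 2 : ℝ) * f s) (Ioi 0) := by
  rw [← integrableOn_Ioi_comp_rpow_iff _ (two_ne_zero (α := ℝ))]
  refine IntegrableOn.congr_fun h (fun x (hx : 0 < x) => ?_) measurableSet_Ioi
  have h1 : (x ^ 2) ^ (1 / 2 : ℝ) = x := by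
    rw [← Real.sqrt_eq_rpow, Real.sqrt_sq hx.le]
  have h2 : x ^ (2 - 1 : ℝ) = x := by norm_num
  simp only [smul_eq_mul, h2, Real.rpow_two, h1]
  norm_num
  ring

/-- The numerator is reduced to `(s + c²) + (κ - c²)`, which leaves the integrals with two and with
three factors in the denominator. -/
theorem integral_sqrt_mul_div {a b c : ℝ} (ha : 0 < a) (hb : 0 < b) (hc : 0 < c) (κ : ℝ) :
    IntegrableOn (fun s : ℝ => s ^ (1 / 2 : ℝ) *
      ((s + κ) / ((s + a ^ 2) * (s + b ^ 2) * (s + c ^ 2)))) (Ioi 0) ∧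
    ∫ s in Ioi (0 : ℝ), s ^ (1 / 2 : ℝ) *
        ((s + κ) / ((s + a ^ 2) * (s + b ^ 2) * (s + c ^ 2))) =
      Real.pi * (a * b + b * c + c * a + κ) / ((a + b) * (b + c) * (c + a)) := by
  have he : ∀ x : ℝ, 2 * x ^ 2 * ((x ^ 2 + κ) /
      ((x ^ 2 + a ^ 2) * (x ^ 2 + b ^ 2) * (x ^ 2 + c ^ 2))) =
      2 * (x ^ 2 / ((x ^ 2 + a ^ 2) * (x ^ 2 + b ^ 2))) + 2 * (κ - c ^ 2) *
        (x ^ 2 / ((x ^ 2 + a ^ 2) * (x ^ 2 + b ^ 2) * (x ^ 2 + c ^ 2))) := fun x => by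
    have : x ^ 2 + a ^ 2 ≠ 0 := by positivity
    have : x ^ 2 + b ^ 2 ≠ 0 := by positivity
    have : x ^ 2 + c ^ 2 ≠ 0 := by positivity
    field_simp
    ring
  obtain ⟨h1, h1'⟩ := integral_Ioi_sq_div ha hb
  have h2 : IntegrableOn (fun x : ℝ =>
      x ^ 2 / ((x ^ 2 + a ^ 2) * (x ^ 2 + b ^ 2) * (x ^ 2 + c ^ 2))) (Ioi 0) := by
    -- a non-integrable function would have integral zero
    refine not_imp_comm.1 integral_undef ?_
    rw [integral_Ioi_sq_div_mul ha hb hc]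
    positivity
  constructor
  · refine integrableOn_sqrt_mul
      (f := fun s => (s + κ) / ((s + a ^ 2) * (s + b ^ 2) * (s + c ^ 2))) ?_
    simp only [he]
    exact (h1.const_mul _).add (h2.const_mul _)
  rw [integral_sqrt_mul fun s => (s + κ) / ((s + a ^ 2) * (s + b ^ 2) * (s + c ^ 2))]
  simp only [he]
  rw [integral_add (h1.const_mul _) (h2.const_mul _), integral_const_mul, integral_const_mul, h1',
    integral_Ioi_sq_div_mul ha hb hc]
  field_simp
  ring

/-- The two scalar integrals in an entry of `cross`, in an eigenbasis of `crossPsi`; the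
parameters `x, y, z` are three eigenvalues. Their sum collapses, after cancellation of `1 + s`, to
an integral with three simple poles. -/
theorem integral_cross_entry {x y z α β γ : ℝ} (hα : 0 < α) (hβ : 0 < β) (hγ : 0 < γ)
    (hx : α ^ 2 = 1 - x ^ 2) (hy : β ^ 2 = 1 - y ^ 2) (hz : γ ^ 2 = 1 - z ^ 2) :
    IntegrableOn (fun s : ℝ => s ^ (1 / 2 : ℝ) * (1 + s)⁻¹ *
      ((1 + s) / (1 + s - x ^ 2) *
        ((1 + s) ^ (-1 / 2 : ℝ) + (1 + s) ^ (-3 / 2 : ℝ) * (x * y)) *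
        ((1 + s) / (1 + s - y ^ 2)) *
        ((1 + s) ^ (-1 / 2 : ℝ) + (1 + s) ^ (-3 / 2 : ℝ) * (z * y)) *
        ((1 + s) / (1 + s - z ^ 2)))) (Ioi 0) ∧
    IntegrableOn (fun s : ℝ => s ^ (1 / 2 : ℝ) * (1 + s)⁻¹ ^ 3 *
      ((1 + s) / (1 + s - x ^ 2) * ((1 + s) / (1 + s - z ^ 2)))) (Ioi 0) ∧
    (∫ s in Ioi (0 : ℝ), s ^ (1 / 2 : ℝ) * (1 + s)⁻¹ *
      ((1 + s) / (1 + s - x ^ 2) *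
        ((1 + s) ^ (-1 / 2 : ℝ) + (1 + s) ^ (-3 / 2 : ℝ) * (x * y)) *
        ((1 + s) / (1 + s - y ^ 2)) *
        ((1 + s) ^ (-1 / 2 : ℝ) + (1 + s) ^ (-3 / 2 : ℝ) * (z * y)) *
        ((1 + s) / (1 + s - z ^ 2)))) +
    x * z * (∫ s in Ioi (0 : ℝ), s ^ (1 / 2 : ℝ) * (1 + s)⁻¹ ^ 3 *
      ((1 + s) / (1 + s - x ^ 2) * ((1 + s) / (1 + s - z ^ 2)))) =
      Real.pi * (α * β + β * γ + γ * α + (1 + x * y + y * z + x * z)) /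
        ((α + β) * (β + γ) * (γ + α)) := by
  obtain ⟨h1, h1'⟩ := integral_sqrt_mul_div hα hβ hγ (1 + x * y + y * z + x * z)
  have h2 : IntegrableOn (fun s : ℝ => s ^ (1 / 2 : ℝ) * (1 + s)⁻¹ ^ 3 *
      ((1 + s) / (1 + s - x ^ 2) * ((1 + s) / (1 + s - z ^ 2)))) (Ioi 0) := by
    refine IntegrableOn.congr_fun ((integral_sqrt_mul_div hα one_pos hγ 1).1.sub
      (integral_sqrt_mul_div hα one_pos hγ 0).1) (fun s (hs : 0 < s) => ?_) measurableSet_Ioi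
    have e1 : 1 + s - x ^ 2 = s + α ^ 2 := by rw [hx]; ring
    have e3 : 1 + s - z ^ 2 = s + γ ^ 2 := by rw [hz]; ring
    have : s + α ^ 2 ≠ 0 := by positivity
    have : s + γ ^ 2 ≠ 0 := by positivity
    have : 1 + s ≠ 0 := by positivity
    have : s + 1 ≠ 0 := by positivity
    simp only [Pi.sub_apply, e1, e3]
    field_simp
    ring
  have he : EqOn (fun s : ℝ => s ^ (1 / 2 : ℝ) * (1 + s)⁻¹ *
      ((1 + s) / (1 + s - x ^ 2) *
        ((1 + s) ^ (-1 / 2 : ℝ) + (1 + s) ^ (-3 / 2 : ℝ) * (x * y)) *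
        ((1 + s) / (1 + s - y ^ 2)) *
        ((1 + s) ^ (-1 / 2 : ℝ) + (1 + s) ^ (-3 / 2 : ℝ) * (z * y)) *
        ((1 + s) / (1 + s - z ^ 2))))
      (fun s => s ^ (1 / 2 : ℝ) * ((s + (1 + x * y + y * z + x * z)) /
        ((s + α ^ 2) * (s + β ^ 2) * (s + γ ^ 2))) - x * z * (s ^ (1 / 2 : ℝ) * (1 + s)⁻¹ ^ 3 *
      ((1 + s) / (1 + s - x ^ 2) * ((1 + s) / (1 + s - z ^ 2))))) (Ioi 0) := by
    intro s (hs : 0 < s)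
    have e1 : 1 + s - x ^ 2 = s + α ^ 2 := by rw [hx]; ring
    have e2 : 1 + s - y ^ 2 = s + β ^ 2 := by rw [hy]; ring
    have e3 : 1 + s - z ^ 2 = s + γ ^ 2 := by rw [hz]; ring
    have hs1 : 0 < 1 + s := by positivity
    have e4 : (1 + s) ^ (-3 / 2 : ℝ) = (1 + s) ^ (-1 / 2 : ℝ) * (1 + s)⁻¹ := by
      rw [← Real.rpow_neg_one (1 + s), ← Real.rpow_add hs1]
      norm_num
    have e5 : (1 + s) ^ (-1 / 2 : ℝ) * (1 + s) ^ (-1 / 2 : ℝ) = (1 + s)⁻¹ := by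
      rw [← Real.rpow_neg_one (1 + s), ← Real.rpow_add hs1]
      norm_num
    have : s + α ^ 2 ≠ 0 := by positivity
    have : s + β ^ 2 ≠ 0 := by positivity
    have : s + γ ^ 2 ≠ 0 := by positivity
    have : 1 + s ≠ 0 := hs1.ne'
    have hy' : y ^ 2 = 1 - β ^ 2 := by linarith
    calc _ = s ^ (1 / 2 : ℝ) * (1 + s)⁻¹ * ((1 + s) / (s + α ^ 2) * ((1 + s) / (s + β ^ 2)) *
          ((1 + s) / (s + γ ^ 2)) * (1 + (1 + s)⁻¹ * (x * y)) * (1 + (1 + s)⁻¹ * (z * y)) *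
          ((1 + s) ^ (-1 / 2 : ℝ) * (1 + s) ^ (-1 / 2 : ℝ))) := by
          simp only [e1, e2, e3, e4]
          ring
      _ = _ := by
          simp only [e1, e3, e5]
          field_simp
          linear_combination (x * z) * hy'
  refine ⟨IntegrableOn.congr_fun (h1.sub (h2.const_mul (x * z))) he.symm measurableSet_Ioi, h2, ?_⟩
  rw [setIntegral_congr_fun measurableSet_Ioi he, integral_sub h1 (h2.const_mul _),
    integral_const_mul, h1']
  ring

end ScalarIntegrals

/-! ### Smoothness of real powers -/

section Smoothness

open Filter Topology

variable {ι κ : Type*} [Fintype ι] [DecidableEq ι] [Fintype κ] [DecidableEq κ]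

theorem continuous_conjDiag (U : Matrix.unitaryGroup ι ℂ) : Continuous (conjDiag U) :=
  (conjDiag U).toLinearMap.continuous_of_finiteDimensional

theorem exp_conjDiag (U : Matrix.unitaryGroup ι ℂ) (d : ι → ℝ) :
    NormedSpace.exp (conjDiag U d) = conjDiag U fun i => Real.exp (d i) := by
  rw [← CFC.real_exp_eq_normedSpace_exp (conjDiag_isHermitian U d).isSelfAdjoint, cfc_conjDiag]
  rfl

/-- The power series `-∑ Mⁿ / n` of `log (1 - M)`; the coefficient at `n = 0` is `-0⁻¹ = 0`. -/
noncomputable def logOneSub (M : Matrix ι ι ℂ) : Matrix ι ι ℂ :=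
  FormalMultilinearSeries.ofScalarsSum (fun n : ℕ => -(n : ℝ)⁻¹) M

theorem contDiffAt_logOneSub {M : Matrix ι ι ℂ} (hM : ‖M‖ < 1) {N : WithTop ℕ∞} :
    ContDiffAt ℝ N (logOneSub (ι := ι)) M := by
  have hlim : Tendsto (fun n : ℕ => ‖(fun n : ℕ => -(n : ℝ)⁻¹) n.succ‖ /
      ‖(fun n : ℕ => -(n : ℝ)⁻¹) n‖) atTop (𝓝 ((1 : NNReal) : ℝ)) := by
    have h := tendsto_natCast_div_add_atTop (1 : ℝ)
    refine h.congr fun n => ?_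
    have h1 : |(n : ℝ) + 1| = n + 1 := abs_of_nonneg (by positivity)
    simp [h1]
    field_simp
  have hr := FormalMultilinearSeries.inv_le_ofScalars_radius_of_tendsto (Matrix ι ι ℂ)
    (fun n : ℕ => -(n : ℝ)⁻¹) one_ne_zero hlim
  rw [inv_one] at hr
  have hpos : 0 < (FormalMultilinearSeries.ofScalars (Matrix ι ι ℂ)
      (fun n : ℕ => -(n : ℝ)⁻¹)).radius := lt_of_lt_of_le (by simp) hr
  refine ((FormalMultilinearSeries.hasFPowerSeriesOnBall _ hpos).analyticAt_of_mem ?_).contDiffAt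
  refine Metric.eball_subset_eball hr ?_
  have h1 : ‖M‖₊ < 1 := hM
  rw [Metric.mem_eball, edist_zero_right]
  exact ENNReal.coe_lt_one_iff.2 h1

theorem logOneSub_conjDiag (U : Matrix.unitaryGroup ι ℂ) {d : ι → ℝ} (hd : ∀ i, |d i| < 1) :
    logOneSub (conjDiag U d) = conjDiag U fun i => Real.log (1 - d i) := by
  have h1 : HasSum (fun n : ℕ => -(n : ℝ)⁻¹ • d ^ n) fun i => Real.log (1 - d i) := by
    rw [Pi.hasSum]
    intro i
    rw [← hasSum_nat_add_iff' 1]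
    simpa [div_eq_inv_mul, Function.comp_def] using
      (Real.hasSum_pow_div_log_of_abs_lt_one (hd i)).neg
  have h2 := h1.map (conjDiag U) (continuous_conjDiag U)
  rw [logOneSub, FormalMultilinearSeries.ofScalarsSum_eq_tsum, ← h2.tsum_eq]
  simp

/-- Near a positive definite matrix, real powers are given by `A ^ q = exp (q L(A))` with one smooth
function `L`, defined on all nearby matrices and equal to the logarithm on Hermitian ones. -/
theorem exists_smooth_log {A₀ : Matrix ι ι ℂ} (hA₀ : A₀.PosDef) :
    ∃ L : Matrix ι ι ℂ → Matrix ι ι ℂ, (∀ N : WithTop ℕ∞, ContDiffAt ℝ N L A₀) ∧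
      ∀ᶠ A in 𝓝 A₀, A.IsHermitian → A.PosDef ∧ ∀ q : ℝ, mpow A q = NormedSpace.exp (q • L A) := by
  obtain ⟨U, d, hd, rfl⟩ := exists_conjDiag_pos hA₀
  obtain ⟨c, hc0, hc⟩ : ∃ c : ℝ, 0 < c ∧ ∀ i, d i < c := by
    refine ⟨1 + ∑ i, d i, ?_, fun i => ?_⟩
    · have := Finset.sum_nonneg fun i (_ : i ∈ Finset.univ) => (hd i).le
      linarith
    · have := Finset.single_le_sum (fun i _ => (hd i).le) (Finset.mem_univ i)
      linarith
  have hsub : ∀ (V : Matrix.unitaryGroup ι ℂ) (e : ι → ℝ),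
      1 - c⁻¹ • conjDiag V e = conjDiag V fun i => 1 - e i / c := by
    intro V e
    rw [← map_smul, ← map_one (conjDiag V), ← map_sub]
    congr 1
    ext i
    simp [div_eq_inv_mul]
  have hf : ContDiff ℝ (⊤ : WithTop ℕ∞) fun A : Matrix ι ι ℂ => 1 - c⁻¹ • A := by fun_prop
  have hA : ‖1 - c⁻¹ • conjDiag U d‖ < 1 := by
    rw [hsub, conjDiag_apply, norm_conj, Matrix.l2_opNorm_diagonal, pi_norm_lt_iff one_pos]
    intro i
    have h1 := div_pos (hd i) hc0
    have h2 := (div_lt_one hc0).2 (hc i)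
    rw [Complex.norm_real, Real.norm_eq_abs, abs_lt]
    constructor <;> linarith
  -- `log A = log c + log (1 - (1 - A / c))`, where `c` exceeds all eigenvalues of `A₀`
  refine ⟨fun A => Real.log c • 1 + logOneSub (1 - c⁻¹ • A), fun N => ?_, ?_⟩
  · exact contDiffAt_const.add
      (ContDiffAt.comp (conjDiag U d) (g := logOneSub) (f := fun A => 1 - c⁻¹ • A)
        (contDiffAt_logOneSub hA) (hf.contDiffAt.of_le le_top))
  · have hcont : ContinuousAt (fun A : Matrix ι ι ℂ => ‖1 - c⁻¹ • A‖) (conjDiag U d) :=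
      hf.continuous.norm.continuousAt
    filter_upwards [hcont.eventually_lt continuousAt_const hA] with A hA1 hAH
    obtain ⟨V, e, rfl⟩ := exists_conjDiag hAH
    have he : ∀ i, |1 - e i / c| < 1 := fun i => by
      rw [hsub] at hA1
      exact (abs_le_norm_conjDiag V _ i).trans_lt hA1
    have hepos : ∀ i, 0 < e i := fun i => by
      have := (abs_lt.1 (he i)).2
      have : 0 < e i / c := by linarith
      exact (div_pos_iff_of_pos_right hc0).1 this
    refine ⟨(posDef_conjDiag_iff V e).2 hepos, fun q => ?_⟩
    rw [hsub, logOneSub_conjDiag V he, ← map_one (conjDiag V), ← map_smul, ← map_add, ← map_smul,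
      exp_conjDiag, mpow_conjDiag]
    congr 1
    ext i
    rw [Real.rpow_def_of_pos (hepos i)]
    simp [Real.log_div (hepos i).ne' hc0.ne', mul_comm]

theorem eventually_posDef {A : ℝ → Matrix ι ι ℂ} {t₀ : ℝ} (hA : ContinuousAt A t₀)
    (hH : ∀ t, (A t).IsHermitian) (h0 : (A t₀).PosDef) : ∀ᶠ t in 𝓝 t₀, (A t).PosDef := by
  obtain ⟨L, -, hL⟩ := exists_smooth_log h0
  filter_upwards [hA.eventually hL] with t ht using (ht (hH t)).1

/-- `(q, t) ↦ A(t) ^ q` is jointly smooth. -/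
theorem contDiffAt_mpow {A : ℝ → Matrix ι ι ℂ} {t₀ : ℝ} {N : WithTop ℕ∞}
    (hA : ContDiffAt ℝ N A t₀) (hH : ∀ t, (A t).IsHermitian) (h0 : (A t₀).PosDef) (q₀ : ℝ) :
    ContDiffAt ℝ N (fun x : ℝ × ℝ => mpow (A x.2) x.1) (q₀, t₀) := by
  obtain ⟨L, hL, hL'⟩ := exists_smooth_log h0
  have h1 : ContDiffAt ℝ N (fun x : ℝ × ℝ => NormedSpace.exp (x.1 • L (A x.2))) (q₀, t₀) := by
    refine ContDiffAt.comp (q₀, t₀) (g := NormedSpace.exp)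
      (NormedSpace.exp_analytic (𝕂 := ℝ) _).contDiffAt (contDiffAt_fst.smul ?_)
    exact ContDiffAt.comp (q₀, t₀) (g := L) (hL N)
      (ContDiffAt.comp (q₀, t₀) (g := A) hA contDiffAt_snd)
  refine h1.congr_of_eventuallyEq ?_
  have h2 : ContinuousAt (fun x : ℝ × ℝ => A x.2) (q₀, t₀) :=
    ContinuousAt.comp (g := A) hA.continuousAt continuousAt_snd
  filter_upwards [h2.eventually hL'] with x hx using (hx (hH x.2)).2 x.1

/-- `A ↦ A ⊗ 1` as a continuous linear map. -/
noncomputable def kronLeft (ι κ : Type*) [Fintype ι] [DecidableEq ι] [Fintype κ] [DecidableEq κ] :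
    Matrix ι ι ℂ →L[ℝ] Matrix (ι × κ) (ι × κ) ℂ :=
  LinearMap.toContinuousLinearMap ((Matrix.kroneckerBilinear (R := ℝ)).flip (1 : Matrix κ κ ℂ))

/-- `B ↦ 1 ⊗ B` as a continuous linear map. -/
noncomputable def kronRight (ι κ : Type*) [Fintype ι] [DecidableEq ι] [Fintype κ] [DecidableEq κ] :
    Matrix κ κ ℂ →L[ℝ] Matrix (ι × κ) (ι × κ) ℂ :=
  LinearMap.toContinuousLinearMap (Matrix.kroneckerBilinear (R := ℝ) (1 : Matrix ι ι ℂ))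

theorem kronLeft_apply (A : Matrix ι ι ℂ) : kronLeft ι κ A = A ⊗ₖ (1 : Matrix κ κ ℂ) := rfl

theorem kronRight_apply (B : Matrix κ κ ℂ) : kronRight ι κ B = (1 : Matrix ι ι ℂ) ⊗ₖ B := rfl

end Smoothness

/-! ### The Lyapunov equation `K Q + Q K = F` -/

section Lyapunov

open MeasureTheory Set Filter Topology

variable {ι : Type*} [Fintype ι] [DecidableEq ι]

/-- The solution `∫₀^∞ e^(-sK) F e^(-sK) ds` of the Lyapunov equation `K Q + Q K = F`. -/
noncomputable def lyap (K F : Matrix ι ι ℂ) : Matrix ι ι ℂ :=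
  ∫ s in Ioi (0 : ℝ), NormedSpace.exp (-(s • K)) * F * NormedSpace.exp (-(s • K))

theorem exp_neg_smul_conjDiag (U : Matrix.unitaryGroup ι ℂ) (k : ι → ℝ) (s : ℝ) :
    NormedSpace.exp (-(s • conjDiag U k)) = conjDiag U fun i => Real.exp (-(s * k i)) := by
  rw [← map_smul, ← map_neg, exp_conjDiag]
  rfl

theorem norm_exp_neg_smul_le {U : Matrix.unitaryGroup ι ℂ} {k : ι → ℝ} {c : ℝ}
    (hk : ∀ i, c ≤ k i) {s : ℝ} (hs : 0 ≤ s) :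
    ‖NormedSpace.exp (-(s • conjDiag U k))‖ ≤ Real.exp (-(s * c)) := by
  rw [exp_neg_smul_conjDiag]
  refine norm_conjDiag_le (Real.exp_pos _).le fun i => ?_
  rw [abs_of_pos (Real.exp_pos _), Real.exp_le_exp]
  have := mul_le_mul_of_nonneg_left (hk i) hs
  linarith

theorem norm_lyap_integrand_le {U : Matrix.unitaryGroup ι ℂ} {k : ι → ℝ} {c : ℝ}
    (hk : ∀ i, c ≤ k i) (F : Matrix ι ι ℂ) {s : ℝ} (hs : 0 ≤ s) :
    ‖NormedSpace.exp (-(s • conjDiag U k)) * F * NormedSpace.exp (-(s • conjDiag U k))‖ ≤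
      ‖F‖ * Real.exp (-(2 * c) * s) := by
  have h := norm_exp_neg_smul_le (U := U) hk hs
  calc _ ≤ ‖NormedSpace.exp (-(s • conjDiag U k))‖ * ‖F‖ *
        ‖NormedSpace.exp (-(s • conjDiag U k))‖ :=
        (norm_mul_le _ _).trans (mul_le_mul_of_nonneg_right (norm_mul_le _ _) (norm_nonneg _))
    _ ≤ Real.exp (-(s * c)) * ‖F‖ * Real.exp (-(s * c)) := by gcongr
    _ = _ := by
        rw [show -(2 * c) * s = -(s * c) + -(s * c) by ring, Real.exp_add]
        ring

theorem continuous_exp_neg_smul (K : Matrix ι ι ℂ) :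
    Continuous fun s : ℝ => NormedSpace.exp (-(s • K)) :=
  Continuous.comp (g := NormedSpace.exp)
    (continuous_iff_continuousAt.2 fun M => (NormedSpace.exp_analytic (𝕂 := ℝ) M).continuousAt)
    (by fun_prop)

theorem exists_pos_le {ι : Type*} [Finite ι] {k : ι → ℝ} (hk : ∀ i, 0 < k i) :
    ∃ c : ℝ, 0 < c ∧ ∀ i, c ≤ k i := by
  rcases isEmpty_or_nonempty ι with h | h
  · exact ⟨1, one_pos, fun i => h.elim i⟩
  · obtain ⟨i, hi⟩ := Finite.exists_min k
    exact ⟨k i, hk i, hi⟩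

theorem integrableOn_lyap {K : Matrix ι ι ℂ} (hK : K.PosDef) (F : Matrix ι ι ℂ) :
    IntegrableOn (fun s : ℝ => NormedSpace.exp (-(s • K)) * F * NormedSpace.exp (-(s • K)))
      (Ioi 0) := by
  have hc := (((continuous_exp_neg_smul K).mul_const F).mul
    (continuous_exp_neg_smul K)).aestronglyMeasurable (μ := volume.restrict (Ioi 0))
  obtain ⟨U, k, hk, rfl⟩ := exists_conjDiag_pos hK
  obtain ⟨c, hc0, hck⟩ := exists_pos_le hk
  refine Integrable.mono' (g := fun s => ‖F‖ * Real.exp (-(2 * c) * s))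
    ((exp_neg_integrableOn_Ioi 0 (by positivity)).const_mul _) hc ?_
  exact ae_restrict_of_forall_mem measurableSet_Ioi fun s hs =>
    norm_lyap_integrand_le hck F (mem_Ioi.1 hs).le

/-- The Lyapunov equation has at most one solution: the integrand of `lyap` is the derivative of
`-e^(-sK) Q e^(-sK)`, which tends to `0`. -/
theorem lyap_eq_of_mul_add_mul {K Q F : Matrix ι ι ℂ} (hK : K.PosDef) (hQ : K * Q + Q * K = F) :
    lyap K F = Q := by
  have hd : ∀ s ∈ Ici (0 : ℝ), HasDerivAt
      (fun s : ℝ => -(NormedSpace.exp (-(s • K)) * Q * NormedSpace.exp (-(s • K))))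
      (NormedSpace.exp (-(s • K)) * F * NormedSpace.exp (-(s • K))) s := by
    intro s _
    have h1 := hasDerivAt_exp_smul_const (-K) s
    have h2 := hasDerivAt_exp_smul_const' (-K) s
    simp only [smul_neg] at h1 h2
    refine ((h1.mul_const Q).mul h2).neg.congr_deriv ?_
    rw [← hQ]
    noncomm_ring
  have hl : Tendsto (fun s : ℝ => -(NormedSpace.exp (-(s • K)) * Q * NormedSpace.exp (-(s • K))))
      atTop (𝓝 0) := by
    obtain ⟨U, k, hk, rfl⟩ := exists_conjDiag_pos hK
    obtain ⟨c, hc0, hck⟩ := exists_pos_le hk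
    refine squeeze_zero_norm' (a := fun s => ‖Q‖ * Real.exp (-(2 * c) * s)) ?_ ?_
    · filter_upwards [eventually_ge_atTop 0] with s hs
      rw [norm_neg]
      exact norm_lyap_integrand_le hck Q hs
    · rw [← mul_zero ‖Q‖]
      refine (Real.tendsto_exp_atBot.comp ?_).const_mul _
      exact tendsto_id.const_mul_atTop_of_neg (by linarith)
  rw [lyap, integral_Ioi_of_hasDerivAt_of_tendsto' hd (integrableOn_lyap hK F) hl]
  simp

theorem lyap_add {K : Matrix ι ι ℂ} (hK : K.PosDef) (F₁ F₂ : Matrix ι ι ℂ) :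
    lyap K (F₁ + F₂) = lyap K F₁ + lyap K F₂ := by
  rw [lyap, lyap, lyap, ← integral_add (integrableOn_lyap hK F₁) (integrableOn_lyap hK F₂)]
  simp only [mul_add, add_mul]

theorem lyap_zero (K : Matrix ι ι ℂ) : lyap K 0 = 0 := by simp [lyap]

theorem lyap_sum {α : Type*} {K : Matrix ι ι ℂ} (hK : K.PosDef) (s : Finset α)
    (F : α → Matrix ι ι ℂ) : lyap K (∑ x ∈ s, F x) = ∑ x ∈ s, lyap K (F x) := by
  classical
  induction s using Finset.induction_on with
  | empty => simp [lyap_zero]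
  | insert a s ha ih => rw [Finset.sum_insert ha, Finset.sum_insert ha, lyap_add hK, ih]

theorem exp_neg_smul_commute (K : Matrix ι ι ℂ) (s : ℝ) :
    Commute K (NormedSpace.exp (-(s • K))) :=
  (((Commute.refl K).smul_right s).neg_right).exp_right

theorem mul_lyap_add_lyap_mul {K : Matrix ι ι ℂ} (hK : K.PosDef) (F : Matrix ι ι ℂ) :
    K * lyap K F + lyap K F * K = F := by
  have hI := integrableOn_lyap hK F
  have h1 : lyap K (K * F) = K * lyap K F := by
    have := (ContinuousLinearMap.mul ℝ (Matrix ι ι ℂ) K).integral_comp_comm hI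
    simp only [ContinuousLinearMap.mul_apply'] at this
    rw [lyap, lyap, ← this]
    refine integral_congr_ae (ae_of_all _ fun s => ?_)
    simp only [← mul_assoc, (exp_neg_smul_commute K s).eq]
  have h2 : lyap K (F * K) = lyap K F * K := by
    have := ((ContinuousLinearMap.mul ℝ (Matrix ι ι ℂ)).flip K).integral_comp_comm hI
    simp only [ContinuousLinearMap.flip_apply, ContinuousLinearMap.mul_apply'] at this
    rw [lyap, lyap, ← this]
    refine integral_congr_ae (ae_of_all _ fun s => ?_)
    simp only [mul_assoc, (exp_neg_smul_commute K s).eq]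
  rw [← h1, ← h2, ← lyap_add hK, lyap_eq_of_mul_add_mul hK rfl]

theorem norm_lyap_le {U : Matrix.unitaryGroup ι ℂ} {k : ι → ℝ} {c : ℝ} (hc : 0 < c)
    (hk : ∀ i, c ≤ k i) (F : Matrix ι ι ℂ) :
    ‖lyap (conjDiag U k) F‖ ≤ ‖F‖ / (2 * c) := by
  have hc2 : -(2 * c) < 0 := by linarith
  have h1 : ∫ s in Ioi (0 : ℝ), ‖F‖ * Real.exp (-(2 * c) * s) = ‖F‖ / (2 * c) := by
    rw [integral_const_mul, integral_exp_mul_Ioi hc2]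
    simp
    ring
  rw [← h1]
  refine norm_integral_le_of_norm_le ((exp_neg_integrableOn_Ioi 0 (by positivity)).const_mul _) ?_
  exact ae_restrict_of_forall_mem measurableSet_Ioi fun s hs =>
    norm_lyap_integrand_le hk F (mem_Ioi.1 hs).le

theorem posSemidef_integral {α : Type*} [MeasurableSpace α] {μ : Measure α}
    {M : α → Matrix ι ι ℂ} (hM : ∀ᵐ x ∂μ, (M x).PosSemidef) : (∫ x, M x ∂μ).PosSemidef := by
  open scoped MatrixOrder in
  have h : ∀ᵐ x ∂μ, 0 ≤ M x := hM.mono fun x hx => hx.nonneg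
  open scoped MatrixOrder in
  exact Matrix.nonneg_iff_posSemidef.1 (integral_nonneg_of_ae h)

theorem posSemidef_lyap {K F : Matrix ι ι ℂ} (hK : K.IsHermitian) (hF : F.PosSemidef) :
    (lyap K F).PosSemidef := by
  refine posSemidef_integral (ae_of_all _ fun s => ?_)
  have h : (NormedSpace.exp (-(s • K))).IsHermitian := by
    obtain ⟨U, k, rfl⟩ := exists_conjDiag hK
    rw [exp_neg_smul_conjDiag]
    exact conjDiag_isHermitian U _
  have := hF.mul_mul_conjTranspose_same (NormedSpace.exp (-(s • K)))
  rwa [h.eq] at this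

theorem isClosed_posSemidef : IsClosed {M : Matrix ι ι ℂ | M.PosSemidef} := by
  open scoped MatrixOrder in
  simpa only [Matrix.nonneg_iff_posSemidef] using
    (CStarAlgebra.isClosed_nonneg : IsClosed {M : Matrix ι ι ℂ | 0 ≤ M})

end Lyapunov

/-! ### The matrix `cross` at commuting arguments -/

section Cross

open MeasureTheory Set Filter Topology

variable {ι : Type*} [Fintype ι] [DecidableEq ι]

/-- `M ↦ U M Uᴴ` as a real-linear homeomorphism. -/
noncomputable def conjCLE (U : Matrix.unitaryGroup ι ℂ) : Matrix ι ι ℂ ≃L[ℝ] Matrix ι ι ℂ :=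
  ((conj U).toAlgEquiv.toLinearEquiv.restrictScalars ℝ).toContinuousLinearEquiv

theorem conj_real_smul (U : Matrix.unitaryGroup ι ℂ) (c : ℝ) (M : Matrix ι ι ℂ) :
    conj U (c • M) = c • conj U M :=
  map_smul (conjCLE U) c M

theorem conj_integral (U : Matrix.unitaryGroup ι ℂ) {α : Type*} [MeasurableSpace α]
    (μ : Measure α) (M : α → Matrix ι ι ℂ) :
    conj U (∫ x, M x ∂μ) = ∫ x, conj U (M x) ∂μ :=
  ((conjCLE U).integral_comp_comm M).symm

theorem conj_tsum (U : Matrix.unitaryGroup ι ℂ) (M : ℕ → Matrix ι ι ℂ) :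
    conj U (∑' k, M k) = ∑' k, conj U (M k) :=
  (conjCLE U).map_tsum

theorem conj_conjDiag (U V : Matrix.unitaryGroup ι ℂ) (d : ι → ℝ) :
    conj U (conjDiag V d) = conjDiag (U * V) d := by
  rw [conjDiag_apply, ← Unitary.conjStarAlgAut_mul_apply, conjDiag_apply]

theorem conj_isHermitian (U : Matrix.unitaryGroup ι ℂ) {A : Matrix ι ι ℂ} (hA : A.IsHermitian) :
    (conj U A).IsHermitian :=
  hA.isSelfAdjoint.map (conj U)

theorem mpow_conj (U : Matrix.unitaryGroup ι ℂ) {A : Matrix ι ι ℂ} (hA : A.IsHermitian) (q : ℝ) :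
    mpow (conj U A) q = conj U (mpow A q) := by
  obtain ⟨V, d, rfl⟩ := exists_conjDiag hA
  rw [conj_conjDiag, mpow_conjDiag, mpow_conjDiag, conj_conjDiag]

theorem conj_conjTranspose (U : Matrix.unitaryGroup ι ℂ) (M : Matrix ι ι ℂ) :
    (conj U M)ᴴ = conj U Mᴴ :=
  (map_star (conj U) M).symm

/-- `cross` is equivariant under unitary conjugation. -/
theorem cross_conj (U : Matrix.unitaryGroup ι ℂ) {A B : Matrix ι ι ℂ} (hA : A.IsHermitian)
    (hB : B.IsHermitian) (X Z : Matrix ι ι ℂ) :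
    cross (conj U A) (conj U B) (conj U X) (conj U Z) = conj U (cross A B X Z) := by
  have hS : ((1 / 2 : ℝ) • (A + B)).IsHermitian := (hA.add hB).smul (IsSelfAdjoint.all _)
  have h0 : ∀ q, mpow ((1 / 2 : ℝ) • (conj U A + conj U B)) q =
      conj U (mpow ((1 / 2 : ℝ) • (A + B)) q) := fun q => by
    rw [← map_add, ← conj_real_smul, mpow_conj U hS]
  have h1 : crossPsi (conj U A) (conj U B) = conj U (crossPsi A B) := by
    simp only [crossPsi, meanInvSqrt, h0, map_mul, conj_real_smul, map_sub]
  have h2 : crossT (conj U A) (conj U B) (conj U X) (conj U Z) = conj U (crossT A B X Z) := by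
    simp only [crossT, crossE₁, crossE₂, meanInvSqrt, h0, h1, map_mul, conj_real_smul, map_sub,
      map_add, map_neg]
  have h3 : ∀ s, crossPsiTilde (conj U A) (conj U B) s = conj U (crossPsiTilde A B s) := by
    intro s
    simp only [crossPsiTilde, h1, conj_tsum, conj_real_smul, map_pow]
  have h4 : ∀ s, crossOmega (conj U A) (conj U B) (conj U X) (conj U Z) s =
      conj U (crossOmega A B X Z s) := by
    intro s
    simp only [crossOmega, h1, h2, map_add, map_mul, conj_real_smul]
  simp only [cross, h0, h1, h2, h3, h4, conj_conjTranspose, map_mul, map_add, conj_real_smul,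
    conj_integral]

theorem conjDiag_one (d : ι → ℝ) : conjDiag 1 d = Matrix.diagonal fun i => (d i : ℂ) := by
  simp [conjDiag_apply]

theorem mpow_diagonal (d : ι → ℝ) (q : ℝ) :
    mpow (Matrix.diagonal fun i => (d i : ℂ)) q = Matrix.diagonal fun i => ((d i ^ q : ℝ) : ℂ) := by
  rw [← conjDiag_one, ← conjDiag_one, mpow_conjDiag]

/-- The integral of a matrix-valued function can be computed entrywise. -/
theorem integral_apply_of_integrable {α : Type*} [MeasurableSpace α] {μ : Measure α}
    {M : α → Matrix ι ι ℂ} (hM : ∀ i j, Integrable (fun x => M x i j) μ) (i j : ι) :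
    (∫ x, M x ∂μ) i j = ∫ x, M x i j ∂μ := by
  have h : Integrable M μ := by
    have h1 : M = fun x => ∑ i, ∑ j, M x i j • Matrix.single i j (1 : ℂ) := by
      funext x
      conv_lhs => rw [Matrix.matrix_eq_sum_single (M x)]
      simp
    rw [h1]
    exact integrable_finsetSum _ fun i _ => integrable_finsetSum _ fun j _ =>
      (hM i j).smul_const _
  exact ((Matrix.entryLinearMap ℝ ℂ i j).toContinuousLinearMap.integral_comp_comm h).symm

/-- Here and below `q i` is the square root of the `i`-th entry of the mean of two diagonal
matrices. -/
theorem mpow_mean_diagonal {a b q : ι → ℝ} (hq : ∀ i, 0 < q i)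
    (hs : ∀ i, q i ^ 2 = (a i + b i) / 2) (r : ℝ) :
    mpow ((1 / 2 : ℝ) • ((Matrix.diagonal fun i => (a i : ℂ)) +
      (Matrix.diagonal fun i => (b i : ℂ)))) (r / 2) =
      Matrix.diagonal fun i => ((q i ^ r : ℝ) : ℂ) := by
  have h : (1 / 2 : ℝ) • ((Matrix.diagonal fun i => (a i : ℂ)) +
      (Matrix.diagonal fun i => (b i : ℂ))) = Matrix.diagonal fun i => ((q i ^ 2 : ℝ) : ℂ) := by
    rw [Matrix.diagonal_add, ← Matrix.diagonal_smul]
    congr 1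
    ext i
    rw [hs]
    simp
    ring
  rw [h, mpow_diagonal]
  congr 1
  ext i
  rw [← Real.rpow_two, ← Real.rpow_mul (hq i).le]
  congr 2
  ring

theorem meanInvSqrt_diagonal {a b q : ι → ℝ} (hq : ∀ i, 0 < q i)
    (hs : ∀ i, q i ^ 2 = (a i + b i) / 2) :
    meanInvSqrt (Matrix.diagonal fun i => (a i : ℂ)) (Matrix.diagonal fun i => (b i : ℂ)) =
      Matrix.diagonal fun i => (((q i)⁻¹ : ℝ) : ℂ) := by
  rw [meanInvSqrt, mpow_mean_diagonal hq hs (-1)]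
  simp only [Real.rpow_neg_one]

theorem crossPsi_diagonal {a b q : ι → ℝ} (hq : ∀ i, 0 < q i)
    (hs : ∀ i, q i ^ 2 = (a i + b i) / 2) :
    crossPsi (Matrix.diagonal fun i => (a i : ℂ)) (Matrix.diagonal fun i => (b i : ℂ)) =
      Matrix.diagonal fun i => (((a i - b i) / (2 * q i ^ 2) : ℝ) : ℂ) := by
  rw [crossPsi, meanInvSqrt_diagonal hq hs, Matrix.diagonal_sub, ← Matrix.diagonal_smul,
    Matrix.diagonal_mul_diagonal, Matrix.diagonal_mul_diagonal]
  congr 1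
  ext i
  have : (q i : ℂ) ≠ 0 := by exact_mod_cast (hq i).ne'
  simp
  field_simp

theorem crossPsiTilde_of_diagonal {A B : Matrix ι ι ℂ} {θ : ι → ℝ}
    (h : crossPsi A B = Matrix.diagonal fun i => (θ i : ℂ)) (hθ : ∀ i, θ i ^ 2 < 1) {s : ℝ}
    (hs : 0 < s) :
    crossPsiTilde A B s =
      Matrix.diagonal fun i => (((1 + s) / (1 + s - θ i ^ 2) : ℝ) : ℂ) := by
  have h1 : HasSum (fun k : ℕ => ((1 + s)⁻¹ ^ k) • θ ^ (2 * k))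
      fun i => (1 + s) / (1 + s - θ i ^ 2) := by
    rw [Pi.hasSum]
    intro i
    have h2 := hasSum_geometric_of_lt_one (r := (1 + s)⁻¹ * θ i ^ 2) (by positivity) (by
      rw [inv_mul_lt_iff₀ (by positivity)]
      linarith [hθ i])
    have h3 : (1 - (1 + s)⁻¹ * θ i ^ 2)⁻¹ = (1 + s) / (1 + s - θ i ^ 2) := by
      have := hθ i
      have : 1 + s - θ i ^ 2 ≠ 0 := by linarith
      have : 1 + s ≠ 0 := by positivity
      have h5 : 1 - (1 + s)⁻¹ * θ i ^ 2 = (1 + s - θ i ^ 2) / (1 + s) := by field_simp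
      rw [h5, inv_div]
    rw [h3] at h2
    simpa [mul_pow, pow_mul] using h2
  have h2 := (h1.map (conjDiag 1) (continuous_conjDiag 1)).tsum_eq
  rw [crossPsiTilde, h, ← conjDiag_one, ← conjDiag_one, ← h2]
  simp only [Function.comp_def, map_smul, map_pow]

/-- The entries of `cross A (A K²) X Z` for diagonal `A = diag(a)` and `K = diag(k)`: in terms of
`K₁` every entry is a sum over `m` of the scalar integrals with the eigenvalues
`(1 - k²) / (1 + k²)` of `crossPsi` at the indices `i, m, j`. -/
theorem cross_diagonal {a k : ι → ℝ} (ha : ∀ i, 0 < a i) (hk : ∀ i, 0 < k i)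
    {X Z K₁ : Matrix ι ι ℂ} (hK₁ : K₁.IsHermitian)
    (h : ∀ i j, Z i j - (k i : ℂ) ^ 2 * X i j = (k i + k j) * a j * K₁ i j) (i j : ι) :
    (k i + k j : ℂ) * cross (Matrix.diagonal fun i => (a i : ℂ))
      (Matrix.diagonal fun i => ((a i * k i ^ 2 : ℝ) : ℂ)) X Z i j =
      ∑ m, K₁ i m * a m * K₁ m j := by
  set b : ι → ℝ := fun i => a i * k i ^ 2
  set q : ι → ℝ := fun i => √((a i + b i) / 2)
  have hb : ∀ i, 0 < b i := fun i => mul_pos (ha i) (pow_pos (hk i) 2)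
  have hs : ∀ i, q i ^ 2 = (a i + b i) / 2 := fun i =>
    Real.sq_sqrt (by have := ha i; have := hb i; positivity)
  have hq : ∀ i, 0 < q i := fun i => Real.sqrt_pos.2 (by have := ha i; have := hb i; positivity)
  set A := Matrix.diagonal fun i => (a i : ℂ)
  set B := Matrix.diagonal fun i => (b i : ℂ)
  set θ : ι → ℝ := fun i => (1 - k i ^ 2) / (1 + k i ^ 2)
  -- `α = √(1 - θ²)` is rational in `k`
  set α : ι → ℝ := fun i => 2 * k i / (1 + k i ^ 2)
  have hαθ : ∀ i, α i ^ 2 = 1 - θ i ^ 2 := fun i => by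
    simp only [α, θ]
    field_simp
    ring
  have hα : ∀ i, 0 < α i := fun i => by have := hk i; positivity
  have hθ : ∀ i, θ i ^ 2 < 1 := fun i => by
    have := hαθ i
    have := pow_pos (hα i) 2
    linarith
  have hqa : ∀ i, q i ^ 2 = a i * (1 + k i ^ 2) / 2 := fun i => by
    rw [hs]
    simp only [b]
    ring
  have hψ : crossPsi A B = Matrix.diagonal fun i => (θ i : ℂ) := by
    rw [crossPsi_diagonal hq hs]
    congr 1
    ext i
    rw [hqa]
    simp only [b, θ]
    have := (ha i).ne'
    congr 1
    field_simp
  -- The matrix `T` is a rescaling of `K₁`.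
  set τ : ι → ι → ℝ := fun i j => -(a i * a j * (k i + k j)) / (2 * q i ^ 3 * q j)
  have hT : ∀ i j, crossT A B X Z i j = τ i j * K₁ i j := by
    intro i j
    have hqi : (q i : ℂ) ≠ 0 := by exact_mod_cast (hq i).ne'
    have hqj : (q j : ℂ) ≠ 0 := by exact_mod_cast (hq j).ne'
    have hqa' : (q i : ℂ) ^ 2 = a i * (1 + k i ^ 2) / 2 := by exact_mod_cast hqa i
    have hk' : (1 + (k i : ℂ) ^ 2) ≠ 0 := by
      have : (1 + k i ^ 2) ≠ 0 := by positivity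
      exact_mod_cast this
    have hZ : Z i j = (k i : ℂ) ^ 2 * X i j + (k i + k j) * a j * K₁ i j := by rw [← h]; ring
    have e : crossT A B X Z i j = ((q i : ℂ)⁻¹ * ((1 / 2) * (X i j - Z i j)) * (q j : ℂ)⁻¹) +
        (θ i : ℂ) * -((q i : ℂ)⁻¹ * ((1 / 2) * (X i j + Z i j)) * (q j : ℂ)⁻¹) := by
      rw [crossT, crossE₁, crossE₂, hψ, meanInvSqrt_diagonal hq hs]
      simp only [Matrix.add_apply, Matrix.diagonal_mul, Matrix.mul_diagonal, Matrix.neg_apply,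
        Matrix.smul_apply, Matrix.sub_apply, Complex.real_smul]
      push_cast
      ring
    have ha' : (a i : ℂ) = 2 * q i ^ 2 / (1 + k i ^ 2) := by
      rw [hqa']
      field_simp
    rw [e, hZ]
    simp only [θ, τ]
    push_cast
    rw [ha']
    field_simp
    ring
  have hT' : ∀ i j, (crossT A B X Z)ᴴ i j = τ j i * K₁ i j := by
    intro i j
    rw [Matrix.conjTranspose_apply, hT, star_mul', ← Matrix.conjTranspose_apply K₁, hK₁.eq]
    simp
  have hΩ : ∀ s i j, crossOmega A B X Z s i j = (((1 + s) ^ (-1 / 2 : ℝ) +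
      (1 + s) ^ (-3 / 2 : ℝ) * (θ i * θ j) : ℝ) : ℂ) * (τ i j * K₁ i j) := by
    intro s i j
    rw [crossOmega, hψ]
    simp only [Matrix.add_apply, Matrix.diagonal_mul, Matrix.mul_diagonal,
        Matrix.smul_apply, Complex.real_smul, hT]
    push_cast
    ring
  have hΩ' : ∀ s i j, (crossOmega A B X Z s)ᴴ i j = (((1 + s) ^ (-1 / 2 : ℝ) +
      (1 + s) ^ (-3 / 2 : ℝ) * (θ j * θ i) : ℝ) : ℂ) * (τ j i * K₁ i j) := by
    intro s i j
    rw [Matrix.conjTranspose_apply, hΩ, star_mul', star_mul', ← Matrix.conjTranspose_apply K₁,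
      hK₁.eq]
    simp
  -- The entries of the two integrands.
  set c : ι → ι → ι → ℂ := fun i m j => τ i m * K₁ i m * (τ j m * K₁ m j)
  set g₁ : ι → ι → ι → ℝ → ℝ := fun i m j s => s ^ (1 / 2 : ℝ) * (1 + s)⁻¹ *
      ((1 + s) / (1 + s - θ i ^ 2) *
        ((1 + s) ^ (-1 / 2 : ℝ) + (1 + s) ^ (-3 / 2 : ℝ) * (θ i * θ m)) *
        ((1 + s) / (1 + s - θ m ^ 2)) *
        ((1 + s) ^ (-1 / 2 : ℝ) + (1 + s) ^ (-3 / 2 : ℝ) * (θ j * θ m)) *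
        ((1 + s) / (1 + s - θ j ^ 2))) with hg₁
  set g₂ : ι → ι → ℝ → ℝ := fun i j s => s ^ (1 / 2 : ℝ) * (1 + s)⁻¹ ^ 3 *
      ((1 + s) / (1 + s - θ i ^ 2) * ((1 + s) / (1 + s - θ j ^ 2))) with hg₂
  have hg : ∀ i m j, IntegrableOn (g₁ i m j) (Ioi 0) ∧ IntegrableOn (g₂ i j) (Ioi 0) ∧
      (∫ s in Ioi (0 : ℝ), g₁ i m j s) + θ i * θ j * (∫ s in Ioi (0 : ℝ), g₂ i j s) =
      Real.pi * (α i * α m + α m * α j + α j * α i + (1 + θ i * θ m + θ m * θ j + θ i * θ j)) /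
        ((α i + α m) * (α m + α j) * (α j + α i)) := fun i m j =>
    integral_cross_entry (hα i) (hα m) (hα j) (hαθ i) (hαθ m) (hαθ j)
  have hI₁ : (∫ s in Ioi (0 : ℝ), (s ^ (1 / 2 : ℝ) * (1 + s)⁻¹) •
      (crossPsiTilde A B s * crossOmega A B X Z s * crossPsiTilde A B s *
        (crossOmega A B X Z s)ᴴ * crossPsiTilde A B s)) i j =
      ∑ m, ((∫ s in Ioi (0 : ℝ), g₁ i m j s : ℝ) : ℂ) * c i m j := by
    have e : EqOn (fun s : ℝ => (s ^ (1 / 2 : ℝ) * (1 + s)⁻¹) •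
        (crossPsiTilde A B s * crossOmega A B X Z s * crossPsiTilde A B s *
          (crossOmega A B X Z s)ᴴ * crossPsiTilde A B s))
        (fun s => Matrix.of fun i j => ∑ m, (g₁ i m j s : ℂ) * c i m j) (Ioi 0) := by
      intro s hs
      ext i j
      simp only [crossPsiTilde_of_diagonal hψ hθ hs]
      rw [Matrix.smul_apply, Matrix.mul_diagonal, Matrix.mul_apply, Matrix.of_apply,
        Finset.sum_mul, Finset.smul_sum]
      refine Finset.sum_congr rfl fun m _ => ?_
      rw [Matrix.mul_diagonal, Matrix.diagonal_mul, hΩ, hΩ', Complex.real_smul]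
      simp only [hg₁, c]
      push_cast
      ring
    rw [setIntegral_congr_fun measurableSet_Ioi e, integral_apply_of_integrable]
    · simp only [Matrix.of_apply]
      rw [integral_finsetSum _ fun m _ => (hg i m j).1.ofReal.mul_const _]
      refine Finset.sum_congr rfl fun m _ => ?_
      rw [integral_mul_const, integral_complex_ofReal]
    · intro i j
      exact integrable_finsetSum _ fun m _ => (hg i m j).1.ofReal.mul_const _
  have hI₂ : (∫ s in Ioi (0 : ℝ), (s ^ (1 / 2 : ℝ) * (1 + s)⁻¹ ^ 3) •
      (crossPsiTilde A B s * crossT A B X Z * (crossT A B X Z)ᴴ * crossPsiTilde A B s)) i j =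
      ∑ m, ((∫ s in Ioi (0 : ℝ), g₂ i j s : ℝ) : ℂ) * c i m j := by
    have e : EqOn (fun s : ℝ => (s ^ (1 / 2 : ℝ) * (1 + s)⁻¹ ^ 3) •
        (crossPsiTilde A B s * crossT A B X Z * (crossT A B X Z)ᴴ * crossPsiTilde A B s))
        (fun s => Matrix.of fun i j => ∑ m, (g₂ i j s : ℂ) * c i m j) (Ioi 0) := by
      intro s hs
      ext i j
      simp only [crossPsiTilde_of_diagonal hψ hθ hs]
      rw [Matrix.smul_apply, Matrix.mul_diagonal, Matrix.mul_apply, Matrix.of_apply,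
        Finset.sum_mul, Finset.smul_sum]
      refine Finset.sum_congr rfl fun m _ => ?_
      rw [Matrix.diagonal_mul, hT, hT', Complex.real_smul]
      simp only [hg₂, c]
      push_cast
      ring
    rw [setIntegral_congr_fun measurableSet_Ioi e, integral_apply_of_integrable]
    · simp only [Matrix.of_apply]
      rw [integral_finsetSum _ fun m _ => (hg i m j).2.1.ofReal.mul_const _]
      refine Finset.sum_congr rfl fun m _ => ?_
      rw [integral_mul_const, integral_complex_ofReal]
    · intro i j
      exact integrable_finsetSum _ fun m _ => (hg i i j).2.1.ofReal.mul_const _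
  rw [cross, mpow_mean_diagonal hq hs 1, hψ]
  simp only [Real.rpow_one, Matrix.smul_apply, Matrix.diagonal_mul, Matrix.mul_diagonal,
    Matrix.add_apply, hI₁, hI₂, Finset.mul_sum, Finset.sum_mul, ← Finset.sum_add_distrib,
    Finset.smul_sum]
  refine Finset.sum_congr rfl fun m _ => ?_
  -- The remaining identity between real numbers.
  have key : (k i + k j) * (1 / Real.pi * (q i * q j)) * (τ i m * τ j m) *
      ((∫ s in Ioi (0 : ℝ), g₁ i m j s) + θ i * θ j * (∫ s in Ioi (0 : ℝ), g₂ i j s)) = a m := by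
    rw [(hg i m j).2.2]
    have ha' : ∀ i, a i = 2 * q i ^ 2 / (1 + k i ^ 2) := fun i => by
      rw [hqa]
      field_simp
    have hα2 : ∀ i j, α i + α j =
        2 * (k i + k j) * (1 + k i * k j) / ((1 + k i ^ 2) * (1 + k j ^ 2)) := fun i j => by
      simp only [α]
      field_simp
      ring
    have hnum : α i * α m + α m * α j + α j * α i + (1 + θ i * θ m + θ m * θ j + θ i * θ j) =
        4 * ((1 + k i * k m) * (1 + k m * k j) * (1 + k j * k i)) /
          ((1 + k i ^ 2) * (1 + k m ^ 2) * (1 + k j ^ 2)) := by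
      simp only [α, θ]
      field_simp
      ring
    have := hk i
    have := hk j
    have := hk m
    have := hq i
    have := hq j
    have := hq m
    have := Real.pi_pos
    rw [hnum, hα2, hα2, hα2]
    simp only [τ]
    rw [ha' i, ha' j, ha' m]
    field_simp
    ring
  have key' := congrArg (fun x : ℝ => (x : ℂ)) key
  push_cast at key'
  simp only [c, Complex.real_smul]
  rw [← key']
  push_cast
  ring

/-- For commuting positive definite `A` and `K`, and first-order data `X, Z, K₁` that are compatible
with `B = A K²` in the sense that `Z - K² X = (K K₁ + K₁ K) A`, the matrix
`cross A (A K²) X Z` solves the Lyapunov equation with right-hand side `K₁ A K₁`. -/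
theorem cross_lyapunov (U : Matrix.unitaryGroup ι ℂ) {a k : ι → ℝ} (ha : ∀ i, 0 < a i)
    (hk : ∀ i, 0 < k i) {B X Z K₁ : Matrix ι ι ℂ} (hK₁ : K₁.IsHermitian)
    (hB : B = conjDiag U a * conjDiag U k ^ 2)
    (h : Z - conjDiag U k ^ 2 * X = (conjDiag U k * K₁ + K₁ * conjDiag U k) * conjDiag U a) :
    conjDiag U k * cross (conjDiag U a) B X Z + cross (conjDiag U a) B X Z * conjDiag U k =
      K₁ * conjDiag U a * K₁ := by
  obtain ⟨X, rfl⟩ : ∃ M, conj U M = X := ⟨_, conj_conj_symm U X⟩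
  obtain ⟨Z, rfl⟩ : ∃ M, conj U M = Z := ⟨_, conj_conj_symm U Z⟩
  obtain ⟨L, rfl⟩ : ∃ M, conj U M = K₁ := ⟨_, conj_conj_symm U K₁⟩
  have hL : L.IsHermitian := by
    have := conj_isHermitian (star U) hK₁
    rwa [conj_symm_conj] at this
  rw [← map_pow, ← map_mul] at hB
  rw [← map_pow] at h
  rw [hB]
  simp only [conjDiag_apply, ← map_mul, ← map_add, ← map_sub] at h ⊢
  rw [cross_conj U (by rw [← conjDiag_one]; exact conjDiag_isHermitian _ _)
    (by rw [← conjDiag_one]; exact conjDiag_isHermitian _ _)]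
  simp only [← map_mul, ← map_add]
  congr 1
  replace h := (conj U).injective h
  have h' : ∀ i j, Z i j - (k i : ℂ) ^ 2 * X i j = (k i + k j) * a j * L i j := by
    intro i j
    have := congrFun (congrFun h i) j
    simp only [Matrix.sub_apply, Matrix.add_apply, Matrix.mul_diagonal, Matrix.diagonal_mul] at this
    simp only [Pi.pow_apply] at this
    push_cast at this
    rw [this]
    ring
  ext i j
  have := cross_diagonal ha hk hL h' i j
  simp only [Matrix.add_apply, Matrix.mul_diagonal, Matrix.diagonal_mul]
  rw [Matrix.mul_apply]
  simp only [Matrix.mul_diagonal]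
  rw [← this]
  simp only [Pi.mul_apply, Pi.pow_apply]
  ring

end Cross

/-! ### Second derivatives of commuting families -/

section SecondDerivative

open Filter Topology

variable {E F : Type*} [NormedAddCommGroup E] [NormedSpace ℝ E] [NormedAddCommGroup F]
  [NormedSpace ℝ F]

theorem eventually_hasDerivAt {f : ℝ → E} {t₀ : ℝ} (hf : ContDiffAt ℝ 2 f t₀) :
    ∀ᶠ t in 𝓝 t₀, HasDerivAt f (deriv f t) t := by
  filter_upwards [hf.eventually (by simp)] with t ht
  exact (ht.differentiableAt (by simp)).hasDerivAt

theorem hasDerivAt_deriv {f : ℝ → E} {t₀ : ℝ} (hf : ContDiffAt ℝ 2 f t₀) :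
    HasDerivAt (deriv f) (iteratedDeriv 2 f t₀) t₀ := by
  rw [iteratedDeriv_succ, iteratedDeriv_one]
  have h1 : ContDiffAt ℝ 1 (deriv f) t₀ := by
    have h2 : ContDiffAt ℝ 1 (fderiv ℝ f) t₀ := hf.fderiv_right (by norm_num)
    exact h2.clm_apply contDiffAt_const
  exact (h1.differentiableAt (by simp)).hasDerivAt

theorem iteratedDeriv_two_eq {f f' : ℝ → E} {f'' : E} {t₀ : ℝ}
    (h1 : ∀ᶠ t in 𝓝 t₀, HasDerivAt f (f' t) t) (h2 : HasDerivAt f' f'' t₀) :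
    iteratedDeriv 2 f t₀ = f'' := by
  rw [iteratedDeriv_succ, iteratedDeriv_one]
  have h3 : deriv f =ᶠ[𝓝 t₀] f' := h1.mono fun t ht => ht.deriv
  rw [h3.deriv_eq, h2.deriv]

theorem iteratedDeriv_two_clm (L : E →L[ℝ] F) {f : ℝ → E} {t₀ : ℝ} (hf : ContDiffAt ℝ 2 f t₀) :
    iteratedDeriv 2 (fun t => L (f t)) t₀ = L (iteratedDeriv 2 f t₀) :=
  iteratedDeriv_two_eq
    ((eventually_hasDerivAt hf).mono fun _ ht => L.hasFDerivAt.comp_hasDerivAt _ ht)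
    (L.hasFDerivAt.comp_hasDerivAt _ (hasDerivAt_deriv hf))

theorem iteratedDeriv_two_congr {f g : ℝ → E} {t₀ : ℝ} (h : f =ᶠ[𝓝 t₀] g) :
    iteratedDeriv 2 f t₀ = iteratedDeriv 2 g t₀ :=
  h.iteratedDeriv_eq 2

variable {R : Type*} [NormedRing R] [NormedAlgebra ℝ R]

/-- If `C = K A = A K` and `B = K A K`, then `B + K₀ A K₀ - K₀ C - C K₀ = (K - K₀) A (K - K₀)` for
the value `K₀` of `K` at `t₀`, and the right-hand side has second derivative `2 K'(t₀) A K'(t₀)`. -/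
theorem lyapunov_iteratedDeriv_two {A B C K : ℝ → R} {t₀ : ℝ} (hA : ContDiffAt ℝ 2 A t₀)
    (hB : ContDiffAt ℝ 2 B t₀) (hC : ContDiffAt ℝ 2 C t₀) (hK : ContDiffAt ℝ 2 K t₀)
    (h1 : ∀ᶠ t in 𝓝 t₀, C t = K t * A t) (h2 : ∀ᶠ t in 𝓝 t₀, C t = A t * K t)
    (h3 : ∀ᶠ t in 𝓝 t₀, B t = K t * A t * K t) :
    K t₀ * iteratedDeriv 2 C t₀ + iteratedDeriv 2 C t₀ * K t₀ =
      iteratedDeriv 2 B t₀ + K t₀ * iteratedDeriv 2 A t₀ * K t₀ -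
        (2 : ℝ) • (deriv K t₀ * A t₀ * deriv K t₀) := by
  set K₀ := K t₀
  have e : (fun t => B t + K₀ * A t * K₀ - (K₀ * C t + C t * K₀)) =ᶠ[𝓝 t₀]
      fun t => (K t - K₀) * A t * (K t - K₀) := by
    filter_upwards [h1, h2, h3] with t h1 h2 h3
    have e1 : K₀ * C t = K₀ * (A t * K t) := by rw [h2]
    have e2 : C t * K₀ = K t * A t * K₀ := by rw [h1]
    rw [e1, e2, h3]
    noncomm_ring
  have hl : iteratedDeriv 2 (fun t => B t + K₀ * A t * K₀ - (K₀ * C t + C t * K₀)) t₀ =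
      iteratedDeriv 2 B t₀ + K₀ * iteratedDeriv 2 A t₀ * K₀ -
        (K₀ * iteratedDeriv 2 C t₀ + iteratedDeriv 2 C t₀ * K₀) := by
    refine iteratedDeriv_two_eq (f' := fun t => deriv B t + K₀ * deriv A t * K₀ -
        (K₀ * deriv C t + deriv C t * K₀)) ?_ ?_
    · filter_upwards [eventually_hasDerivAt hA, eventually_hasDerivAt hB,
        eventually_hasDerivAt hC] with t a b c
      exact (b.add ((a.const_mul K₀).mul_const K₀)).sub ((c.const_mul K₀).add (c.mul_const K₀))
    · have a := hasDerivAt_deriv hA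
      have b := hasDerivAt_deriv hB
      have c := hasDerivAt_deriv hC
      exact (b.add ((a.const_mul K₀).mul_const K₀)).sub ((c.const_mul K₀).add (c.mul_const K₀))
  have hr : iteratedDeriv 2 (fun t => (K t - K₀) * A t * (K t - K₀)) t₀ =
      (2 : ℝ) • (deriv K t₀ * A t₀ * deriv K t₀) := by
    refine iteratedDeriv_two_eq (f' := fun t => (deriv K t * A t + (K t - K₀) * deriv A t) *
        (K t - K₀) + (K t - K₀) * A t * deriv K t) ?_ ?_
    · filter_upwards [eventually_hasDerivAt hA, eventually_hasDerivAt hK] with t a k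
      exact ((k.sub_const K₀).mul a).mul (k.sub_const K₀)
    · have a := hasDerivAt_deriv hA
      have k := hasDerivAt_deriv hK
      have a' := (eventually_hasDerivAt hA).self_of_nhds
      have k' := (eventually_hasDerivAt hK).self_of_nhds.sub_const K₀
      refine ((((k.mul a').add (k'.mul a)).mul k').add ((k'.mul a').mul k)).congr_deriv ?_
      simp only [K₀, sub_self, zero_mul, add_zero, mul_zero, zero_add, Pi.add_apply, Pi.mul_apply,
        two_smul]
  rw [iteratedDeriv_two_congr e, hr] at hl
  rw [hl]
  abel

end SecondDerivative

section Families

open Filter Topology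

variable {n m : Type*} [Fintype n] [DecidableEq n] [Fintype m] [DecidableEq m]

theorem contDiffAt_kronecker {E : Type*} [NormedAddCommGroup E] [NormedSpace ℝ E]
    {f : E → Matrix n n ℂ} {g : E → Matrix m m ℂ} {x : E} {N : WithTop ℕ∞}
    (hf : ContDiffAt ℝ N f x) (hg : ContDiffAt ℝ N g x) :
    ContDiffAt ℝ N (fun y => f y ⊗ₖ g y) x := by
  have h1 : ContDiffAt ℝ N (fun y => f y ⊗ₖ (1 : Matrix m m ℂ)) x :=
    (kronLeft n m).contDiff.contDiffAt.comp x hf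
  have h2 : ContDiffAt ℝ N (fun y => (1 : Matrix n n ℂ) ⊗ₖ g y) x :=
    (kronRight n m).contDiff.contDiffAt.comp x hg
  have h := h1.mul h2
  simp only [← Matrix.mul_kronecker_mul, mul_one, one_mul] at h
  exact h

theorem hasDerivAt_kronecker {f : ℝ → Matrix n n ℂ} {g : ℝ → Matrix m m ℂ} {f' : Matrix n n ℂ}
    {g' : Matrix m m ℂ} {x : ℝ} (hf : HasDerivAt f f' x) (hg : HasDerivAt g g' x) :
    HasDerivAt (fun y => f y ⊗ₖ g y) (f' ⊗ₖ g x + f x ⊗ₖ g') x := by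
  have h1 : HasDerivAt (fun y => f y ⊗ₖ (1 : Matrix m m ℂ)) (f' ⊗ₖ 1) x :=
    (kronLeft n m).hasFDerivAt.comp_hasDerivAt x hf
  have h2 : HasDerivAt (fun y => (1 : Matrix n n ℂ) ⊗ₖ g y) (1 ⊗ₖ g') x :=
    (kronRight n m).hasFDerivAt.comp_hasDerivAt x hg
  have h := h1.mul h2
  simp only [Pi.mul_def, ← Matrix.mul_kronecker_mul, mul_one, one_mul] at h
  exact h

/-- The family `(q, r, t) ↦ A(t)^q ⊗ B(t)^r` is jointly smooth. -/
theorem contDiffAt_mpow_kronecker {A : ℝ → Matrix n n ℂ} {B : ℝ → Matrix m m ℂ} {t₀ : ℝ}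
    {N : WithTop ℕ∞} (hA : ContDiffAt ℝ N A t₀) (hB : ContDiffAt ℝ N B t₀)
    (hAH : ∀ t, (A t).IsHermitian) (hBH : ∀ t, (B t).IsHermitian) (hA0 : (A t₀).PosDef)
    (hB0 : (B t₀).PosDef) (q r : ℝ) :
    ContDiffAt ℝ N (fun x : ℝ × ℝ × ℝ => mpow (A x.2.2) x.1 ⊗ₖ mpow (B x.2.2) x.2.1)
      (q, r, t₀) := by
  have h1 : ContDiffAt ℝ N (fun x : ℝ × ℝ × ℝ => mpow (A x.2.2) x.1) (q, r, t₀) :=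
    ContDiffAt.comp (q, r, t₀) (g := fun x : ℝ × ℝ => mpow (A x.2) x.1)
      (f := fun x : ℝ × ℝ × ℝ => (x.1, x.2.2)) (contDiffAt_mpow hA hAH hA0 q) (by fun_prop)
  have h2 : ContDiffAt ℝ N (fun x : ℝ × ℝ × ℝ => mpow (B x.2.2) x.2.1) (q, r, t₀) :=
    ContDiffAt.comp (q, r, t₀) (g := fun x : ℝ × ℝ => mpow (B x.2) x.1)
      (f := fun x : ℝ × ℝ × ℝ => (x.2.1, x.2.2)) (contDiffAt_mpow hB hBH hB0 r) (by fun_prop)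
  exact contDiffAt_kronecker h1 h2

theorem contDiffAt_mpow_kronecker_time {A : ℝ → Matrix n n ℂ} {B : ℝ → Matrix m m ℂ} {t₀ : ℝ}
    {N : WithTop ℕ∞} (hA : ContDiffAt ℝ N A t₀) (hB : ContDiffAt ℝ N B t₀)
    (hAH : ∀ t, (A t).IsHermitian) (hBH : ∀ t, (B t).IsHermitian) (hA0 : (A t₀).PosDef)
    (hB0 : (B t₀).PosDef) (q r : ℝ) :
    ContDiffAt ℝ N (fun t : ℝ => mpow (A t) q ⊗ₖ mpow (B t) r) t₀ :=
  ContDiffAt.comp t₀ (g := fun x : ℝ × ℝ × ℝ => mpow (A x.2.2) x.1 ⊗ₖ mpow (B x.2.2) x.2.1)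
    (f := fun t => (q, r, t)) (contDiffAt_mpow_kronecker hA hB hAH hBH hA0 hB0 q r) (by fun_prop)

variable {Ψ V : Matrix n n ℂ} {Φ W : Matrix m m ℂ}

theorem isHermitian_add_smul {ι : Type*} {L F : Matrix ι ι ℂ} (hL : L.IsHermitian)
    (hF : F.IsHermitian) (ε : ℝ) : (L + ε • F).IsHermitian :=
  hL.add (hF.smul (IsSelfAdjoint.all _))

theorem eventually_posDef_add_smul {L F : Matrix n n ℂ} (hL : L.PosDef) (hF : F.IsHermitian) :
    ∀ᶠ ε : ℝ in 𝓝 0, (L + ε • F).PosDef := by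
  refine eventually_posDef (A := fun ε : ℝ => L + ε • F) (by fun_prop)
    (isHermitian_add_smul hL.isHermitian hF) ?_
  simpa using hL

theorem contDiffAt_mpow_add_smul {L F : Matrix n n ℂ} (hL : L.PosDef) (hF : F.IsHermitian)
    (q : ℝ) {N : WithTop ℕ∞} : ContDiffAt ℝ N (fun ε : ℝ => mpow (L + ε • F) q) 0 :=
  ContDiffAt.comp 0 (g := fun x : ℝ × ℝ => mpow (L + x.2 • F) x.1) (f := fun ε => (q, ε))
    (contDiffAt_mpow (A := fun ε => L + ε • F) (by fun_prop)
      (isHermitian_add_smul hL.isHermitian hF) (by simpa using hL) q) (by fun_prop)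

theorem contDiffAt_G (hΨ : Ψ.PosDef) (hΦ : Φ.PosDef) (hV : V.IsHermitian) (hW : W.IsHermitian)
    (q r : ℝ) {N : WithTop ℕ∞} : ContDiffAt ℝ N (G Ψ V Φ W q r) 0 :=
  contDiffAt_mpow_kronecker_time (A := fun ε => Ψ + ε • V) (B := fun ε => Φ + ε • W)
    (by fun_prop) (by fun_prop) (isHermitian_add_smul hΨ.isHermitian hV)
    (isHermitian_add_smul hΦ.isHermitian hW) (by simpa using hΨ) (by simpa using hΦ) q r

theorem G_zero (q r : ℝ) : G Ψ V Φ W q r 0 = mpow Ψ q ⊗ₖ mpow Φ r := by simp [G]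

/-- Near `ε = 0`, the matrices `G_{q,r}(ε)` multiply by adding exponents. -/
theorem eventually_G_mul (hΨ : Ψ.PosDef) (hΦ : Φ.PosDef) (hV : V.IsHermitian)
    (hW : W.IsHermitian) : ∀ᶠ ε in 𝓝 (0 : ℝ), ∀ q r q' r' : ℝ,
      G Ψ V Φ W q r ε * G Ψ V Φ W q' r' ε = G Ψ V Φ W (q + q') (r + r') ε := by
  filter_upwards [eventually_posDef_add_smul hΨ hV, eventually_posDef_add_smul hΦ hW]
    with ε h1 h2 q r q' r' using mpow_kronecker_mul h1 h2 q r q' r'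

theorem hasDerivAt_G (hΨ : Ψ.PosDef) (hΦ : Φ.PosDef) (hV : V.IsHermitian) (hW : W.IsHermitian)
    (q r : ℝ) : HasDerivAt (G Ψ V Φ W q r) (firstOrderG Ψ V Φ W q r) 0 := by
  have h1 : HasDerivAt (fun ε : ℝ => mpow (Ψ + ε • V) q) (firstOrder q Ψ V) 0 :=
    ((contDiffAt_mpow_add_smul hΨ hV q (N := 1)).differentiableAt (by simp)).hasDerivAt
  have h2 : HasDerivAt (fun ε : ℝ => mpow (Φ + ε • W) r) (firstOrder r Φ W) 0 :=
    ((contDiffAt_mpow_add_smul hΦ hW r (N := 1)).differentiableAt (by simp)).hasDerivAt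
  have h3 := hasDerivAt_kronecker h1 h2
  simp only [zero_smul, add_zero] at h3
  exact h3

theorem isHermitian_kronecker {n m : Type*} {A : Matrix n n ℂ} {B : Matrix m m ℂ}
    (hA : A.IsHermitian) (hB : B.IsHermitian) : (A ⊗ₖ B).IsHermitian := by
  rw [Matrix.IsHermitian, Matrix.conjTranspose_kronecker, hA.eq, hB.eq]

theorem isHermitian_mpow (A : Matrix n n ℂ) (q : ℝ) : (mpow A q).IsHermitian :=
  cfc_predicate _ A

theorem isHermitian_firstOrderG (hΨ : Ψ.PosDef) (hΦ : Φ.PosDef) (hV : V.IsHermitian)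
    (hW : W.IsHermitian) (q r : ℝ) : (firstOrderG Ψ V Φ W q r).IsHermitian := by
  have h := hasDerivAt_G hΨ hΦ hV hW q r
  have h1 : (fun ε => star (G Ψ V Φ W q r ε)) = G Ψ V Φ W q r := by
    funext ε
    exact isHermitian_kronecker (isHermitian_mpow _ _) (isHermitian_mpow _ _)
  have h2 := h.star
  rw [h1] at h2
  exact h2.unique h

theorem posDef_Kmat (hΨ : Ψ.PosDef) (hΦ : Φ.PosDef) (δ : ℝ) : (Kmat Ψ Φ δ).PosDef :=
  (posDef_mpow hΨ δ).kronecker (posDef_mpow hΦ (-δ))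

theorem Dop_eq_lyap (δ : ℝ) (F : Matrix (n × m) (n × m) ℂ) :
    Dop Ψ Φ δ F = lyap (Kmat Ψ Φ δ) F := rfl

/-- `cross` at two points of the family `Ψ^q ⊗ Φ^r` solves the Lyapunov equation of `K_δ` with a
positive semidefinite right-hand side. -/
theorem cross_eq_lyap (hΨ : Ψ.PosDef) (hΦ : Φ.PosDef) (hV : V.IsHermitian) (hW : W.IsHermitian)
    (q r δ : ℝ) :
    cross (mpow Ψ q ⊗ₖ mpow Φ r) (mpow Ψ (q + 2 * δ) ⊗ₖ mpow Φ (r - 2 * δ))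
      (firstOrderG Ψ V Φ W q r) (firstOrderG Ψ V Φ W (q + 2 * δ) (r - 2 * δ)) =
    lyap (Kmat Ψ Φ δ) (firstOrderG Ψ V Φ W δ (-δ) * (mpow Ψ q ⊗ₖ mpow Φ r) *
      firstOrderG Ψ V Φ W δ (-δ)) := by
  refine (lyap_eq_of_mul_add_mul (posDef_Kmat hΨ hΦ δ) ?_).symm
  have hB : mpow Ψ (q + 2 * δ) ⊗ₖ mpow Φ (r - 2 * δ) =
      (mpow Ψ q ⊗ₖ mpow Φ r) * Kmat Ψ Φ δ ^ 2 := by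
    rw [sq, Kmat, mpow_kronecker_mul hΨ hΦ, mpow_kronecker_mul hΨ hΦ]
    congr 2 <;> ring
  have hZ : firstOrderG Ψ V Φ W (q + 2 * δ) (r - 2 * δ) -
      Kmat Ψ Φ δ ^ 2 * firstOrderG Ψ V Φ W q r =
      (Kmat Ψ Φ δ * firstOrderG Ψ V Φ W δ (-δ) + firstOrderG Ψ V Φ W δ (-δ) * Kmat Ψ Φ δ) *
        (mpow Ψ q ⊗ₖ mpow Φ r) := by
    have hk := hasDerivAt_G hΨ hΦ hV hW δ (-δ)
    have ha := hasDerivAt_G hΨ hΦ hV hW q r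
    have hb := (hk.mul hk).mul ha
    have e : G Ψ V Φ W (q + 2 * δ) (r - 2 * δ) =ᶠ[𝓝 0]
        G Ψ V Φ W δ (-δ) * G Ψ V Φ W δ (-δ) * G Ψ V Φ W q r := by
      filter_upwards [eventually_G_mul hΨ hΦ hV hW] with ε hε
      rw [Pi.mul_apply, Pi.mul_apply, hε, hε]
      congr 1 <;> ring
    have := (hasDerivAt_G hΨ hΦ hV hW (q + 2 * δ) (r - 2 * δ)).unique
      (hb.congr_of_eventuallyEq e)
    rw [this]
    simp only [G_zero, Kmat, Pi.mul_apply]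
    noncomm_ring
  have hK := isHermitian_firstOrderG hΨ hΦ hV hW δ (-δ)
  rw [hB] at *
  obtain ⟨U, d, hd, rfl⟩ := exists_conjDiag_pos hΨ
  obtain ⟨U', d', hd', rfl⟩ := exists_conjDiag_pos hΦ
  simp only [Kmat, mpow_conjDiag, conjDiag_kronecker] at hZ ⊢
  exact cross_lyapunov _
    (fun x => mul_pos (Real.rpow_pos_of_pos (hd _) _) (Real.rpow_pos_of_pos (hd' _) _))
    (fun x => mul_pos (Real.rpow_pos_of_pos (hd _) _) (Real.rpow_pos_of_pos (hd' _) _))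
    hK rfl hZ

theorem source_succ_eq_lyap (hΨ : Ψ.PosDef) (hΦ : Φ.PosDef) (hV : V.IsHermitian)
    (hW : W.IsHermitian) (p : ℝ) (k l : ℕ) :
    source Ψ V Φ W p (k + 1) l = lyap (Kmat Ψ Φ (p / 2 ^ (k + 1)))
      (firstOrderG Ψ V Φ W (p / 2 ^ (k + 1)) (-(p / 2 ^ (k + 1))) *
        (mpow Ψ (p * (((l : ℝ) - 1) / 2 ^ (k + 1))) ⊗ₖ
          mpow Φ (p * (1 - ((l : ℝ) - 1) / 2 ^ (k + 1)))) *
        firstOrderG Ψ V Φ W (p / 2 ^ (k + 1)) (-(p / 2 ^ (k + 1)))) := by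
  rw [← cross_eq_lyap hΨ hΦ hV hW]
  have e1 : p * (((l : ℝ) - 1) / 2 ^ (k + 1)) + 2 * (p / 2 ^ (k + 1)) =
      p * (((l : ℝ) + 1) / 2 ^ (k + 1)) := by ring
  have e2 : p * (1 - ((l : ℝ) - 1) / 2 ^ (k + 1)) - 2 * (p / 2 ^ (k + 1)) =
      p * (1 - ((l : ℝ) + 1) / 2 ^ (k + 1)) := by ring
  rw [e1, e2]
  simp only [source]

theorem posSemidef_source_succ (hΨ : Ψ.PosDef) (hΦ : Φ.PosDef) (hV : V.IsHermitian)
    (hW : W.IsHermitian) (p : ℝ) (k l : ℕ) : (source Ψ V Φ W p (k + 1) l).PosSemidef := by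
  rw [source_succ_eq_lyap hΨ hΦ hV hW]
  refine posSemidef_lyap (posDef_Kmat hΨ hΦ _).isHermitian ?_
  have h := ((posDef_mpow hΨ (p * (((l : ℝ) - 1) / 2 ^ (k + 1)))).kronecker
    (posDef_mpow hΦ (p * (1 - ((l : ℝ) - 1) / 2 ^ (k + 1))))).posSemidef.mul_mul_conjTranspose_same
      (firstOrderG Ψ V Φ W (p / 2 ^ (k + 1)) (-(p / 2 ^ (k + 1))))
  rwa [(isHermitian_firstOrderG hΨ hΦ hV hW _ _).eq] at h

/-- Minus one half of the second derivative of `G_{q,r}` at `0`. -/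
noncomputable def curvature (Ψ V : Matrix n n ℂ) (Φ W : Matrix m m ℂ) (q r : ℝ) :
    Matrix (n × m) (n × m) ℂ :=
  -((1 / 2 : ℝ) • iteratedDeriv 2 (G Ψ V Φ W q r) 0)

/-- `D_δ(K_δ F K_δ) = D_{-δ}(F)`. -/
theorem lyap_Kmat_mul_mul (hΨ : Ψ.PosDef) (hΦ : Φ.PosDef) (δ : ℝ)
    (F : Matrix (n × m) (n × m) ℂ) :
    lyap (Kmat Ψ Φ δ) (Kmat Ψ Φ δ * F * Kmat Ψ Φ δ) = lyap (Kmat Ψ Φ (-δ)) F := by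
  refine lyap_eq_of_mul_add_mul (posDef_Kmat hΨ hΦ δ) ?_
  have h := mul_lyap_add_lyap_mul (posDef_Kmat hΨ hΦ (-δ)) F
  have e : ∀ δ : ℝ, Kmat Ψ Φ δ * Kmat Ψ Φ (-δ) = 1 := fun δ => by
    rw [Kmat, Kmat, mpow_kronecker_mul hΨ hΦ]
    simp [mpow_zero hΨ, mpow_zero hΦ]
  have e1 := e δ
  have e2 := e (-δ)
  rw [neg_neg] at e2
  set Q := lyap (Kmat Ψ Φ (-δ)) F
  rw [← h, mul_add, add_mul, ← mul_assoc, e1, one_mul, mul_assoc (Kmat Ψ Φ δ),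
    mul_assoc Q, e2, mul_one, add_comm]

/-- The recursion along the dyadic tree: the curvature at the midpoint is the source plus the
contributions of the two neighbours. -/
theorem curvature_midpoint (hΨ : Ψ.PosDef) (hΦ : Φ.PosDef) (hV : V.IsHermitian)
    (hW : W.IsHermitian) (q r δ : ℝ) :
    curvature Ψ V Φ W (q + δ) (r - δ) =
      lyap (Kmat Ψ Φ δ) (firstOrderG Ψ V Φ W δ (-δ) * (mpow Ψ q ⊗ₖ mpow Φ r) *
        firstOrderG Ψ V Φ W δ (-δ)) +
      Dop Ψ Φ δ (curvature Ψ V Φ W (q + 2 * δ) (r - 2 * δ)) +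
      Dop Ψ Φ (-δ) (curvature Ψ V Φ W q r) := by
  have hK := posDef_Kmat hΨ hΦ δ
  rw [Dop_eq_lyap, Dop_eq_lyap, ← lyap_Kmat_mul_mul hΨ hΦ, ← lyap_add hK, ← lyap_add hK]
  refine (lyap_eq_of_mul_add_mul hK ?_).symm
  have hc := fun q r => contDiffAt_G hΨ hΦ hV hW q r (N := 2)
  have hm := eventually_G_mul hΨ hΦ hV hW
  have key := lyapunov_iteratedDeriv_two (hc q r) (hc (q + 2 * δ) (r - 2 * δ))
    (hc (q + δ) (r - δ)) (hc δ (-δ))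
    (hm.mono fun ε h => by rw [h]; congr 1 <;> ring)
    (hm.mono fun ε h => by rw [h]; congr 1)
    (hm.mono fun ε h => by rw [h, h]; congr 1 <;> ring)
  rw [(hasDerivAt_G hΨ hΦ hV hW δ (-δ)).deriv, G_zero, G_zero] at key
  change Kmat Ψ Φ δ * _ + _ * Kmat Ψ Φ δ = _ + Kmat Ψ Φ δ * _ * Kmat Ψ Φ δ - _ at key
  simp only [curvature, mul_neg, neg_mul, mul_smul_comm, smul_mul_assoc]
  rw [← neg_add, ← smul_add, key, smul_sub, smul_add, smul_smul]
  norm_num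
  abel

theorem curvature_dyadic (hΨ : Ψ.PosDef) (hΦ : Φ.PosDef) (hV : V.IsHermitian)
    (hW : W.IsHermitian) (p : ℝ) (k l : ℕ) :
    curvature Ψ V Φ W (p * ((2 * l + 1 : ℕ) / 2 ^ (k + 1)))
        (p * (1 - (2 * l + 1 : ℕ) / 2 ^ (k + 1))) =
      source Ψ V Φ W p (k + 1) (2 * l + 1) +
      Dop Ψ Φ (p / 2 ^ (k + 1)) (curvature Ψ V Φ W (p * ((l + 1 : ℕ) / 2 ^ k))
        (p * (1 - (l + 1 : ℕ) / 2 ^ k))) +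
      Dop Ψ Φ (-(p / 2 ^ (k + 1))) (curvature Ψ V Φ W (p * (l / 2 ^ k)) (p * (1 - l / 2 ^ k))) := by
  have h := curvature_midpoint hΨ hΦ hV hW (p * (l / 2 ^ k)) (p * (1 - l / 2 ^ k))
    (p / 2 ^ (k + 1))
  rw [source_succ_eq_lyap hΨ hΦ hV hW]
  have h2 : (2 : ℝ) ^ k ≠ 0 := by positivity
  have e1 : p * (l / 2 ^ k) + p / 2 ^ (k + 1) = p * ((2 * l + 1 : ℕ) / 2 ^ (k + 1)) := by
    push_cast; rw [pow_succ]; field_simp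
  have e2 : p * (1 - l / 2 ^ k) - p / 2 ^ (k + 1) = p * (1 - (2 * l + 1 : ℕ) / 2 ^ (k + 1)) := by
    push_cast; rw [pow_succ]; field_simp; ring
  have e3 : p * (l / 2 ^ k) + 2 * (p / 2 ^ (k + 1)) = p * ((l + 1 : ℕ) / 2 ^ k) := by
    push_cast; rw [pow_succ]; field_simp
  have e4 : p * (1 - l / 2 ^ k) - 2 * (p / 2 ^ (k + 1)) = p * (1 - (l + 1 : ℕ) / 2 ^ k) := by
    push_cast; rw [pow_succ]; field_simp; ring
  have e5 : p * (l / 2 ^ k) = p * (((2 * l + 1 : ℕ) - 1) / 2 ^ (k + 1)) := by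
    push_cast; rw [pow_succ]; field_simp; ring
  have e6 : p * (1 - l / 2 ^ k) = p * (1 - ((2 * l + 1 : ℕ) - 1) / 2 ^ (k + 1)) := by
    push_cast; rw [pow_succ]; field_simp; ring
  rw [e1, e2, e3, e4] at h
  rw [h, ← e5, ← e6]

end Families

/-! ### The second derivative of a real power -/

section SecondOrder

open MeasureTheory Set Filter Topology

/-- The normalization of the integral representation of `x ^ p`. -/
theorem integral_rpowIntegrand_one {p : ℝ} (hp : p ∈ Ioo (0 : ℝ) 1) :
    ∫ t in Ioi (0 : ℝ), Real.rpowIntegrand₀₁ p t 1 = Real.pi / Real.sin (Real.pi * p) := by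
  have hp1 : 0 < 1 - p := sub_pos.2 hp.2
  have h1 : Real.pi / Real.sin (Real.pi * p) =
      (Complex.betaIntegral (p : ℂ) ((1 - p : ℝ) : ℂ)).re := by
    rw [← ProbabilityTheory.beta_eq_betaIntegralReal p (1 - p) hp.1 hp1, ProbabilityTheory.beta,
      Real.Gamma_mul_Gamma_one_sub]
    simp
  have h2 : Complex.betaIntegral (p : ℂ) ((1 - p : ℝ) : ℂ) =
      ((∫ u in Ioo (0 : ℝ) 1, u ^ (p - 1) * (1 - u) ^ (-p) : ℝ) : ℂ) := by
    rw [Complex.betaIntegral, intervalIntegral.integral_of_le zero_le_one,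
      ← integral_Ioc_eq_integral_Ioo, ← integral_complex_ofReal]
    refine setIntegral_congr_fun measurableSet_Ioc fun u hu => ?_
    rw [Complex.ofReal_mul, Complex.ofReal_cpow hu.1.le, Complex.ofReal_cpow (sub_nonneg.2 hu.2)]
    push_cast
    ring_nf
  -- the substitution `u = t / (1 + t)` turns the Beta integral into an integral over `(0, ∞)`
  have himg : (fun t : ℝ => t / (1 + t)) '' Ioi 0 = Ioo 0 1 := by
    ext u
    constructor
    · rintro ⟨t, ht : 0 < t, rfl⟩
      have : 0 < 1 + t := by positivity
      exact ⟨by positivity, by rw [div_lt_one this]; linarith⟩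
    · rintro ⟨h0, h1⟩
      have : 0 < 1 - u := sub_pos.2 h1
      refine ⟨u / (1 - u), div_pos h0 this, ?_⟩
      simp only
      field_simp
      ring
  have hd : ∀ t ∈ Ioi (0 : ℝ), HasDerivWithinAt (fun t : ℝ => t / (1 + t)) (((1 + t) ^ 2)⁻¹)
      (Ioi 0) t := by
    intro t (ht : 0 < t)
    have h3 : 1 + t ≠ 0 := by positivity
    refine (((hasDerivAt_id' t).fun_div ((hasDerivAt_id' t).const_add 1) h3).congr_deriv
      ?_).hasDerivWithinAt
    field_simp
    ring
  have hinj : InjOn (fun t : ℝ => t / (1 + t)) (Ioi 0) := by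
    intro s (hs : 0 < s) t (ht : 0 < t) h
    have h3 : 1 + s ≠ 0 := by positivity
    have h4 : 1 + t ≠ 0 := by positivity
    simp only [div_eq_div_iff h3 h4] at h
    linarith
  have h3 := integral_image_eq_integral_abs_deriv_smul measurableSet_Ioi hd hinj
    fun u : ℝ => u ^ (p - 1) * (1 - u) ^ (-p)
  rw [himg] at h3
  rw [h1, h2, Complex.ofReal_re, h3]
  refine setIntegral_congr_fun measurableSet_Ioi fun t (ht : 0 < t) => ?_
  have ht1 : 0 < 1 + t := by positivity
  rw [Real.rpowIntegrand₀₁_eq_pow_div hp ht.le zero_le_one]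
  have e1 : 1 - t / (1 + t) = (1 + t)⁻¹ := by field_simp; ring
  have e2 : (1 + t) ^ p = (1 + t) ^ (p - 1) * (1 + t) := by
    rw [Real.rpow_sub_one ht1.ne']; field_simp
  simp only [smul_eq_mul]
  rw [abs_of_pos (by positivity), e1, Real.div_rpow ht.le ht1.le, Real.inv_rpow ht1.le,
    Real.rpow_neg ht1.le, inv_inv, e2]
  have := (Real.rpow_pos_of_pos ht1 (p - 1)).ne'
  field_simp
  ring

theorem rpow_eq_sin_mul_integral {p x : ℝ} (hp : p ∈ Ioo (0 : ℝ) 1) (hx : 0 ≤ x) :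
    x ^ p = Real.sin (Real.pi * p) / Real.pi *
      ∫ t in Ioi (0 : ℝ), Real.rpowIntegrand₀₁ p t x := by
  rw [Real.rpow_eq_const_mul_integral hp hx, integral_rpowIntegrand_one hp, inv_div]

variable {ι : Type*} [Fintype ι] [DecidableEq ι]

theorem integrable_conjDiag {α : Type*} [MeasurableSpace α] {μ : Measure α}
    (U : Matrix.unitaryGroup ι ℂ) {d : α → ι → ℝ} (hd : ∀ i, Integrable (fun x => d x i) μ) :
    Integrable (fun x => conjDiag U (d x)) μ ∧
      ∫ x, conjDiag U (d x) ∂μ = conjDiag U fun i => ∫ x, d x i ∂μ := by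
  have h : ∀ e : ι → ℝ, conjDiag U e = ∑ i, e i • conjDiag U (Pi.single i 1) := fun e => by
    simp only [← map_smul, ← map_sum]
    congr 1
    ext i
    simp [Finset.sum_apply, Pi.single_apply]
  have hI : ∀ i, Integrable (fun x => d x i • conjDiag U (Pi.single i 1)) μ := fun i =>
    (hd i).smul_const _
  constructor
  · rw [funext fun x => h (d x)]
    exact integrable_finsetSum _ fun i _ => hI i
  · rw [funext fun x => h (d x), h, integral_finsetSum _ fun i _ => hI i]
    simp only [integral_smul_const]

theorem smul_one_add_conjDiag (U : Matrix.unitaryGroup ι ℂ) (d : ι → ℝ) (t : ℝ) :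
    t • (1 : Matrix ι ι ℂ) + conjDiag U d = conjDiag U fun i => t + d i := by
  rw [← map_one (conjDiag U), ← map_smul, ← map_add]
  congr 1
  ext i
  simp

/-- The resolvent `(t + A)⁻¹`. -/
noncomputable def resolvent (A : Matrix ι ι ℂ) (t : ℝ) : Matrix ι ι ℂ :=
  (t • (1 : Matrix ι ι ℂ) + A)⁻¹

theorem resolvent_conjDiag {U : Matrix.unitaryGroup ι ℂ} {d : ι → ℝ} (hd : ∀ i, 0 < d i) {t : ℝ}
    (ht : 0 ≤ t) : resolvent (conjDiag U d) t = conjDiag U fun i => (t + d i)⁻¹ := by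
  rw [resolvent, smul_one_add_conjDiag, inv_conjDiag fun i => by have := hd i; positivity]

theorem mpow_eq_integral {A : Matrix ι ι ℂ} (hA : A.PosDef) {p : ℝ} (hp : p ∈ Ioo (0 : ℝ) 1) :
    IntegrableOn (fun t : ℝ => t ^ p • (t⁻¹ • (1 : Matrix ι ι ℂ) - resolvent A t)) (Ioi 0) ∧
    mpow A p = (Real.sin (Real.pi * p) / Real.pi) •
      ∫ t in Ioi (0 : ℝ), t ^ p • (t⁻¹ • (1 : Matrix ι ι ℂ) - resolvent A t) := by
  obtain ⟨U, d, hd, rfl⟩ := exists_conjDiag_pos hA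
  have e : EqOn (fun t : ℝ => conjDiag U fun i => Real.rpowIntegrand₀₁ p t (d i))
      (fun t : ℝ => t ^ p • (t⁻¹ • (1 : Matrix ι ι ℂ) - resolvent (conjDiag U d) t)) (Ioi 0) := by
    intro t (ht : 0 < t)
    simp only
    rw [resolvent_conjDiag hd ht.le, ← map_one (conjDiag U), ← map_smul, ← map_sub, ← map_smul]
    congr 1
    ext i
    simp [Real.rpowIntegrand₀₁]
  have h := integrable_conjDiag (μ := volume.restrict (Ioi 0)) U
    (d := fun t i => Real.rpowIntegrand₀₁ p t (d i))
    fun i => Real.integrableOn_rpowIntegrand₀₁_Ioi hp (hd i).le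
  refine ⟨IntegrableOn.congr_fun h.1 e measurableSet_Ioi, ?_⟩
  rw [← setIntegral_congr_fun measurableSet_Ioi e, h.2, mpow_conjDiag, ← map_smul]
  congr 1
  ext i
  exact rpow_eq_sin_mul_integral hp (hd i).le

theorem isUnit_smul_one_add {A : Matrix ι ι ℂ} (hA : A.PosDef) {t : ℝ} (ht : 0 ≤ t) :
    IsUnit (t • (1 : Matrix ι ι ℂ) + A) := by
  obtain ⟨U, d, hd, rfl⟩ := exists_conjDiag_pos hA
  rw [smul_one_add_conjDiag]
  exact isUnit_conjDiag fun i => by have := hd i; positivity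

theorem hasDerivAt_inv_of_isUnit {M : ℝ → Matrix ι ι ℂ} {M' : Matrix ι ι ℂ} {x : ℝ}
    (hM : HasDerivAt M M' x) (hu : IsUnit (M x)) :
    HasDerivAt (fun y => (M y)⁻¹) (-((M x)⁻¹ * M' * (M x)⁻¹)) x := by
  obtain ⟨u, hu⟩ := hu
  have h := hasFDerivAt_ringInverse (𝕜 := ℝ) u
  rw [hu] at h
  have h2 := h.comp_hasDerivAt x hM
  simp only [Matrix.nonsing_inv_eq_ringInverse]
  refine h2.congr_deriv ?_
  rw [← hu, Ring.inverse_unit]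
  simp [ContinuousLinearMap.mulLeftRight_apply]

theorem continuousOn_resolvent {A : Matrix ι ι ℂ} (hA : A.PosDef) :
    ContinuousOn (resolvent A) (Ioi 0) := by
  intro t (ht : 0 < t)
  have h : HasDerivAt (fun t : ℝ => t • (1 : Matrix ι ι ℂ) + A) ((1 : ℝ) • 1) t :=
    ((hasDerivAt_id t).smul_const _).add_const A
  exact (hasDerivAt_inv_of_isUnit h (isUnit_smul_one_add hA ht.le)).continuousAt.continuousWithinAt

theorem continuousOn_rpow_Ioi (p : ℝ) : ContinuousOn (fun t : ℝ => t ^ p) (Ioi 0) :=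
  fun t (ht : 0 < t) => (Real.continuousAt_rpow_const t p (Or.inl ht.ne')).continuousWithinAt

theorem norm_resolvent_le {A : Matrix ι ι ℂ} {κ : ℝ} (hκ : 0 < κ)
    (hA : (A - κ • (1 : Matrix ι ι ℂ)).PosSemidef) {t : ℝ} (ht : 0 ≤ t) :
    A.PosDef ∧ ‖resolvent A t‖ ≤ (t + κ)⁻¹ := by
  have hH : A.IsHermitian := by
    have h1 : (κ • (1 : Matrix ι ι ℂ)).IsHermitian :=
      Matrix.isHermitian_one.smul (IsSelfAdjoint.all _)
    simpa using hA.isHermitian.add h1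
  obtain ⟨U, d, rfl⟩ := exists_conjDiag hH
  have hd : ∀ i, κ ≤ d i := by
    rw [← map_one (conjDiag U), ← map_smul, ← map_sub, posSemidef_conjDiag_iff] at hA
    intro i
    simpa using hA i
  have hd0 : ∀ i, 0 < d i := fun i => hκ.trans_le (hd i)
  refine ⟨(posDef_conjDiag_iff U d).2 hd0, ?_⟩
  rw [resolvent_conjDiag hd0 ht]
  refine norm_conjDiag_le (by positivity) fun i => ?_
  have := hd0 i
  rw [abs_of_pos (by positivity)]
  gcongr
  exact hd i

/-- Positive definiteness is uniform along a short segment: a lower bound at both ends of the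
segment holds in between by convexity. -/
theorem exists_uniform_lower_bound {L F : Matrix ι ι ℂ} (hL : L.PosDef) (hF : F.IsHermitian) :
    ∃ κ : ℝ, 0 < κ ∧ ∃ r : ℝ, 0 < r ∧ ∀ ε : ℝ, |ε| ≤ r →
      (L + ε • F - κ • (1 : Matrix ι ι ℂ)).PosSemidef := by
  obtain ⟨r', hr', h⟩ := Metric.eventually_nhds_iff.1 (eventually_posDef_add_smul hL hF)
  have hlow : ∀ {A : Matrix ι ι ℂ}, A.PosDef →
      ∃ κ : ℝ, 0 < κ ∧ ∀ c ≤ κ, (A - c • (1 : Matrix ι ι ℂ)).PosSemidef := by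
    intro A hA
    obtain ⟨U, d, hd, rfl⟩ := exists_conjDiag_pos hA
    obtain ⟨κ, hκ, hκd⟩ := exists_pos_le hd
    refine ⟨κ, hκ, fun c hc => ?_⟩
    rw [← map_one (conjDiag U), ← map_smul, ← map_sub, posSemidef_conjDiag_iff]
    intro i
    have := hκd i
    simp only [Pi.sub_apply, Pi.smul_apply, Pi.one_apply, smul_eq_mul]
    linarith
  set r := r' / 2
  have hr : 0 < r := half_pos hr'
  have hrr : r < r' := half_lt_self hr'
  obtain ⟨κ₁, hκ₁, h₁⟩ := hlow (h (y := r) (by simpa [abs_of_pos hr] using hrr))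
  obtain ⟨κ₂, hκ₂, h₂⟩ := hlow (h (y := -r) (by simpa [abs_of_pos hr] using hrr))
  refine ⟨min κ₁ κ₂, lt_min hκ₁ hκ₂, r, hr, fun ε hε => ?_⟩
  have hε' := abs_le.1 hε
  have e : L + ε • F - min κ₁ κ₂ • (1 : Matrix ι ι ℂ) =
      ((r + ε) / (2 * r)) • (L + r • F - min κ₁ κ₂ • (1 : Matrix ι ι ℂ)) +
      ((r - ε) / (2 * r)) • (L + (-r) • F - min κ₁ κ₂ • (1 : Matrix ι ι ℂ)) := by
    match_scalars <;> field_simp <;> ring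
  rw [e]
  exact ((h₁ _ (min_le_left _ _)).smul (div_nonneg (by linarith) (by linarith))).add
    ((h₂ _ (min_le_right _ _)).smul (div_nonneg (by linarith) (by linarith)))

/-- `t^p (t + κ)⁻²` is integrable, being dominated by the integrand for `κ ^ p`. -/
theorem rpow_mul_inv_mul_inv_le {p κ t : ℝ} (hp : p ∈ Ioo (0 : ℝ) 1) (hκ : 0 < κ) (ht : 0 < t) :
    t ^ p * ((t + κ)⁻¹ * (t + κ)⁻¹) ≤ κ⁻¹ * Real.rpowIntegrand₀₁ p t κ := by
  rw [Real.rpowIntegrand₀₁_eq_pow_div hp ht.le hκ.le, Real.rpow_sub_one ht.ne']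
  have h1 := Real.rpow_pos_of_pos ht p
  have h2 : (t + κ)⁻¹ ≤ t⁻¹ := by gcongr; linarith
  calc t ^ p * ((t + κ)⁻¹ * (t + κ)⁻¹) ≤ t ^ p * (t⁻¹ * (t + κ)⁻¹) := by gcongr
    _ = _ := by field_simp

section Derivatives

variable {L F : Matrix ι ι ℂ} {κ r : ℝ}

theorem hasDerivAt_resolvent {ε t : ℝ} (hpd : (L + ε • F).PosDef) (ht : 0 < t) :
    HasDerivAt (fun ε : ℝ => resolvent (L + ε • F) t)
      (-(resolvent (L + ε • F) t * F * resolvent (L + ε • F) t)) ε := by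
  have h : HasDerivAt (fun ε : ℝ => t • (1 : Matrix ι ι ℂ) + (L + ε • F)) F ε := by
    simpa using (((hasDerivAt_id ε).smul_const F).const_add L).const_add (t • (1 : Matrix ι ι ℂ))
  exact hasDerivAt_inv_of_isUnit h (isUnit_smul_one_add hpd ht.le)

theorem norm_mul_mul_le (M N : Matrix ι ι ℂ) : ‖M * N * M‖ ≤ ‖M‖ * ‖N‖ * ‖M‖ :=
  (norm_mul_le _ _).trans (mul_le_mul_of_nonneg_right (norm_mul_le _ _) (norm_nonneg _))

/-- Differentiation under the integral sign, dominated by `‖F‖ t^p (t + κ)⁻²`. -/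
theorem hasDerivAt_integral_resolvent (hκ : 0 < κ)
    (hlow : ∀ ε ∈ Metric.ball (0 : ℝ) r, (L + ε • F - κ • (1 : Matrix ι ι ℂ)).PosSemidef)
    {p : ℝ} (hp : p ∈ Ioo (0 : ℝ) 1) {ε : ℝ} (hε : ε ∈ Metric.ball (0 : ℝ) r) :
    IntegrableOn (fun t : ℝ => t ^ p • (resolvent (L + ε • F) t * F * resolvent (L + ε • F) t))
      (Ioi 0) ∧
    HasDerivAt (fun ε : ℝ =>
        ∫ t in Ioi (0 : ℝ), t ^ p • (t⁻¹ • (1 : Matrix ι ι ℂ) - resolvent (L + ε • F) t))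
      (∫ t in Ioi (0 : ℝ), t ^ p • (resolvent (L + ε • F) t * F * resolvent (L + ε • F) t)) ε := by
  have hpd : ∀ ε ∈ Metric.ball (0 : ℝ) r, (L + ε • F).PosDef := fun ε hε =>
    (norm_resolvent_le hκ (hlow ε hε) le_rfl).1
  refine hasDerivAt_integral_of_dominated_loc_of_deriv_le (μ := volume.restrict (Ioi 0))
    (s := Metric.ball 0 r)
    (F := fun ε t => t ^ p • (t⁻¹ • (1 : Matrix ι ι ℂ) - resolvent (L + ε • F) t))
    (F' := fun ε t => t ^ p • (resolvent (L + ε • F) t * F * resolvent (L + ε • F) t))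
    (bound := fun t => ‖F‖ * (κ⁻¹ * Real.rpowIntegrand₀₁ p t κ))
    (Metric.isOpen_ball.mem_nhds hε) ?_ (mpow_eq_integral (hpd ε hε) hp).1 ?_ ?_
    (((Real.integrableOn_rpowIntegrand₀₁_Ioi hp hκ.le).const_mul _).const_mul _) ?_
  · filter_upwards [Metric.isOpen_ball.mem_nhds hε] with η hη
    exact (mpow_eq_integral (hpd η hη) hp).1.aestronglyMeasurable
  · have hc := continuousOn_resolvent (hpd ε hε)
    exact ((continuousOn_rpow_Ioi p).smul ((hc.mul continuousOn_const).mul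
      hc)).aestronglyMeasurable measurableSet_Ioi
  · refine ae_restrict_of_forall_mem measurableSet_Ioi fun t (ht : 0 < t) η hη => ?_
    have h1 := (norm_resolvent_le hκ (hlow η hη) ht.le).2
    have h2 := Real.rpow_pos_of_pos ht p
    rw [norm_smul, Real.norm_of_nonneg h2.le]
    generalize resolvent (L + η • F) t = R at h1 ⊢
    calc t ^ p * ‖R * F * R‖ ≤ t ^ p * (‖R‖ * ‖F‖ * ‖R‖) := by
          gcongr
          exact norm_mul_mul_le R F
      _ ≤ t ^ p * ((t + κ)⁻¹ * ‖F‖ * (t + κ)⁻¹) := by gcongr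
      _ = ‖F‖ * (t ^ p * ((t + κ)⁻¹ * (t + κ)⁻¹)) := by ring
      _ ≤ _ := by exact mul_le_mul_of_nonneg_left (rpow_mul_inv_mul_inv_le hp hκ ht) (by positivity)
  · refine ae_restrict_of_forall_mem measurableSet_Ioi fun t (ht : 0 < t) η hη => ?_
    have h := (hasDerivAt_resolvent (hpd η hη) ht).const_sub (t⁻¹ • (1 : Matrix ι ι ℂ))
    rw [neg_neg] at h
    exact h.const_smul (t ^ p)

theorem hasDerivAt_integral_resolvent_mul_resolvent (hr : 0 < r) (hκ : 0 < κ)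
    (hlow : ∀ ε ∈ Metric.ball (0 : ℝ) r, (L + ε • F - κ • (1 : Matrix ι ι ℂ)).PosSemidef)
    {p : ℝ} (hp : p ∈ Ioo (0 : ℝ) 1) :
    HasDerivAt (fun ε : ℝ =>
        ∫ t in Ioi (0 : ℝ), t ^ p • (resolvent (L + ε • F) t * F * resolvent (L + ε • F) t))
      (∫ t in Ioi (0 : ℝ), t ^ p • -((2 : ℝ) • (resolvent (L + (0 : ℝ) • F) t * F *
        resolvent (L + (0 : ℝ) • F) t * F * resolvent (L + (0 : ℝ) • F) t))) 0 := by
  have h0 : (0 : ℝ) ∈ Metric.ball (0 : ℝ) r := Metric.mem_ball_self hr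
  have hpd : ∀ ε ∈ Metric.ball (0 : ℝ) r, (L + ε • F).PosDef := fun ε hε =>
    (norm_resolvent_le hκ (hlow ε hε) le_rfl).1
  refine (hasDerivAt_integral_of_dominated_loc_of_deriv_le (μ := volume.restrict (Ioi 0))
    (s := Metric.ball 0 r)
    (F := fun ε t => t ^ p • (resolvent (L + ε • F) t * F * resolvent (L + ε • F) t))
    (F' := fun ε t => t ^ p • -((2 : ℝ) • (resolvent (L + ε • F) t * F *
        resolvent (L + ε • F) t * F * resolvent (L + ε • F) t)))
    (bound := fun t => 2 * (‖F‖ * ‖F‖ * κ⁻¹) * (κ⁻¹ * Real.rpowIntegrand₀₁ p t κ))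
    (Metric.isOpen_ball.mem_nhds h0) ?_ (hasDerivAt_integral_resolvent hκ hlow hp h0).1 ?_ ?_
    (((Real.integrableOn_rpowIntegrand₀₁_Ioi hp hκ.le).const_mul _).const_mul _) ?_).2
  · filter_upwards [Metric.isOpen_ball.mem_nhds h0] with η hη
    exact (hasDerivAt_integral_resolvent hκ hlow hp hη).1.aestronglyMeasurable
  · have hc := continuousOn_resolvent (hpd 0 h0)
    exact ((continuousOn_rpow_Ioi p).smul (((((hc.mul continuousOn_const).mul
      hc).mul continuousOn_const).mul hc).const_smul (2 : ℝ)).neg).aestronglyMeasurable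
        measurableSet_Ioi
  · refine ae_restrict_of_forall_mem measurableSet_Ioi fun t (ht : 0 < t) η hη => ?_
    have h1 := (norm_resolvent_le hκ (hlow η hη) ht.le).2
    have h2 := Real.rpow_pos_of_pos ht p
    have h3 : (t + κ)⁻¹ ≤ κ⁻¹ := by gcongr; linarith
    rw [norm_smul, Real.norm_of_nonneg h2.le, norm_neg, norm_smul,
      Real.norm_of_nonneg zero_le_two]
    generalize resolvent (L + η • F) t = R at h1 ⊢
    have h4 : ‖R * F * R * F * R‖ ≤ ‖R‖ * ‖F‖ * ‖R‖ * ‖F‖ * ‖R‖ := by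
      refine (norm_mul_le _ _).trans (mul_le_mul_of_nonneg_right ?_ (norm_nonneg _))
      exact (norm_mul_le _ _).trans (mul_le_mul_of_nonneg_right (norm_mul_mul_le R F)
        (norm_nonneg _))
    have h5 := h1.trans h3
    calc t ^ p * (2 * ‖R * F * R * F * R‖) ≤
          t ^ p * (2 * (‖R‖ * ‖F‖ * ‖R‖ * ‖F‖ * ‖R‖)) := by gcongr
      _ ≤ t ^ p * (2 * ((t + κ)⁻¹ * ‖F‖ * (t + κ)⁻¹ * ‖F‖ * κ⁻¹)) := by gcongr
      _ = 2 * (‖F‖ * ‖F‖ * κ⁻¹) * (t ^ p * ((t + κ)⁻¹ * (t + κ)⁻¹)) := by ring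
      _ ≤ _ := by exact mul_le_mul_of_nonneg_left (rpow_mul_inv_mul_inv_le hp hκ ht) (by positivity)
  · refine ae_restrict_of_forall_mem measurableSet_Ioi fun t (ht : 0 < t) η hη => ?_
    have h := hasDerivAt_resolvent (hpd η hη) ht
    have h2 := (h.mul_const F).mul h
    refine HasDerivAt.const_smul (t ^ p) (h2.congr_deriv ?_)
    generalize resolvent (L + η • F) t = R
    rw [two_smul]
    noncomm_ring

end Derivatives

theorem iteratedDeriv_two_mpow_of_mem_Ioo {L F : Matrix ι ι ℂ} (hL : L.PosDef)
    (hF : F.IsHermitian) {p : ℝ} (hp : p ∈ Ioo (0 : ℝ) 1) :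
    iteratedDeriv 2 (fun ε : ℝ => mpow (L + ε • F) p) 0 = -((2 : ℝ) • secondOrder p L F) := by
  obtain ⟨κ, hκ, r, hr, hlow⟩ := exists_uniform_lower_bound hL hF
  replace hlow : ∀ ε ∈ Metric.ball (0 : ℝ) r,
      (L + ε • F - κ • (1 : Matrix ι ι ℂ)).PosSemidef := fun ε hε => by
    have h : |ε| < r := by simpa using hε
    exact hlow ε h.le
  have h0 : (0 : ℝ) ∈ Metric.ball (0 : ℝ) r := Metric.mem_ball_self hr
  set c := Real.sin (Real.pi * p) / Real.pi with hc
  have h1 : ∀ᶠ ε in 𝓝 (0 : ℝ), HasDerivAt (fun ε : ℝ => mpow (L + ε • F) p)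
      (c • ∫ t in Ioi (0 : ℝ), t ^ p • (resolvent (L + ε • F) t * F * resolvent (L + ε • F) t))
        ε := by
    filter_upwards [Metric.isOpen_ball.mem_nhds h0] with ε hε
    refine ((hasDerivAt_integral_resolvent hκ hlow hp hε).2.const_smul c).congr_of_eventuallyEq ?_
    filter_upwards [Metric.isOpen_ball.mem_nhds hε] with η hη
    exact (mpow_eq_integral (norm_resolvent_le hκ (hlow η hη) le_rfl).1 hp).2
  rw [iteratedDeriv_two_eq h1
    ((hasDerivAt_integral_resolvent_mul_resolvent hr hκ hlow hp).const_smul c), secondOrder, ← hc]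
  have h2 : ∀ t : ℝ, t ^ p • -((2 : ℝ) • (resolvent (L + (0 : ℝ) • F) t * F *
      resolvent (L + (0 : ℝ) • F) t * F * resolvent (L + (0 : ℝ) • F) t)) =
      (-2 : ℝ) • (t ^ p • (resolvent L t * F * resolvent L t * F * resolvent L t)) := fun t => by
    rw [zero_smul, add_zero, ← neg_smul, smul_comm]
  simp only [h2]
  rw [integral_smul, smul_comm, neg_smul]
  rfl

theorem iteratedDeriv_two_mpow {L F : Matrix ι ι ℂ} (hL : L.PosDef) (hF : F.IsHermitian) {p : ℝ}
    (hp : p ∈ Icc (0 : ℝ) 1) :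
    iteratedDeriv 2 (fun ε : ℝ => mpow (L + ε • F) p) 0 = -((2 : ℝ) • secondOrder p L F) := by
  rcases hp.1.eq_or_lt with rfl | h0
  · have h : (fun ε : ℝ => mpow (L + ε • F) 0) =ᶠ[𝓝 0] fun _ => 1 :=
      (eventually_posDef_add_smul hL hF).mono fun ε h => mpow_zero h
    rw [iteratedDeriv_two_congr h]
    simp [secondOrder, iteratedDeriv_const]
  rcases hp.2.eq_or_lt with rfl | h1
  · have h : (fun ε : ℝ => mpow (L + ε • F) 1) =ᶠ[𝓝 0] fun ε => L + ε • F :=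
      (eventually_posDef_add_smul hL hF).mono fun ε h => mpow_one h.isHermitian
    rw [iteratedDeriv_two_congr h, iteratedDeriv_two_eq (f' := fun _ => F) (f'' := 0)]
    · simp [secondOrder]
    · exact Eventually.of_forall fun ε => by
        simpa using ((hasDerivAt_id ε).smul_const F).const_add L
    · exact hasDerivAt_const _ _
  exact iteratedDeriv_two_mpow_of_mem_Ioo hL hF ⟨h0, h1⟩

theorem posSemidef_secondOrder {L F : Matrix ι ι ℂ} (hL : L.PosDef) (hF : F.IsHermitian) {p : ℝ}
    (hp : p ∈ Icc (0 : ℝ) 1) : (secondOrder p L F).PosSemidef := by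
  refine Matrix.PosSemidef.smul (posSemidef_integral
    (ae_restrict_of_forall_mem measurableSet_Ioi fun t (ht : 0 < t) => ?_)) ?_
  · refine Matrix.PosSemidef.smul ?_ (Real.rpow_nonneg ht.le p)
    obtain ⟨U, d, hd, rfl⟩ := exists_conjDiag_pos hL
    have h1 : (resolvent (conjDiag U d) t).PosSemidef := by
      rw [resolvent_conjDiag hd ht.le, posSemidef_conjDiag_iff]
      intro i
      have := hd i
      positivity
    have h2 := h1.mul_mul_conjTranspose_same (resolvent (conjDiag U d) t * F)
    rwa [Matrix.conjTranspose_mul, hF.eq, h1.isHermitian.eq, ← mul_assoc] at h2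
  · refine div_nonneg (Real.sin_nonneg_of_nonneg_of_le_pi ?_ ?_) Real.pi_pos.le
    · exact mul_nonneg Real.pi_pos.le hp.1
    · exact mul_le_of_le_one_right Real.pi_pos.le hp.2

end SecondOrder

/-! ### Step sequences along the dyadic tree -/

section StepSequences

/-- A signed sum of powers `2⁻ᵐ` with `m ≤ k` is a multiple of `2⁻ᵏ`. -/
theorem exists_int_sum_steps (k : ℕ) (w : List (ℕ × ℤ)) (hw : ∀ x ∈ w, x.1 ≤ k) :
    ∃ z : ℤ, (w.map fun x => (x.2 : ℝ) / 2 ^ x.1).sum = z / 2 ^ k := by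
  induction w with
  | nil => exact ⟨0, by simp⟩
  | cons x w ih =>
    obtain ⟨z, hz⟩ := ih fun y hy => hw y (List.mem_cons_of_mem _ hy)
    obtain ⟨j, hj⟩ := Nat.exists_eq_add_of_le (hw x List.mem_cons_self)
    refine ⟨x.2 * 2 ^ j + z, ?_⟩
    rw [List.map_cons, List.sum_cons, hz, hj]
    push_cast
    rw [pow_add]
    field_simp

theorem stepSequences_self (k l l₀ : ℕ) : stepSequences k l k l₀ = if l₀ = l then {[]} else ∅ := by
  have h : ∀ w ∈ stepSequences k l k l₀, w = [] ∧ l₀ = l := by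
    rintro w ⟨-, h2, h3⟩
    have hw : w = [] := List.eq_nil_iff_forall_not_mem.2 fun x hx => by
      have := h2 x hx
      omega
    subst hw
    refine ⟨rfl, ?_⟩
    have h4 : (2 : ℝ) ^ k ≠ 0 := by positivity
    simp only [List.map_nil, List.sum_nil] at h3
    rw [sub_eq_zero, div_left_inj' h4] at h3
    exact_mod_cast h3
  split_ifs with hl
  · subst hl
    refine Set.eq_singleton_iff_unique_mem.2 ⟨?_, fun w hw => (h w hw).1⟩
    simp [stepSequences]
  · exact Set.eq_empty_iff_forall_notMem.2 fun w hw => hl (h w hw).2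

/-- The steps from `l₀ / 2^k₀` down to level `k + 1`: either no step is made at level `k + 1`, and
the end point is already of level `k`, or the last step is one of the two steps `± 2^(-(k+1))`. -/
theorem mem_stepSequences_succ {k L k₀ l₀ : ℕ} (hk : k₀ ≤ k) {w : List (ℕ × ℤ)}
    (hw : w ∈ stepSequences (k + 1) L k₀ l₀) :
    (Even L ∧ (∀ x ∈ w, x.1 ≤ k)) ∨
      ∃ (v : List (ℕ × ℤ)) (c : ℤ), (c = 1 ∨ c = -1) ∧ Odd L ∧ w = v ++ [(k + 1, c)] ∧
        ∀ x ∈ v, x.1 ≤ k := by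
  obtain ⟨h1, h2, h3⟩ := hw
  obtain ⟨j, rfl⟩ := Nat.exists_eq_add_of_le hk
  have e0 : (2 : ℝ) ^ (k₀ + j + 1) ≠ 0 := by positivity
  by_cases hle : ∀ x ∈ w, x.1 ≤ k₀ + j
  · refine Or.inl ⟨?_, hle⟩
    obtain ⟨z, hz⟩ := exists_int_sum_steps (k₀ + j) w hle
    rw [hz] at h3
    have h4 : (L : ℤ) = 2 * (l₀ * 2 ^ j - z) := by
      have : (L : ℝ) = 2 * (l₀ * 2 ^ j - z) := by
        rw [pow_add, pow_succ, pow_add] at h3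
        field_simp at h3
        linarith
      exact_mod_cast this
    have : Even (L : ℤ) := ⟨l₀ * 2 ^ j - z, by rw [h4]; ring⟩
    exact_mod_cast this
  · right
    rcases List.eq_nil_or_concat' w with rfl | ⟨v, x, rfl⟩
    · simp at hle
    have hx := h2 x (by simp)
    have hv : ∀ y ∈ v, y.1 < x.1 := fun y hy =>
      (List.pairwise_append.1 h1).2.2 y hy x (by simp)
    have hxk : x.1 = k₀ + j + 1 := by
      by_contra hne
      refine hle fun y hy => ?_
      rcases List.mem_append.1 hy with hy | hy
      · have := hv y hy
        omega
      · rw [List.mem_singleton.1 hy]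
        omega
    have hv' : ∀ y ∈ v, y.1 ≤ k₀ + j := fun y hy => by
      have := hv y hy
      omega
    obtain ⟨m, c⟩ := x
    simp only at hxk hx
    subst hxk
    refine ⟨v, c, hx.2.2, ?_, rfl, hv'⟩
    obtain ⟨z, hz⟩ := exists_int_sum_steps (k₀ + j) v hv'
    rw [List.map_append, List.sum_append, hz] at h3
    simp only [List.map_cons, List.map_nil, List.sum_cons, List.sum_nil, add_zero] at h3
    have h4 : (L : ℤ) = 2 * (l₀ * 2 ^ j - z) - c := by
      have : (L : ℝ) = 2 * (l₀ * 2 ^ j - z) - c := by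
        rw [pow_succ, pow_add] at h3
        field_simp at h3
        linarith
      exact_mod_cast this
    have : Odd (L : ℤ) := by
      rcases hx.2.2 with rfl | rfl
      · exact ⟨l₀ * 2 ^ j - z - 1, by rw [h4]; ring⟩
      · exact ⟨l₀ * 2 ^ j - z, by rw [h4]; ring⟩
    exact_mod_cast this

theorem stepSequences_succ_even {k k₀ : ℕ} (hk : k₀ ≤ k) (l l₀ : ℕ) :
    stepSequences (k + 1) (2 * l) k₀ l₀ = stepSequences k l k₀ l₀ := by
  have e : ((2 * l : ℕ) : ℝ) / 2 ^ (k + 1) = l / 2 ^ k := by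
    push_cast; rw [pow_succ]; field_simp
  ext w
  constructor
  · intro hw
    rcases mem_stepSequences_succ hk hw with h | ⟨_, _, -, h, -⟩
    · obtain ⟨h1, h2, h3⟩ := hw
      refine ⟨h1, fun x hx => ⟨(h2 x hx).1, h.2 x hx, (h2 x hx).2.2⟩, ?_⟩
      rwa [e] at h3
    · exact absurd h (Nat.not_odd_iff_even.2 ⟨l, by ring⟩)
  · rintro ⟨h1, h2, h3⟩
    refine ⟨h1, fun x hx => ⟨(h2 x hx).1, (h2 x hx).2.1.trans k.le_succ, (h2 x hx).2.2⟩, ?_⟩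
    rwa [e]

theorem append_mem_stepSequences_succ {k k₀ : ℕ} (hk : k₀ ≤ k) {l L l₀ : ℕ} {c : ℤ}
    (hc : c = 1 ∨ c = -1) (hL : (L : ℤ) + c = 2 * l) {v : List (ℕ × ℤ)}
    (hv : ∀ x ∈ v, x.1 ≤ k) :
    v ++ [(k + 1, c)] ∈ stepSequences (k + 1) L k₀ l₀ ↔ v ∈ stepSequences k l k₀ l₀ := by
  have e : (l : ℝ) / 2 ^ k = L / 2 ^ (k + 1) + c / 2 ^ (k + 1) := by
    have : (L : ℝ) + c = 2 * l := by exact_mod_cast hL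
    rw [← add_div, this, pow_succ]
    field_simp
  constructor
  · rintro ⟨h1, h2, h3⟩
    refine ⟨(List.pairwise_append.1 h1).1, fun x hx => ?_, ?_⟩
    · have := h2 x (List.mem_append_left _ hx)
      exact ⟨this.1, hv x hx, this.2.2⟩
    · rw [List.map_append, List.sum_append] at h3
      simp only [List.map_cons, List.map_nil, List.sum_cons, List.sum_nil, add_zero] at h3
      rw [e]
      linarith
  · rintro ⟨h1, h2, h3⟩
    refine ⟨List.pairwise_append.2 ⟨h1, List.pairwise_singleton _ _, fun x hx y hy => ?_⟩,
      fun x hx => ?_, ?_⟩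
    · rw [List.mem_singleton.1 hy]
      exact Nat.lt_succ_of_le (hv x hx)
    · rcases List.mem_append.1 hx with hx | hx
      · have := h2 x hx
        exact ⟨this.1, this.2.1.trans k.le_succ, this.2.2⟩
      · rw [List.mem_singleton.1 hx]
        exact ⟨Nat.lt_succ_of_le hk, le_rfl, hc⟩
    · rw [List.map_append, List.sum_append, ← h3]
      simp only [List.map_cons, List.map_nil, List.sum_cons, List.sum_nil, add_zero]
      rw [e]
      ring

theorem stepSequences_succ_odd {k k₀ : ℕ} (hk : k₀ ≤ k) (l l₀ : ℕ) :
    stepSequences (k + 1) (2 * l + 1) k₀ l₀ =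
      (fun v => v ++ [(k + 1, 1)]) '' stepSequences k (l + 1) k₀ l₀ ∪
      (fun v => v ++ [(k + 1, -1)]) '' stepSequences k l k₀ l₀ := by
  have hle : ∀ {l : ℕ} {v : List (ℕ × ℤ)}, v ∈ stepSequences k l k₀ l₀ → ∀ x ∈ v, x.1 ≤ k :=
    fun hv x hx => (hv.2.1 x hx).2.1
  ext w
  constructor
  · intro hw
    rcases mem_stepSequences_succ hk hw with h | ⟨v, c, hc, -, rfl, hv⟩
    · exact absurd h.1 (Nat.not_even_iff_odd.2 ⟨l, rfl⟩)
    · rcases hc with rfl | rfl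
      · refine Or.inl ⟨v, ?_, rfl⟩
        exact (append_mem_stepSequences_succ hk (Or.inl rfl) (by push_cast; ring) hv).1 hw
      · refine Or.inr ⟨v, ?_, rfl⟩
        exact (append_mem_stepSequences_succ hk (Or.inr rfl) (by push_cast; ring) hv).1 hw
  · rintro (⟨v, hv, rfl⟩ | ⟨v, hv, rfl⟩)
    · exact (append_mem_stepSequences_succ hk (Or.inl rfl) (by push_cast; ring) (hle hv)).2 hv
    · exact (append_mem_stepSequences_succ hk (Or.inr rfl) (by push_cast; ring) (hle hv)).2 hv

end StepSequences

/-! ### The expansion of the curvature along the dyadic tree -/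

section Tree

variable {n m : Type*} [Fintype n] [DecidableEq n] [Fintype m] [DecidableEq m]
  {Ψ V : Matrix n n ℂ} {Φ W : Matrix m m ℂ}

theorem Y_self (p : ℝ) (k l l₀ : ℕ) :
    Y Ψ V Φ W p k l k l₀ = if l₀ = l then source Ψ V Φ W p k l₀ else 0 := by
  have h := stepSequences_self k l l₀
  rw [Y]
  split_ifs at h ⊢ with hl
  · rw [show (stepSequences_finite k l k l₀).toFinset = {[]} by
      rw [← Finset.coe_inj, Set.Finite.coe_toFinset, h]; simp]
    simp
  · rw [show (stepSequences_finite k l k l₀).toFinset = ∅ by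
      rw [← Finset.coe_inj, Set.Finite.coe_toFinset, h]; simp]
    simp

theorem Y_succ_even {k k₀ : ℕ} (hk : k₀ ≤ k) (p : ℝ) (l l₀ : ℕ) :
    Y Ψ V Φ W p (k + 1) (2 * l) k₀ l₀ = Y Ψ V Φ W p k l k₀ l₀ := by
  rw [Y, Y]
  congr 1
  rw [← Finset.coe_inj, Set.Finite.coe_toFinset, Set.Finite.coe_toFinset,
    stepSequences_succ_even hk]

/-- The last step into an odd point of level `k + 1` comes from its right or its left neighbour. -/
theorem Y_succ_odd (hΨ : Ψ.PosDef) (hΦ : Φ.PosDef) {k k₀ : ℕ} (hk : k₀ ≤ k) (p : ℝ) (l l₀ : ℕ) :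
    Y Ψ V Φ W p (k + 1) (2 * l + 1) k₀ l₀ =
      Dop Ψ Φ (p / 2 ^ (k + 1)) (Y Ψ V Φ W p k (l + 1) k₀ l₀) +
      Dop Ψ Φ (-(p / 2 ^ (k + 1))) (Y Ψ V Φ W p k l k₀ l₀) := by
  classical
  have hinj : ∀ c : ℤ, Function.Injective fun v : List (ℕ × ℤ) => v ++ [(k + 1, c)] :=
    fun c => List.append_left_injective _
  have e : (stepSequences_finite (k + 1) (2 * l + 1) k₀ l₀).toFinset =
      (stepSequences_finite k (l + 1) k₀ l₀).toFinset.image (fun v => v ++ [(k + 1, 1)]) ∪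
      (stepSequences_finite k l k₀ l₀).toFinset.image fun v => v ++ [(k + 1, -1)] := by
    rw [← Finset.coe_inj]
    push_cast
    simp only [Set.Finite.coe_toFinset]
    exact stepSequences_succ_odd hk l l₀
  have hdisj : Disjoint
      ((stepSequences_finite k (l + 1) k₀ l₀).toFinset.image (fun v => v ++ [(k + 1, (1 : ℤ))]))
      ((stepSequences_finite k l k₀ l₀).toFinset.image fun v => v ++ [(k + 1, (-1 : ℤ))]) := by
    rw [Finset.disjoint_left]
    intro w h1 h2
    obtain ⟨v, -, rfl⟩ := Finset.mem_image.1 h1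
    obtain ⟨v', -, h⟩ := Finset.mem_image.1 h2
    have := List.append_inj_right' h rfl
    simp at this
  rw [Y, e, Finset.sum_union hdisj, Finset.sum_image (hinj 1).injOn,
    Finset.sum_image (hinj (-1)).injOn]
  simp only [List.foldl_append, List.foldl_cons, List.foldl_nil, Dop_eq_lyap]
  rw [Y, Y, lyap_sum (posDef_Kmat hΨ hΦ _), lyap_sum (posDef_Kmat hΨ hΦ _)]
  simp [neg_div, Dop_eq_lyap]

theorem posSemidef_source (hΨ : Ψ.PosDef) (hΦ : Φ.PosDef) (hV : V.IsHermitian)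
    (hW : W.IsHermitian) {p : ℝ} (hp : p ∈ Set.Icc (0 : ℝ) 1) (k l : ℕ) :
    (source Ψ V Φ W p k l).PosSemidef := by
  rcases k with _ | k
  · rcases l with _ | l
    · exact Matrix.PosSemidef.one.kronecker (posSemidef_secondOrder hΦ hW hp)
    · exact (posSemidef_secondOrder hΨ hV hp).kronecker Matrix.PosSemidef.one
  · exact posSemidef_source_succ hΨ hΦ hV hW p k l

theorem posSemidef_Y (hΨ : Ψ.PosDef) (hΦ : Φ.PosDef) (hV : V.IsHermitian)
    (hW : W.IsHermitian) {p : ℝ} (hp : p ∈ Set.Icc (0 : ℝ) 1) (k l k₀ l₀ : ℕ) :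
    (Y Ψ V Φ W p k l k₀ l₀).PosSemidef := by
  refine Matrix.posSemidef_sum _ fun w hw => ?_
  clear hw
  induction w using List.reverseRecOn with
  | nil => exact posSemidef_source hΨ hΦ hV hW hp k₀ l₀
  | append_singleton w x ih =>
    rw [List.foldl_append]
    exact posSemidef_lyap (posDef_Kmat hΨ hΦ _).isHermitian ih

/-- `Y` vanishes unless `|l₀ / 2^k₀ - l / 2^k| < 2^(-k₀)`. -/
theorem Y_eq_zero (hΨ : Ψ.PosDef) (hΦ : Φ.PosDef) (p : ℝ) (k₀ l₀ j : ℕ) :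
    ∀ l : ℕ, ¬ |(l₀ : ℤ) * 2 ^ j - l| < 2 ^ j → Y Ψ V Φ W p (k₀ + j) l k₀ l₀ = 0 := by
  induction j with
  | zero =>
    intro l h
    rw [add_zero, Y_self, if_neg]
    rintro rfl
    simp at h
  | succ j ih =>
    intro l h
    rw [← add_assoc]
    rw [abs_lt, pow_succ] at h
    have hpos : (0 : ℤ) < 2 ^ j := by positivity
    rcases Nat.even_or_odd' l with ⟨a, rfl | rfl⟩
    · rw [Y_succ_even (Nat.le_add_right _ _)]
      refine ih a fun h' => h ?_
      rw [abs_lt] at h'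
      push_cast
      constructor <;> linarith
    · rw [Y_succ_odd hΨ hΦ (Nat.le_add_right _ _), ih, ih, Dop_eq_lyap, Dop_eq_lyap, lyap_zero,
        lyap_zero, add_zero]
      all_goals
        refine fun h' => h ?_
        rw [abs_lt] at h'
        push_cast at h' ⊢
        rw [← mul_assoc]
        constructor <;> omega

/-- At an end point of `[0, 1]` one of the tensor factors is constant, and the curvature is the
second-order term of the other one. -/
theorem curvature_left (hΨ : Ψ.PosDef) (hΦ : Φ.PosDef) (hV : V.IsHermitian)
    (hW : W.IsHermitian) {p : ℝ} (hp : p ∈ Set.Icc (0 : ℝ) 1) :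
    curvature Ψ V Φ W 0 p = source Ψ V Φ W p 0 0 := by
  have h : G Ψ V Φ W 0 p =ᶠ[nhds 0] fun ε => kronRight n m (mpow (Φ + ε • W) p) :=
    (eventually_posDef_add_smul hΨ hV).mono fun ε h => by
      rw [G, mpow_zero h]; rfl
  rw [curvature, iteratedDeriv_two_congr h,
    iteratedDeriv_two_clm _ (contDiffAt_mpow_add_smul hΦ hW p), iteratedDeriv_two_mpow hΦ hW hp,
    map_neg, map_smul, smul_neg, neg_neg, smul_smul, kronRight_apply]
  norm_num
  rfl

theorem curvature_right (hΨ : Ψ.PosDef) (hΦ : Φ.PosDef) (hV : V.IsHermitian)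
    (hW : W.IsHermitian) {p : ℝ} (hp : p ∈ Set.Icc (0 : ℝ) 1) :
    curvature Ψ V Φ W p 0 = source Ψ V Φ W p 0 1 := by
  have h : G Ψ V Φ W p 0 =ᶠ[nhds 0] fun ε => kronLeft n m (mpow (Ψ + ε • V) p) :=
    (eventually_posDef_add_smul hΦ hW).mono fun ε h => by
      rw [G, mpow_zero h]; rfl
  rw [curvature, iteratedDeriv_two_congr h,
    iteratedDeriv_two_clm _ (contDiffAt_mpow_add_smul hΨ hV p), iteratedDeriv_two_mpow hΨ hV hp,
    map_neg, map_smul, smul_neg, neg_neg, smul_smul, kronLeft_apply]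
  norm_num
  rfl

/-- The vertices of level `k` of the dyadic tree: `l / 2^k ∈ [0, 1]` in lowest terms. -/
def vertices (k : ℕ) : Finset ℕ :=
  (Finset.range (2 ^ k + 1)).filter fun l => 1 ≤ k → l % 2 = 1

theorem curvature_eq_sum_vertices (hΨ : Ψ.PosDef) (hΦ : Φ.PosDef) (hV : V.IsHermitian)
    (hW : W.IsHermitian) {p : ℝ} (hp : p ∈ Set.Icc (0 : ℝ) 1) (k : ℕ) : ∀ l : ℕ, l ≤ 2 ^ k →
    curvature Ψ V Φ W (p * (l / 2 ^ k)) (p * (1 - l / 2 ^ k)) =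
      ∑ k₀ ∈ Finset.range (k + 1), ∑ l₀ ∈ vertices k₀, Y Ψ V Φ W p k l k₀ l₀ := by
  induction k with
  | zero =>
    intro l hl
    have hv : vertices 0 = {0, 1} := rfl
    rw [Finset.sum_range_one, hv, Finset.sum_pair zero_ne_one, Y_self, Y_self]
    rw [pow_zero] at hl
    interval_cases l
    · simpa using curvature_left hΨ hΦ hV hW hp
    · simpa using curvature_right hΨ hΦ hV hW hp
  | succ k ih =>
    intro l hl
    have hle : ∀ k₀ ∈ Finset.range (k + 1), k₀ ≤ k := fun k₀ h =>
      Nat.le_of_lt_succ (Finset.mem_range.1 h)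
    rw [pow_succ] at hl
    rw [Finset.sum_range_succ]
    simp only [Y_self]
    rw [Finset.sum_ite_eq']
    rcases Nat.even_or_odd' l with ⟨a, rfl | rfl⟩
    · have hnot : 2 * a ∉ vertices (k + 1) := fun h => by
        have := (Finset.mem_filter.1 h).2 (Nat.succ_pos k)
        omega
      rw [if_neg hnot, add_zero, Finset.sum_congr rfl fun k₀ h => Finset.sum_congr rfl fun l₀ _ =>
        Y_succ_even (hle k₀ h) p a l₀, ← ih a (by omega)]
      have e : ((2 * a : ℕ) : ℝ) / 2 ^ (k + 1) = a / 2 ^ k := by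
        push_cast; rw [pow_succ]; field_simp
      rw [e]
    · have hmem : 2 * a + 1 ∈ vertices (k + 1) :=
        Finset.mem_filter.2 ⟨Finset.mem_range.2 (by rw [pow_succ]; omega), fun _ => by omega⟩
      rw [if_pos hmem, curvature_dyadic hΨ hΦ hV hW, ih a (by omega), ih (a + 1) (by omega),
        Finset.sum_congr rfl fun k₀ h => Finset.sum_congr rfl fun l₀ _ =>
          Y_succ_odd hΨ hΦ (hle k₀ h) p a l₀]
      simp only [Finset.sum_add_distrib, Dop_eq_lyap, lyap_sum (posDef_Kmat hΨ hΦ _)]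
      abel

theorem curvature_eq_sum_ancestors (hΨ : Ψ.PosDef) (hΦ : Φ.PosDef) (hV : V.IsHermitian)
    (hW : W.IsHermitian) {p : ℝ} (hp : p ∈ Set.Icc (0 : ℝ) 1) {k l : ℕ} (hl : l ≤ 2 ^ k) :
    curvature Ψ V Φ W (p * (l / 2 ^ k)) (p * (1 - l / 2 ^ k)) =
      ∑ x ∈ ancestors k l, Y Ψ V Φ W p k l x.1 x.2 := by
  rw [curvature_eq_sum_vertices hΨ hΦ hV hW hp k l hl]
  have h1 := Finset.sum_finset_product
    ((Finset.range (k + 1) ×ˢ Finset.range (2 ^ k + 1)).filter fun x =>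
      x.2 ≤ 2 ^ x.1 ∧ (1 ≤ x.1 → x.2 % 2 = 1)) (Finset.range (k + 1)) vertices
    (f := fun x => Y Ψ V Φ W p k l x.1 x.2) fun x => by
      have : x.1 < k + 1 → 2 ^ x.1 ≤ 2 ^ k := fun h =>
        Nat.pow_le_pow_right two_pos (Nat.le_of_lt_succ h)
      simp only [Finset.mem_filter, Finset.mem_product, Finset.mem_range, vertices]
      constructor
      · rintro ⟨⟨h1, h2⟩, h3, h4⟩
        exact ⟨h1, by omega, h4⟩
      · rintro ⟨h1, h2, h3⟩
        have := this h1
        exact ⟨⟨h1, by omega⟩, by omega, h3⟩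
  rw [← h1]
  refine (Finset.sum_subset (fun x hx => ?_) fun x hx hx' => ?_).symm
  · obtain ⟨h1, h2, h3, -⟩ := Finset.mem_filter.1 hx
    exact Finset.mem_filter.2 ⟨h1, h2, fun h => Nat.odd_iff.1 (h3 h)⟩
  · obtain ⟨h1, h2, h3⟩ := Finset.mem_filter.1 hx
    obtain ⟨k₀, l₀⟩ := x
    simp only [Finset.mem_product, Finset.mem_range] at h1 h2 h3 ⊢
    obtain ⟨j, rfl⟩ := Nat.exists_eq_add_of_le (Nat.le_of_lt_succ h1.1)
    refine Y_eq_zero hΨ hΦ p k₀ l₀ j l fun h => hx' ?_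
    refine Finset.mem_filter.2 ⟨Finset.mem_product.2
      ⟨Finset.mem_range.2 h1.1, Finset.mem_range.2 h1.2⟩, h2, fun h => Nat.odd_iff.2 (h3 h), ?_⟩
    have h4 : |(l₀ : ℝ) * 2 ^ j - l| < 2 ^ j := by exact_mod_cast h
    have e : (l₀ : ℝ) / 2 ^ k₀ - l / 2 ^ (k₀ + j) = (l₀ * 2 ^ j - l) / 2 ^ (k₀ + j) := by
      rw [pow_add]
      field_simp
    rw [e, abs_div, abs_of_pos (by positivity : (0 : ℝ) < 2 ^ (k₀ + j)), div_lt_div_iff₀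
      (by positivity) (by positivity), pow_add]
    nlinarith [show (0 : ℝ) < 2 ^ k₀ by positivity]

end Tree

/-! ### The size of the terms of the expansion -/

section Estimate

variable {n m : Type*} [Fintype n] [DecidableEq n] [Fintype m] [DecidableEq m]
  {Ψ V : Matrix n n ℂ} {Φ W : Matrix m m ℂ}

theorem exp_sub_one_le_mul_exp (u : ℝ) : Real.exp u - 1 ≤ u * Real.exp u := by
  have h := Real.add_one_le_exp (-u)
  have h1 := Real.exp_pos u
  have h2 : Real.exp u * Real.exp (-u) = 1 := by rw [← Real.exp_add]; simp
  nlinarith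

theorem abs_exp_sub_one_le_mul_exp (u : ℝ) : |Real.exp u - 1| ≤ |u| * Real.exp |u| := by
  have h0 := Real.one_le_exp (abs_nonneg u)
  rw [abs_le]
  constructor
  · have h1 := Real.add_one_le_exp u
    have h2 := neg_abs_le u
    have h3 : |u| * 1 ≤ |u| * Real.exp |u| := by gcongr
    linarith
  · exact (sub_le_sub_right (Real.exp_le_exp.2 (le_abs_self u)) 1).trans
      (exp_sub_one_le_mul_exp _)

/-- For small `δ` the operator `D_δ` is close to multiplication by `1 / 2`. -/
theorem exists_norm_Dop_sub_le (hΨ : Ψ.PosDef) (hΦ : Φ.PosDef) :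
    ∃ c : ℝ, 0 ≤ c ∧ ∀ δ : ℝ, |δ| ≤ 1 → ∀ F : Matrix (n × m) (n × m) ℂ,
      ‖Dop Ψ Φ δ F - (1 / 2 : ℝ) • F‖ ≤ c * |δ| * ‖F‖ / 2 := by
  obtain ⟨U, d, hd, rfl⟩ := exists_conjDiag_pos hΨ
  obtain ⟨U', d', hd', rfl⟩ := exists_conjDiag_pos hΦ
  set a : n × m → ℝ := fun x => Real.log (d x.1) - Real.log (d' x.2) with ha
  obtain ⟨M, hM0, hM⟩ : ∃ M : ℝ, 0 ≤ M ∧ ∀ x, |a x| ≤ M :=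
    ⟨∑ x, |a x|, by positivity, fun x =>
      Finset.single_le_sum (f := fun x => |a x|) (fun _ _ => abs_nonneg _) (Finset.mem_univ x)⟩
  refine ⟨M * Real.exp M * Real.exp M, by positivity, fun δ hδ F => ?_⟩
  have hK : Kmat (conjDiag U d) (conjDiag U' d') δ =
      conjDiag (kronUnitary U U') fun x => Real.exp (δ * a x) := by
    rw [Kmat, mpow_conjDiag, mpow_conjDiag, conjDiag_kronecker]
    congr 1
    ext x
    rw [Real.rpow_def_of_pos (hd _), Real.rpow_def_of_pos (hd' _), ← Real.exp_add]
    congr 1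
    simp only [ha]
    ring
  have hu : ∀ x, |δ * a x| ≤ |δ| * M := fun x => by
    rw [abs_mul]
    exact mul_le_mul_of_nonneg_left (hM x) (abs_nonneg _)
  have hu1 : ∀ x, |δ * a x| ≤ M := fun x =>
    (hu x).trans (mul_le_of_le_one_left hM0 hδ)
  have hKpos : (Kmat (conjDiag U d) (conjDiag U' d') δ).PosDef := posDef_Kmat hΨ hΦ δ
  rw [Dop_eq_lyap]
  set K := Kmat (conjDiag U d) (conjDiag U' d') δ with hKdef
  have hK1 : ‖K - 1‖ ≤ |δ| * M * Real.exp M := by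
    rw [hK, ← map_one (conjDiag (kronUnitary U U')), ← map_sub]
    refine norm_conjDiag_le (by positivity) fun x => ?_
    refine (abs_exp_sub_one_le_mul_exp _).trans ?_
    have := hu x
    have := hu1 x
    gcongr
  have hlow : ∀ x, Real.exp (-M) ≤ Real.exp (δ * a x) := fun x =>
    Real.exp_le_exp.2 (abs_le.1 (hu1 x)).1
  -- `F / 2` solves the equation with right-hand side `F + R`
  set R : Matrix (n × m) (n × m) ℂ := (1 / 2 : ℝ) • ((K - 1) * F + F * (K - 1)) with hR
  have h1 : lyap K (F + R) = (1 / 2 : ℝ) • F := by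
    refine lyap_eq_of_mul_add_mul hKpos ?_
    rw [hR, mul_smul_comm, smul_mul_assoc, sub_mul, mul_sub, one_mul, mul_one]
    match_scalars <;> norm_num
  have h2 : lyap K F - (1 / 2 : ℝ) • F = -lyap K R := by
    rw [← h1, lyap_add hKpos]
    abel
  have h3 : ‖R‖ ≤ |δ| * M * Real.exp M * ‖F‖ := by
    have h4 : ‖(K - 1) * F‖ ≤ |δ| * M * Real.exp M * ‖F‖ :=
      (norm_mul_le _ _).trans (mul_le_mul_of_nonneg_right hK1 (norm_nonneg _))
    have h5 : ‖F * (K - 1)‖ ≤ ‖F‖ * (|δ| * M * Real.exp M) :=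
      (norm_mul_le _ _).trans (mul_le_mul_of_nonneg_left hK1 (norm_nonneg _))
    rw [hR, norm_smul, Real.norm_of_nonneg (by norm_num)]
    have := norm_add_le ((K - 1) * F) (F * (K - 1))
    linarith
  rw [h2, norm_neg, hK]
  refine (norm_lyap_le (Real.exp_pos (-M)) hlow R).trans ?_
  rw [Real.exp_neg, div_le_iff₀ (by positivity)]
  refine h3.trans (le_of_eq ?_)
  have := (Real.exp_pos M).ne'
  field_simp

/-- The tent function `max 0 (2^j - |l₀ 2^j - l|)`, which is `2^j` times the fraction of the source
at `l₀` that reaches `l` when every `D_δ` is replaced by the factor `1 / 2`. -/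
def tent (l₀ j l : ℕ) : ℤ := max 0 (2 ^ j - |(l₀ : ℤ) * 2 ^ j - l|)

theorem tent_zero (l₀ l : ℕ) : tent l₀ 0 l = if l₀ = l then 1 else 0 := by
  rw [tent]
  split_ifs with h
  · simp [h]
  · simp only [pow_zero, mul_one]
    have : (l₀ : ℤ) - l ≠ 0 := by omega
    have := Int.one_le_abs this
    omega

theorem tent_succ_even (l₀ j l : ℕ) : tent l₀ (j + 1) (2 * l) = 2 * tent l₀ j l := by
  rw [tent, tent, pow_succ, ← mul_assoc]
  push_cast
  generalize (l₀ : ℤ) * 2 ^ j = a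
  generalize (2 : ℤ) ^ j = b
  simp only [abs_eq_max_neg]
  omega

theorem tent_succ_odd (l₀ j l : ℕ) :
    tent l₀ (j + 1) (2 * l + 1) = tent l₀ j (l + 1) + tent l₀ j l := by
  rw [tent, tent, tent, pow_succ, ← mul_assoc]
  have hb : (0 : ℤ) < 2 ^ j := by positivity
  push_cast
  generalize (l₀ : ℤ) * 2 ^ j = a at *
  generalize (2 : ℤ) ^ j = b at *
  simp only [abs_eq_max_neg]
  omega

/-- A step to level `k` multiplies the norm of `Y`, relative to its tent multiple of the source, by at
most `1 + c 2⁻ᵏ ≤ exp (c 2⁻ᵏ)`, and these exponents add up to `c (2^(-k₀) - 2^(-(k₀ + j)))`. -/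
theorem norm_Y_sub_le (hΨ : Ψ.PosDef) (hΦ : Φ.PosDef) {c : ℝ} (hc : 0 ≤ c)
    (hD : ∀ δ : ℝ, |δ| ≤ 1 → ∀ F : Matrix (n × m) (n × m) ℂ,
      ‖Dop Ψ Φ δ F - (1 / 2 : ℝ) • F‖ ≤ c * |δ| * ‖F‖ / 2)
    {p : ℝ} (hp : p ∈ Set.Icc (0 : ℝ) 1) (k₀ l₀ j : ℕ) : ∀ l : ℕ,
    ‖Y Ψ V Φ W p (k₀ + j) l k₀ l₀ - ((tent l₀ j l : ℝ) / 2 ^ j) • source Ψ V Φ W p k₀ l₀‖ ≤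
      (tent l₀ j l : ℝ) / 2 ^ j * (Real.exp (c * (1 / 2 ^ k₀ - 1 / 2 ^ (k₀ + j))) - 1) *
        ‖source Ψ V Φ W p k₀ l₀‖ := by
  have htent : ∀ j l, (0 : ℝ) ≤ (tent l₀ j l : ℝ) / 2 ^ j := fun j l =>
    div_nonneg (by exact_mod_cast le_max_left _ _) (by positivity)
  set S := source Ψ V Φ W p k₀ l₀ with hS
  induction j with
  | zero =>
    intro l
    rw [add_zero, Y_self, tent_zero]
    split_ifs <;> simp [hS]
  | succ j ih =>
    intro l
    rw [← add_assoc]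
    set E := Real.exp (c * (1 / 2 ^ k₀ - 1 / 2 ^ (k₀ + j))) with hE
    set δ := p / 2 ^ (k₀ + j + 1) with hδ
    have hE0 : 0 < E := Real.exp_pos _
    have hpow : (1 : ℝ) ≤ 2 ^ (k₀ + j + 1) := one_le_pow₀ one_le_two
    have hδ0 : 0 ≤ δ := div_nonneg hp.1 (by positivity)
    have hδ1 : δ ≤ 1 / 2 ^ (k₀ + j + 1) := by rw [hδ]; gcongr; exact hp.2
    have hδ2 : |δ| ≤ 1 := by
      rw [abs_of_nonneg hδ0]
      exact hδ1.trans (div_le_one_of_le₀ hpow (by positivity))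
    have hEsucc : E * (1 + c * δ) ≤
        Real.exp (c * (1 / 2 ^ k₀ - 1 / 2 ^ (k₀ + j + 1))) := by
      have e : c * (1 / 2 ^ k₀ - 1 / 2 ^ (k₀ + j + 1)) =
          c * (1 / 2 ^ k₀ - 1 / 2 ^ (k₀ + j)) + c * (1 / 2 ^ (k₀ + j + 1) : ℝ) := by
        rw [pow_succ (2 : ℝ) (k₀ + j)]
        field_simp
        ring
      rw [e, Real.exp_add]
      refine mul_le_mul_of_nonneg_left ?_ hE0.le
      have h1 := Real.add_one_le_exp (c * (1 / 2 ^ (k₀ + j + 1) : ℝ))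
      have h2 := mul_le_mul_of_nonneg_left hδ1 hc
      linarith
    rcases Nat.even_or_odd' l with ⟨a, rfl | rfl⟩
    · rw [Y_succ_even (Nat.le_add_right _ _), tent_succ_even]
      have e : ((2 * tent l₀ j a : ℤ) : ℝ) / 2 ^ (j + 1) = (tent l₀ j a : ℝ) / 2 ^ j := by
        push_cast; rw [pow_succ]; field_simp
      rw [e]
      refine (ih a).trans ?_
      have := htent j a
      have : E ≤ Real.exp (c * (1 / 2 ^ k₀ - 1 / 2 ^ (k₀ + j + 1))) :=
        le_trans (le_mul_of_one_le_right hE0.le (by nlinarith)) hEsucc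
      gcongr
    · rw [Y_succ_odd hΨ hΦ (Nat.le_add_right _ _), tent_succ_odd]
      have e : ((tent l₀ j (a + 1) + tent l₀ j a : ℤ) : ℝ) / 2 ^ (j + 1) =
          1 / 2 * ((tent l₀ j (a + 1) : ℝ) / 2 ^ j) + 1 / 2 * ((tent l₀ j a : ℝ) / 2 ^ j) := by
        push_cast; rw [pow_succ]; field_simp
      rw [e]
      -- one step: each of the two neighbours contributes half of its own deviation and the
      -- deviation of `D_δ` from `1 / 2`
      have step : ∀ η : ℝ, |η| = δ → ∀ b : ℕ,
          ‖Dop Ψ Φ η (Y Ψ V Φ W p (k₀ + j) b k₀ l₀) -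
            (1 / 2 * ((tent l₀ j b : ℝ) / 2 ^ j)) • S‖ ≤
          1 / 2 * ((tent l₀ j b : ℝ) / 2 ^ j) * (E * (1 + c * δ) - 1) * ‖S‖ := by
        intro η hη b
        have h1 := hD η (by rw [hη, ← abs_of_nonneg hδ0]; exact hδ2)
          (Y Ψ V Φ W p (k₀ + j) b k₀ l₀)
        have h2 := ih b
        have ht := htent j b
        generalize Y Ψ V Φ W p (k₀ + j) b k₀ l₀ = y at h1 h2 ⊢
        generalize (tent l₀ j b : ℝ) / 2 ^ j = w at h2 ht ⊢
        rw [hη] at h1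
        have h3 : ‖y‖ ≤ w * E * ‖S‖ := by
          have h4 : ‖y‖ ≤ ‖y - w • S‖ + ‖w • S‖ := by
            simpa using norm_add_le (y - w • S) (w • S)
          rw [norm_smul, Real.norm_of_nonneg ht] at h4
          linarith
        have h5 : Dop Ψ Φ η y - (1 / 2 * w) • S =
            (Dop Ψ Φ η y - (1 / 2 : ℝ) • y) + (1 / 2 : ℝ) • (y - w • S) := by
          rw [smul_sub, smul_smul]
          abel
        have h6 := norm_add_le (Dop Ψ Φ η y - (1 / 2 : ℝ) • y) ((1 / 2 : ℝ) • (y - w • S))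
        rw [← h5, norm_smul, Real.norm_of_nonneg (by norm_num)] at h6
        have h7 : c * δ * ‖y‖ ≤ c * δ * (w * E * ‖S‖) := by gcongr
        refine h6.trans ?_
        linarith
      have hs1 := step δ (abs_of_nonneg hδ0) (a + 1)
      have hs2 := step (-δ) (by rw [abs_neg, abs_of_nonneg hδ0]) a
      have ht1 := htent j (a + 1)
      have ht2 := htent j a
      generalize (tent l₀ j (a + 1) : ℝ) / 2 ^ j = w₁ at *
      generalize (tent l₀ j a : ℝ) / 2 ^ j = w₂ at *
      rw [add_smul, add_sub_add_comm]
      refine (norm_add_le _ _).trans ((add_le_add hs1 hs2).trans ?_)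
      rw [← add_mul, ← add_mul]
      gcongr

theorem exists_norm_Y_sub_le (hΨ : Ψ.PosDef) (hΦ : Φ.PosDef) :
    ∃ C : ℝ, 0 < C ∧ ∀ p ∈ Set.Icc (0 : ℝ) 1, ∀ k l : ℕ, ∀ x ∈ ancestors k l,
      ‖Y Ψ V Φ W p k l x.1 x.2 -
          (1 - |(x.2 : ℝ) - (l : ℝ) / 2 ^ (k - x.1)|) • source Ψ V Φ W p x.1 x.2‖ ≤
        C * (1 / 2 ^ x.1) * ‖source Ψ V Φ W p x.1 x.2‖ := by
  obtain ⟨c, hc, hD⟩ := exists_norm_Dop_sub_le hΨ hΦ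
  refine ⟨c * Real.exp c + 1, by positivity, fun p hp k l x hx => ?_⟩
  obtain ⟨k₀, l₀⟩ := x
  obtain ⟨h1, -, -, h2⟩ := Finset.mem_filter.1 hx
  obtain ⟨j, rfl⟩ := Nat.exists_eq_add_of_le
    (Nat.le_of_lt_succ (Finset.mem_range.1 (Finset.mem_product.1 h1).1))
  simp only at h2 ⊢
  have hj : (0 : ℝ) < 2 ^ j := by positivity
  have hk : (0 : ℝ) < 2 ^ k₀ := by positivity
  rw [Nat.add_sub_cancel_left]
  have e1 : (l₀ : ℝ) - l / 2 ^ j = (l₀ * 2 ^ j - l) / 2 ^ j := by field_simp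
  have e2 : (l₀ : ℝ) / 2 ^ k₀ - l / 2 ^ (k₀ + j) = (l₀ - l / 2 ^ j) / 2 ^ k₀ := by
    rw [pow_add]; field_simp
  rw [e2, abs_div, abs_of_pos hk, div_lt_div_iff_of_pos_right hk] at h2
  have e3 : 1 - |(l₀ : ℝ) - l / 2 ^ j| = (tent l₀ j l : ℝ) / 2 ^ j := by
    rw [e1, abs_div, abs_of_pos hj, div_lt_one hj] at h2
    rw [e1, abs_div, abs_of_pos hj, tent, Int.cast_max]
    push_cast
    rw [max_eq_right (by linarith), sub_div, div_self hj.ne']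
  have hw : (tent l₀ j l : ℝ) / 2 ^ j ≤ 1 := by
    rw [← e3]
    linarith [abs_nonneg ((l₀ : ℝ) - l / 2 ^ j)]
  rw [e3]
  refine (norm_Y_sub_le hΨ hΦ hc hD hp k₀ l₀ j l).trans ?_
  refine mul_le_mul_of_nonneg_right ?_ (norm_nonneg _)
  have hk1 : (1 : ℝ) / 2 ^ k₀ ≤ 1 := div_le_one_of_le₀ (one_le_pow₀ one_le_two) hk.le
  have hkj : (1 : ℝ) / 2 ^ (k₀ + j) ≤ 1 / 2 ^ k₀ := by
    gcongr
    · exact one_le_two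
    · omega
  have h0 : 0 ≤ c * (1 / 2 ^ k₀ - 1 / 2 ^ (k₀ + j) : ℝ) := mul_nonneg hc (sub_nonneg.2 hkj)
  calc (tent l₀ j l : ℝ) / 2 ^ j * (Real.exp (c * (1 / 2 ^ k₀ - 1 / 2 ^ (k₀ + j))) - 1)
      ≤ 1 * (Real.exp (c * (1 / 2 ^ k₀ - 1 / 2 ^ (k₀ + j))) - 1) :=
        mul_le_mul_of_nonneg_right hw (sub_nonneg.2 (Real.one_le_exp h0))
    _ ≤ Real.exp (c * (1 / 2 ^ k₀)) - 1 := by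
        rw [one_mul]
        gcongr
        exact sub_le_self _ (by positivity)
    _ ≤ c * (1 / 2 ^ k₀) * Real.exp (c * (1 / 2 ^ k₀)) := exp_sub_one_le_mul_exp _
    _ ≤ c * (1 / 2 ^ k₀) * Real.exp c := by
        gcongr
        exact mul_le_of_le_one_right hc hk1
    _ ≤ (c * Real.exp c + 1) * (1 / 2 ^ k₀) := by
        have : (0 : ℝ) < 1 / 2 ^ k₀ := by positivity
        nlinarith

end Estimate

/-! ### The second derivative along a segment, for all exponents -/

section AllExponents

open Filter Topology

/-- The second derivative along a line is a second directional derivative, and it is continuous in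
the base point. -/
theorem iteratedDeriv_two_line {X E : Type*} [NormedAddCommGroup X] [NormedSpace ℝ X]
    [NormedAddCommGroup E] [NormedSpace ℝ E] {f : X → E} {y : X} (hf : ContDiffAt ℝ 2 f y)
    (v : X) :
    iteratedDeriv 2 (fun t : ℝ => f (y + t • v)) 0 =
        fderiv ℝ (fun x => fderiv ℝ f x v) y v ∧
      ContinuousAt (fun x => fderiv ℝ (fun x => fderiv ℝ f x v) x v) y := by
  have hline : ∀ t : ℝ, HasDerivAt (fun t : ℝ => y + t • v) v t := fun t => by
    simpa using ((hasDerivAt_id t).smul_const v).const_add y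
  have h0 : y + (0 : ℝ) • v = y := by simp
  have hcont : Tendsto (fun t : ℝ => y + t • v) (𝓝 0) (𝓝 y) := by
    have h := (hline 0).continuousAt.tendsto
    rwa [h0] at h
  have h1 : ContDiffAt ℝ 1 (fun x => fderiv ℝ f x v) y :=
    (hf.fderiv_right (m := 1) (by norm_num)).clm_apply contDiffAt_const
  refine ⟨iteratedDeriv_two_eq (f' := fun t => fderiv ℝ f (y + t • v) v) ?_ ?_, ?_⟩
  · filter_upwards [hcont.eventually (hf.eventually (by simp))] with t ht
    exact (ht.differentiableAt (by simp)).hasFDerivAt.comp_hasDerivAt t (hline t)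
  · have h2 : HasFDerivAt (fun x => fderiv ℝ f x v) (fderiv ℝ (fun x => fderiv ℝ f x v) y)
        (y + (0 : ℝ) • v) := by
      rw [h0]
      exact (h1.differentiableAt (by simp)).hasFDerivAt
    exact h2.comp_hasDerivAt (0 : ℝ) (hline 0)
  · have h2 : ContDiffAt ℝ 0 (fderiv ℝ fun x => fderiv ℝ f x v) y :=
      h1.fderiv_right (by norm_num)
    exact (h2.clm_apply contDiffAt_const).continuousAt

variable {n m : Type*} [Fintype n] [DecidableEq n] [Fintype m] [DecidableEq m]

section Families

variable {Ψ V : Matrix n n ℂ} {Φ W : Matrix m m ℂ}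

/-- The second derivative depends continuously on the two exponents. -/
theorem continuous_iteratedDeriv_two_G (hΨ : Ψ.PosDef) (hΦ : Φ.PosDef) (hV : V.IsHermitian)
    (hW : W.IsHermitian) :
    Continuous fun x : ℝ × ℝ => iteratedDeriv 2 (G Ψ V Φ W x.1 x.2) 0 := by
  set f : ℝ × ℝ × ℝ → Matrix (n × m) (n × m) ℂ :=
    fun x => mpow (Ψ + x.2.2 • V) x.1 ⊗ₖ mpow (Φ + x.2.2 • W) x.2.1 with hf
  have hsm : ∀ q r : ℝ, ContDiffAt ℝ 2 f (q, r, 0) := fun q r =>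
    contDiffAt_mpow_kronecker (A := fun ε => Ψ + ε • V) (B := fun ε => Φ + ε • W)
      (by fun_prop) (by fun_prop) (isHermitian_add_smul hΨ.isHermitian hV)
      (isHermitian_add_smul hΦ.isHermitian hW) (by simpa using hΨ) (by simpa using hΦ) q r
  refine continuous_iff_continuousAt.2 fun x => ?_
  have h1 := fun x : ℝ × ℝ => iteratedDeriv_two_line (hsm x.1 x.2) ((0, 0, 1) : ℝ × ℝ × ℝ)
  have h2 : ∀ x : ℝ × ℝ, (fun t : ℝ => f ((x.1, x.2, 0) + t • ((0, 0, 1) : ℝ × ℝ × ℝ))) =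
      G Ψ V Φ W x.1 x.2 := fun x => by
    funext t
    simp [hf, G]
  have h3 : (fun x : ℝ × ℝ => iteratedDeriv 2 (G Ψ V Φ W x.1 x.2) 0) =
      (fun y => fderiv ℝ (fun x => fderiv ℝ f x (0, 0, 1)) y (0, 0, 1)) ∘
        fun x : ℝ × ℝ => ((x.1, x.2, 0) : ℝ × ℝ × ℝ) := by
    funext x
    rw [← h2]
    exact (h1 x).1
  rw [h3]
  exact ContinuousAt.comp (h1 x).2 (by fun_prop)

/-- The curvature is positive semidefinite: at dyadic fractions it is a sum of positive
semidefinite terms, and these fractions are dense. -/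
theorem posSemidef_curvature (hΨ : Ψ.PosDef) (hΦ : Φ.PosDef) (hV : V.IsHermitian)
    (hW : W.IsHermitian) {q r : ℝ} (hq : 0 ≤ q) (hr : 0 ≤ r) (hqr : q + r ≤ 1) :
    (curvature Ψ V Φ W q r).PosSemidef := by
  obtain ⟨x, hx0, hx1, hxq, hxr⟩ : ∃ x : ℝ, 0 ≤ x ∧ x ≤ 1 ∧ q = (q + r) * x ∧
      r = (q + r) * (1 - x) := by
    rcases (add_nonneg hq hr).eq_or_lt with h | h
    · exact ⟨0, le_rfl, zero_le_one, by linarith, by linarith⟩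
    · refine ⟨q / (q + r), by positivity, div_le_one_of_le₀ (by linarith) h.le, ?_, ?_⟩ <;>
        field_simp
      ring
  have hlim : Tendsto (fun k : ℕ => (⌊x * 2 ^ k⌋₊ : ℝ) / 2 ^ k) atTop (𝓝 x) :=
    (tendsto_nat_floor_mul_div_atTop hx0).comp (tendsto_pow_atTop_atTop_of_one_lt one_lt_two)
  have hc : Continuous fun y : ℝ => curvature Ψ V Φ W ((q + r) * y) ((q + r) * (1 - y)) :=
    (((continuous_iteratedDeriv_two_G hΨ hΦ hV hW).comp
      (by fun_prop : Continuous fun y : ℝ => ((q + r) * y, (q + r) * (1 - y)))).const_smul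
        (1 / 2 : ℝ)).neg
  have h := isClosed_posSemidef.mem_of_tendsto ((hc.tendsto x).comp hlim)
    (Eventually.of_forall fun k => ?_)
  · rwa [Set.mem_ofPred_eq, ← hxq, ← hxr] at h
  · have hk : ⌊x * 2 ^ k⌋₊ ≤ 2 ^ k := by
      refine Nat.floor_le_of_le ?_
      push_cast
      exact mul_le_of_le_one_left (by positivity) hx1
    have hp : q + r ∈ Set.Icc (0 : ℝ) 1 := ⟨add_nonneg hq hr, hqr⟩
    simp only [Function.comp, Set.mem_ofPred_eq]
    rw [curvature_eq_sum_ancestors hΨ hΦ hV hW hp hk]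
    exact Matrix.posSemidef_sum _ fun y _ => posSemidef_Y hΨ hΦ hV hW hp _ _ _ _

end Families

section Segments

theorem isHermitian_seg {ι : Type*} [Fintype ι] [DecidableEq ι] {A₁ A₂ : Matrix ι ι ℂ}
    (h₁ : A₁.IsHermitian) (h₂ : A₂.IsHermitian) (t : ℝ) : (seg A₁ A₂ t).IsHermitian :=
  (h₁.smul (IsSelfAdjoint.all _)).add (h₂.smul (IsSelfAdjoint.all _))

theorem posDef_seg {ι : Type*} [Fintype ι] [DecidableEq ι] {A₁ A₂ : Matrix ι ι ℂ}
    (h₁ : A₁.PosDef) (h₂ : A₂.PosDef) {t : ℝ} (ht : t ∈ Set.Icc (0 : ℝ) 1) :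
    (seg A₁ A₂ t).PosDef := by
  rcases ht.1.eq_or_lt with rfl | h0
  · simpa [seg] using h₂
  · exact (h₁.smul h0).add_posSemidef (h₂.posSemidef.smul (sub_nonneg.2 ht.2))

theorem seg_add {ι : Type*} [Fintype ι] [DecidableEq ι] (A₁ A₂ : Matrix ι ι ℂ) (t ε : ℝ) :
    seg A₁ A₂ (t + ε) = seg A₁ A₂ t + ε • (A₁ - A₂) := by
  simp only [seg]
  module

variable {A₁ A₂ : Matrix n n ℂ} {B₁ B₂ : Matrix m m ℂ}

theorem contDiffAt_H (hA₁ : A₁.PosDef) (hA₂ : A₂.PosDef) (hB₁ : B₁.PosDef) (hB₂ : B₂.PosDef)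
    (q r : ℝ) {t : ℝ} (ht : t ∈ Set.Icc (0 : ℝ) 1) {N : WithTop ℕ∞} :
    ContDiffAt ℝ N (H A₁ A₂ B₁ B₂ q r) t :=
  contDiffAt_mpow_kronecker_time (A := seg A₁ A₂) (B := seg B₁ B₂)
    (by unfold seg; fun_prop) (by unfold seg; fun_prop)
    (isHermitian_seg hA₁.isHermitian hA₂.isHermitian)
    (isHermitian_seg hB₁.isHermitian hB₂.isHermitian) (posDef_seg hA₁ hA₂ ht)
    (posDef_seg hB₁ hB₂ ht) q r

/-- `ε ↦ H(t + ε)` is the family `G` at the base point `t`. -/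
theorem iteratedDeriv_two_H (A₁ A₂ : Matrix n n ℂ) (B₁ B₂ : Matrix m m ℂ) (q r t : ℝ) :
    iteratedDeriv 2 (H A₁ A₂ B₁ B₂ q r) t =
      iteratedDeriv 2 (G (seg A₁ A₂ t) (A₁ - A₂) (seg B₁ B₂ t) (B₁ - B₂) q r) 0 := by
  have h : G (seg A₁ A₂ t) (A₁ - A₂) (seg B₁ B₂ t) (B₁ - B₂) q r =
      fun ε => H A₁ A₂ B₁ B₂ q r (t + ε) := by
    funext ε
    rw [G, H, seg_add, seg_add]
  rw [h, iteratedDeriv_comp_const_add]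
  simp

theorem iteratedDeriv_two_H_eq_curvature (A₁ A₂ : Matrix n n ℂ) (B₁ B₂ : Matrix m m ℂ)
    (q r t : ℝ) :
    iteratedDeriv 2 (H A₁ A₂ B₁ B₂ q r) t =
      -((2 : ℝ) • curvature (seg A₁ A₂ t) (A₁ - A₂) (seg B₁ B₂ t) (B₁ - B₂) q r) := by
  rw [iteratedDeriv_two_H, curvature, smul_neg, neg_neg, smul_smul]
  norm_num

theorem posSemidef_neg_iteratedDeriv_two_H (hA₁ : A₁.PosDef) (hA₂ : A₂.PosDef) (hB₁ : B₁.PosDef)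
    (hB₂ : B₂.PosDef) {q r : ℝ} (hq : 0 ≤ q) (hr : 0 ≤ r) (hqr : q + r ≤ 1) {t : ℝ}
    (ht : t ∈ Set.Icc (0 : ℝ) 1) : (-iteratedDeriv 2 (H A₁ A₂ B₁ B₂ q r) t).PosSemidef := by
  rw [iteratedDeriv_two_H_eq_curvature, neg_neg]
  exact (posSemidef_curvature (posDef_seg hA₁ hA₂ ht) (posDef_seg hB₁ hB₂ ht)
    (hA₁.isHermitian.sub hA₂.isHermitian) (hB₁.isHermitian.sub hB₂.isHermitian) hq hr
    hqr).smul zero_le_two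

theorem tendsto_iteratedDeriv_two_H (hA₁ : A₁.PosDef) (hA₂ : A₂.PosDef) (hB₁ : B₁.PosDef)
    (hB₂ : B₂.PosDef) {t : ℝ} (ht : t ∈ Set.Icc (0 : ℝ) 1) {q r : ℝ} {u v : ℕ → ℝ}
    (hu : Tendsto u atTop (𝓝 q)) (hv : Tendsto v atTop (𝓝 r)) :
    Tendsto (fun N => iteratedDeriv 2 (H A₁ A₂ B₁ B₂ (u N) (v N)) t) atTop
      (𝓝 (iteratedDeriv 2 (H A₁ A₂ B₁ B₂ q r) t)) := by
  simp only [iteratedDeriv_two_H]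
  have h := continuous_iteratedDeriv_two_G (posDef_seg hA₁ hA₂ ht) (posDef_seg hB₁ hB₂ ht)
    (hA₁.isHermitian.sub hA₂.isHermitian) (hB₁.isHermitian.sub hB₂.isHermitian)
  have key : ∀ g : ℝ → ℝ → Matrix (n × m) (n × m) ℂ, Continuous (fun x : ℝ × ℝ => g x.1 x.2) →
      Tendsto (fun N => g (u N) (v N)) atTop (𝓝 (g q r)) := fun g hg =>
    (hg.tendsto (q, r)).comp (hu.prodMk_nhds hv)
  exact key
    (fun q r => iteratedDeriv 2 (G (seg A₁ A₂ t) (A₁ - A₂) (seg B₁ B₂ t) (B₁ - B₂) q r) 0) h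

end Segments

/-! ### Binary expansions -/

section BinaryExpansion

/-- The exponent of the leading term of a non-terminating binary expansion of `y` is the `k` with
`2⁻ᵏ < y ≤ 2 · 2⁻ᵏ`. -/
theorem lt_and_le_of_hasSum {e : ℕ → ℕ} (he : StrictMono e) {y : ℝ}
    (hy : HasSum (fun i => (1 / 2 ^ e i : ℝ)) y) : 1 / 2 ^ e 0 < y ∧ y ≤ 2 * (1 / 2 ^ e 0) := by
  constructor
  · have h := sum_le_hasSum (Finset.range 2) (fun i _ => by positivity) hy
    rw [Finset.sum_range_succ, Finset.sum_range_one] at h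
    have : (0 : ℝ) < 1 / 2 ^ e 1 := by positivity
    linarith
  · have h := hasSum_geometric_two.mul_left (1 / 2 ^ e 0 : ℝ)
    rw [mul_comm]
    refine hasSum_le (fun i => ?_) hy h
    have hi : e 0 + i ≤ e i := by
      induction i with
      | zero => simp
      | succ i ih =>
        have := he (Nat.lt_add_one i)
        omega
    rw [← one_div_pow, ← one_div_pow, ← pow_add]
    exact pow_le_pow_of_le_one (by norm_num) (by norm_num) hi

theorem binary_exponent_unique {y : ℝ} {a b : ℕ} (ha : 1 / 2 ^ a < y) (ha' : y ≤ 2 * (1 / 2 ^ a))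
    (hb : 1 / 2 ^ b < y) (hb' : y ≤ 2 * (1 / 2 ^ b)) : a = b := by
  have key : ∀ {a b : ℕ}, 1 / 2 ^ a < y → y ≤ 2 * (1 / 2 ^ b) → b ≤ a := by
    intro a b ha hb
    by_contra! h
    have h1 : (1 / 2 ^ b : ℝ) ≤ 1 / 2 ^ (a + 1) := by
      gcongr
      · exact one_le_two
      · exact h
    have h2 : (2 : ℝ) * (1 / 2 ^ (a + 1)) = 1 / 2 ^ a := by
      rw [pow_succ]
      field_simp
    linarith
  exact le_antisymm (key hb ha') (key ha hb')

theorem binary_expansion_unique {e e' : ℕ → ℕ} (he : StrictMono e) (he' : StrictMono e') {y : ℝ}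
    (hy : HasSum (fun i => (1 / 2 ^ e i : ℝ)) y) (hy' : HasSum (fun i => (1 / 2 ^ e' i : ℝ)) y) :
    e = e' := by
  have hshift : ∀ N : ℕ, StrictMono fun i : ℕ => i + N := fun N _ _ h => by simpa using h
  funext N
  induction N using Nat.strong_induction_on with
  | _ N ih =>
    have h1 := (hasSum_nat_add_iff' N).2 hy
    have h2 := (hasSum_nat_add_iff' N).2 hy'
    rw [Finset.sum_congr rfl fun i hi => by rw [ih i (Finset.mem_range.1 hi)]] at h1
    have h3 := lt_and_le_of_hasSum (he.comp (hshift N)) h1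
    have h4 := lt_and_le_of_hasSum (he'.comp (hshift N)) h2
    have := binary_exponent_unique h3.1 h3.2 h4.1 h4.2
    simpa using this

/-- Every number in `(0, 1]` has a non-terminating binary expansion: each step takes the largest
power of `1 / 2` strictly below the remainder. -/
theorem exists_binary_expansion {x : ℝ} (hx0 : 0 < x) (hx1 : x ≤ 1) :
    ∃ e : ℕ → ℕ, StrictMono e ∧ (∀ i, 0 < e i) ∧ HasSum (fun i => (1 / 2 ^ e i : ℝ)) x := by
  have hm : ∀ y : Set.Ioc (0 : ℝ) 1, ∃ a : ℕ, 1 / 2 ^ (a + 1) < (y : ℝ) ∧ (y : ℝ) ≤ 1 / 2 ^ a := by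
    intro y
    obtain ⟨a, h1, h2⟩ := exists_nat_pow_near_of_lt_one y.2.1 y.2.2
      (by norm_num : (0 : ℝ) < 1 / 2) (by norm_num)
    exact ⟨a, by rwa [← one_div_pow], by rwa [← one_div_pow]⟩
  choose a ha ha' using hm
  have hhalf : ∀ a : ℕ, (1 / 2 ^ a : ℝ) = 2 * (1 / 2 ^ (a + 1)) := fun a => by
    rw [pow_succ]
    field_simp
  have hrem : ∀ y : Set.Ioc (0 : ℝ) 1, (y : ℝ) - 1 / 2 ^ (a y + 1) ∈ Set.Ioc (0 : ℝ) 1 :=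
    fun y => ⟨sub_pos.2 (ha y), (sub_le_self _ (by positivity)).trans y.2.2⟩
  let y : ℕ → Set.Ioc (0 : ℝ) 1 := fun N =>
    Nat.rec ⟨x, hx0, hx1⟩ (fun _ y => ⟨y.1 - 1 / 2 ^ (a y + 1), hrem y⟩) N
  have hy : ∀ N : ℕ, (y (N + 1)).1 = (y N).1 - 1 / 2 ^ (a (y N) + 1) := fun N => rfl
  have hmono : StrictMono fun N => a (y N) + 1 := by
    refine strictMono_nat_of_lt_succ fun N => ?_
    by_contra! h
    have h1 : (1 / 2 ^ (a (y N) + 1) : ℝ) ≤ 1 / 2 ^ (a (y (N + 1)) + 1) := by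
      gcongr
      exact one_le_two
    have h2 := ha (y (N + 1))
    have h3 := ha' (y N)
    have h4 := hhalf (a (y N))
    have h5 := hy N
    linarith
  refine ⟨fun N => a (y N) + 1, hmono, fun _ => Nat.succ_pos _, ?_⟩
  rw [hasSum_iff_tendsto_nat_of_nonneg fun i => by positivity]
  have hsum : ∀ N, ∑ i ∈ Finset.range N, (1 / 2 ^ (a (y i) + 1) : ℝ) = x - (y N).1 := by
    intro N
    induction N with
    | zero => simp [y]
    | succ N ih =>
      rw [Finset.sum_range_succ, ih, hy]
      ring
  simp only [hsum]
  have hlim : Tendsto (fun N => (y N).1) atTop (𝓝 0) := by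
    refine squeeze_zero (fun N => (y N).2.1.le) (fun N => (ha' (y N)).trans ?_)
      (g := fun N : ℕ => 2 * (1 / 2 : ℝ) ^ N) ?_
    · rw [hhalf, ← one_div_pow]
      refine mul_le_mul_of_nonneg_left ?_ zero_le_two
      exact pow_le_pow_of_le_one (by norm_num) (by norm_num) (hmono.id_le N)
    · simpa using (tendsto_pow_atTop_nhds_zero_of_lt_one (by norm_num : (0 : ℝ) ≤ 1 / 2)
        (by norm_num)).const_mul 2
  simpa using hlim.const_sub x

end BinaryExpansion

end AllExponents

/-! ### The trace function -/

section Trace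

open Filter Topology

/-- The transpose of `U diag(d) Uᴴ` is diagonalized by the entrywise conjugate of `U`. -/
theorem exists_transpose_conjDiag {ι : Type*} [Fintype ι] [DecidableEq ι]
    (U : Matrix.unitaryGroup ι ℂ) :
    ∃ U' : Matrix.unitaryGroup ι ℂ, ∀ d : ι → ℝ, (conjDiag U d)ᵀ = conjDiag U' d := by
  have hU : (U : Matrix ι ι ℂ) * (U : Matrix ι ι ℂ)ᴴ = 1 := Matrix.mem_unitaryGroup_iff.1 U.2
  have e : ((U : Matrix ι ι ℂ)ᴴᵀ)ᴴ = (U : Matrix ι ι ℂ)ᵀ := by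
    ext i j
    simp
  refine ⟨⟨(U : Matrix ι ι ℂ)ᴴᵀ, Matrix.mem_unitaryGroup_iff.2 ?_⟩, fun d => ?_⟩
  · rw [Matrix.star_eq_conjTranspose, e, ← Matrix.transpose_mul, hU, Matrix.transpose_one]
  · rw [conjDiag_apply, conjDiag_apply, Unitary.conjStarAlgAut_apply,
      Unitary.conjStarAlgAut_apply]
    simp only [Matrix.transpose_mul, Matrix.diagonal_transpose, Matrix.star_eq_conjTranspose, e,
      mul_assoc]

theorem mpow_transpose {ι : Type*} [Fintype ι] [DecidableEq ι] {A : Matrix ι ι ℂ}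
    (hA : A.IsHermitian) (q : ℝ) : mpow Aᵀ q = (mpow A q)ᵀ := by
  obtain ⟨U, d, rfl⟩ := exists_conjDiag hA
  obtain ⟨U', hU'⟩ := exists_transpose_conjDiag U
  rw [hU', mpow_conjDiag, mpow_conjDiag, hU']

section Calculus

variable {f : ℝ → ℝ}

theorem contDiffAt_deriv {t : ℝ} {N : WithTop ℕ∞} (hf : ContDiffAt ℝ (N + 1) f t) :
    ContDiffAt ℝ N (deriv f) t :=
  (hf.fderiv_right le_rfl).clm_apply contDiffAt_const

theorem continuousAt_iteratedDeriv_two {t : ℝ} (hf : ContDiffAt ℝ 2 f t) :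
    ContinuousAt (iteratedDeriv 2 f) t := by
  rw [iteratedDeriv_succ, iteratedDeriv_one]
  have h1 : ContDiffAt ℝ 1 (deriv f) t := contDiffAt_deriv (by norm_num; exact hf)
  exact (contDiffAt_deriv (N := 0) (by simpa using h1)).continuousAt

theorem concaveOn_Icc_of_iteratedDeriv_two_nonpos
    (hf : ∀ t ∈ Set.Icc (0 : ℝ) 1, ContDiffAt ℝ 2 f t)
    (hf' : ∀ t ∈ Set.Icc (0 : ℝ) 1, iteratedDeriv 2 f t ≤ 0) :
    ConcaveOn ℝ (Set.Icc (0 : ℝ) 1) f := by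
  have hI : ∀ {t : ℝ}, t ∈ interior (Set.Icc (0 : ℝ) 1) → t ∈ Set.Icc (0 : ℝ) 1 :=
    fun h => interior_subset h
  refine concaveOn_of_deriv2_nonpos (convex_Icc _ _)
    (fun t ht => (hf t ht).continuousAt.continuousWithinAt)
    (fun t ht => ((hf t (hI ht)).differentiableAt (by simp)).differentiableWithinAt)
    (fun t ht => (hasDerivAt_deriv (hf t (hI ht))).differentiableAt.differentiableWithinAt)
    fun t ht => ?_
  rw [← iteratedDeriv_eq_iterate]
  exact hf' t (hI ht)

/-- The deviation of a function from its chord as a double integral of its second derivative. -/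
theorem sub_chord_eq_integral (hf : ∀ t ∈ Set.Icc (0 : ℝ) 1, ContDiffAt ℝ 2 f t) {t : ℝ}
    (ht : t ∈ Set.Icc (0 : ℝ) 1) :
    f t - (1 - t) * f 0 - t * f 1 =
      -t * ∫ x in (0 : ℝ)..1, ∫ σ in (t * x)..x, iteratedDeriv 2 f σ := by
  have hmul : ∀ x ∈ Set.Icc (0 : ℝ) 1, t * x ∈ Set.Icc (0 : ℝ) 1 := fun x hx =>
    ⟨mul_nonneg ht.1 hx.1, mul_le_one₀ ht.2 hx.1 hx.2⟩
  have h01 : Set.uIcc (0 : ℝ) 1 = Set.Icc 0 1 := Set.uIcc_of_le zero_le_one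
  have hd : ∀ x ∈ Set.Icc (0 : ℝ) 1, HasDerivAt f (deriv f x) x := fun x hx =>
    (eventually_hasDerivAt (hf x hx)).self_of_nhds
  have hdc : ContinuousOn (deriv f) (Set.Icc 0 1) := fun x hx =>
    (hasDerivAt_deriv (hf x hx)).continuousAt.continuousWithinAt
  have hdc' : ContinuousOn (fun x => deriv f (t * x)) (Set.Icc 0 1) :=
    hdc.comp (by fun_prop) hmul
  have hinner : ∀ x ∈ Set.uIcc (0 : ℝ) 1, ∫ σ in (t * x)..x, iteratedDeriv 2 f σ =
      deriv f x - deriv f (t * x) := by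
    intro x hx
    rw [h01] at hx
    have hsub : Set.uIcc (t * x) x ⊆ Set.Icc 0 1 := Set.uIcc_subset_Icc (hmul x hx) hx
    refine intervalIntegral.integral_eq_sub_of_hasDerivAt
      (fun σ hσ => hasDerivAt_deriv (hf σ (hsub hσ))) (ContinuousOn.intervalIntegrable ?_)
    exact fun σ hσ => (continuousAt_iteratedDeriv_two (hf σ (hsub hσ))).continuousWithinAt
  have hi1 : IntervalIntegrable (deriv f) MeasureTheory.volume 0 1 :=
    ContinuousOn.intervalIntegrable (by rwa [h01])
  have hi2 : IntervalIntegrable (fun x => deriv f (t * x)) MeasureTheory.volume 0 1 :=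
    ContinuousOn.intervalIntegrable (by rwa [h01])
  have h1 : ∫ x in (0 : ℝ)..1, deriv f x = f 1 - f 0 :=
    intervalIntegral.integral_eq_sub_of_hasDerivAt (fun x hx => hd x (h01 ▸ hx)) hi1
  have h2 : ∫ x in (0 : ℝ)..1, t * deriv f (t * x) = f t - f 0 := by
    have h3 : ∀ x ∈ Set.uIcc (0 : ℝ) 1,
        HasDerivAt (fun x => f (t * x)) (t * deriv f (t * x)) x := fun x hx => by
      have h4 := (hd _ (hmul x (h01 ▸ hx))).comp x ((hasDerivAt_id' x).const_mul t)
      exact h4.congr_deriv (by ring)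
    have h5 := intervalIntegral.integral_eq_sub_of_hasDerivAt h3 (hi2.const_mul t)
    simpa using h5
  rw [intervalIntegral.integral_congr hinner, intervalIntegral.integral_sub hi1 hi2, h1]
  rw [intervalIntegral.integral_const_mul] at h2
  linear_combination (-1) * h2

end Calculus

section QuadraticForm

variable {n m : Type*} [Fintype n] [Fintype m]

/-- `Q ↦ ⟨V_K, Q V_K⟩` as a continuous real-linear map. -/
noncomputable def quadFormCLM (K : Matrix n m ℂ) : Matrix (n × m) (n × m) ℂ →L[ℝ] ℂ :=
  LinearMap.toContinuousLinearMap
    { toFun := quadForm K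
      map_add' := fun P Q => by simp [quadForm, Matrix.add_mulVec, dotProduct_add]
      map_smul' := fun c Q => by simp [quadForm, Matrix.smul_mulVec, dotProduct_smul] }

theorem quadFormCLM_apply (K : Matrix n m ℂ) (Q : Matrix (n × m) (n × m) ℂ) :
    quadFormCLM K Q = quadForm K Q := rfl

theorem quadForm_eq_re (K : Matrix n m ℂ) {Q : Matrix (n × m) (n × m) ℂ} (hQ : Q.IsHermitian) :
    quadForm K Q = ((quadForm K Q).re : ℂ) := by
  have h := hQ.im_star_dotProduct_mulVec_self fun x : n × m => K x.1 x.2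
  exact (Complex.ext rfl (by simpa [quadForm] using h))

theorem quadForm_kronecker_transpose (K : Matrix n m ℂ) (P : Matrix n n ℂ) (Q : Matrix m m ℂ) :
    quadForm K (P ⊗ₖ Qᵀ) = (Kᴴ * P * K * Q).trace := by
  simp only [quadForm, dotProduct, Matrix.mulVec, Matrix.trace, Matrix.diag, Matrix.mul_apply,
    Fintype.sum_prod_type, Finset.mul_sum, Finset.sum_mul, Matrix.kroneckerMap_apply,
    Matrix.transpose_apply, Matrix.conjTranspose_apply, Pi.star_apply]
  rw [Finset.sum_comm]
  refine Finset.sum_congr rfl fun j _ => ?_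
  calc _ = ∑ k, ∑ i, ∑ l, star (K i j) * (P i k * Q l j * K k l) := Finset.sum_comm
    _ = ∑ k, ∑ l, ∑ i, star (K i j) * (P i k * Q l j * K k l) :=
        Finset.sum_congr rfl fun k _ => Finset.sum_comm
    _ = ∑ l, ∑ k, ∑ i, star (K i j) * (P i k * Q l j * K k l) := Finset.sum_comm
    _ = _ := by
        refine Finset.sum_congr rfl fun l _ => Finset.sum_congr rfl fun k _ =>
          Finset.sum_congr rfl fun i _ => ?_
        ring

end QuadraticForm

section Segments

variable {n m : Type*} [Fintype n] [DecidableEq n] [Fintype m] [DecidableEq m]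
  {A₁ A₂ : Matrix n n ℂ} {B₁ B₂ : Matrix m m ℂ}

theorem seg_transpose {ι : Type*} [Fintype ι] [DecidableEq ι] (A₁ A₂ : Matrix ι ι ℂ) (t : ℝ) :
    seg A₁ᵀ A₂ᵀ t = (seg A₁ A₂ t)ᵀ := by
  simp [seg]

theorem traceFun_eq_quadForm (K : Matrix n m ℂ) (hB₁ : B₁.IsHermitian) (hB₂ : B₂.IsHermitian)
    (q r t : ℝ) :
    traceFun K A₁ A₂ B₁ B₂ q r t = quadForm K (H A₁ A₂ B₁ᵀ B₂ᵀ q r t) := by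
  rw [H, seg_transpose, mpow_transpose (isHermitian_seg hB₁ hB₂ t), quadForm_kronecker_transpose,
    traceFun]

theorem isHermitian_H (q r t : ℝ) : (H A₁ A₂ B₁ B₂ q r t).IsHermitian :=
  isHermitian_kronecker (isHermitian_mpow _ _) (isHermitian_mpow _ _)

theorem h_eq_clm (K : Matrix n m ℂ) (hB₁ : B₁.IsHermitian) (hB₂ : B₂.IsHermitian) (q r : ℝ) :
    h K A₁ A₂ B₁ B₂ q r =
      fun t => (Complex.reCLM.comp (quadFormCLM K)) (H A₁ A₂ B₁ᵀ B₂ᵀ q r t) := by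
  funext t
  rw [h, traceFun_eq_quadForm K hB₁ hB₂]
  rfl

theorem contDiffAt_h (K : Matrix n m ℂ) (hA₁ : A₁.PosDef) (hA₂ : A₂.PosDef) (hB₁ : B₁.PosDef)
    (hB₂ : B₂.PosDef) (q r : ℝ) {t : ℝ} (ht : t ∈ Set.Icc (0 : ℝ) 1) :
    ContDiffAt ℝ 2 (h K A₁ A₂ B₁ B₂ q r) t := by
  rw [h_eq_clm K hB₁.isHermitian hB₂.isHermitian]
  exact (Complex.reCLM.comp (quadFormCLM K)).contDiff.contDiffAt.comp t
    (contDiffAt_H hA₁ hA₂ hB₁.transpose hB₂.transpose q r ht)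

theorem iteratedDeriv_two_h (K : Matrix n m ℂ) (hA₁ : A₁.PosDef) (hA₂ : A₂.PosDef)
    (hB₁ : B₁.PosDef) (hB₂ : B₂.PosDef) (q r : ℝ) {t : ℝ} (ht : t ∈ Set.Icc (0 : ℝ) 1) :
    iteratedDeriv 2 (h K A₁ A₂ B₁ B₂ q r) t =
      (quadForm K (iteratedDeriv 2 (H A₁ A₂ B₁ᵀ B₂ᵀ q r) t)).re := by
  rw [h_eq_clm K hB₁.isHermitian hB₂.isHermitian, iteratedDeriv_two_clm _
    (contDiffAt_H hA₁ hA₂ hB₁.transpose hB₂.transpose q r ht)]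
  rfl

theorem iteratedDeriv_two_h_nonpos (K : Matrix n m ℂ) (hA₁ : A₁.PosDef) (hA₂ : A₂.PosDef)
    (hB₁ : B₁.PosDef) (hB₂ : B₂.PosDef) {q r : ℝ} (hq : 0 ≤ q) (hr : 0 ≤ r) (hqr : q + r ≤ 1)
    {t : ℝ} (ht : t ∈ Set.Icc (0 : ℝ) 1) : iteratedDeriv 2 (h K A₁ A₂ B₁ B₂ q r) t ≤ 0 := by
  rw [iteratedDeriv_two_h K hA₁ hA₂ hB₁ hB₂ q r ht]
  have h1 := (posSemidef_neg_iteratedDeriv_two_H hA₁ hA₂ hB₁.transpose hB₂.transpose hq hr hqr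
    ht).re_dotProduct_nonneg fun x : n × m => K x.1 x.2
  change 0 ≤ (quadForm K _).re at h1
  rw [← quadFormCLM_apply, map_neg, quadFormCLM_apply, Complex.neg_re] at h1
  linarith

end Segments

end Trace

end LiebConcavity

theorem mainTheorem3 {n m : Type*} [Fintype n] [DecidableEq n] [Fintype m] [DecidableEq m] :
    -- the second derivative of `H` exists, and it is the one of `G` at `0`
    (∀ (A₁ A₂ : Matrix n n ℂ) (B₁ B₂ : Matrix m m ℂ),
      A₁.PosDef → A₂.PosDef → B₁.PosDef → B₂.PosDef →
      ∀ q r : ℝ, 0 ≤ q → 0 ≤ r → q + r ≤ 1 → ∀ t₀ ∈ Set.Icc (0 : ℝ) 1,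
        ContDiffAt ℝ 2 (LiebConcavity.H A₁ A₂ B₁ B₂ q r) t₀ ∧
        iteratedDeriv 2 (LiebConcavity.H A₁ A₂ B₁ B₂ q r) t₀ =
          iteratedDeriv 2 (LiebConcavity.G (LiebConcavity.seg A₁ A₂ t₀) (A₁ - A₂)
            (LiebConcavity.seg B₁ B₂ t₀) (B₁ - B₂) q r) 0) ∧
    -- the dyadic case
    (∀ (A₁ A₂ : Matrix n n ℂ) (B₁ B₂ : Matrix m m ℂ),
      A₁.PosDef → A₂.PosDef → B₁.PosDef → B₂.PosDef →
      ∀ p ∈ Set.Icc (0 : ℝ) 1, ∀ t₀ ∈ Set.Icc (0 : ℝ) 1,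
      ∀ k l : ℕ, 1 ≤ k → l < 2 ^ k → Odd l →
        (1 / 2 : ℝ) • iteratedDeriv 2 (LiebConcavity.H A₁ A₂ B₁ B₂
            (p * ((l : ℝ) / 2 ^ k)) (p * (1 - (l : ℝ) / 2 ^ k))) t₀ =
          -∑ x ∈ LiebConcavity.ancestors k l,
            LiebConcavity.Y (LiebConcavity.seg A₁ A₂ t₀) (A₁ - A₂)
              (LiebConcavity.seg B₁ B₂ t₀) (B₁ - B₂) p k l x.1 x.2 ∧
        (∀ x ∈ LiebConcavity.ancestors k l,
          (LiebConcavity.Y (LiebConcavity.seg A₁ A₂ t₀) (A₁ - A₂)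
            (LiebConcavity.seg B₁ B₂ t₀) (B₁ - B₂) p k l x.1 x.2).PosSemidef) ∧
        (-iteratedDeriv 2 (LiebConcavity.H A₁ A₂ B₁ B₂
            (p * ((l : ℝ) / 2 ^ k)) (p * (1 - (l : ℝ) / 2 ^ k))) t₀).PosSemidef) ∧
    -- the estimate of the terms `Y`, in the operator norm
    (∀ (Ψ V : Matrix n n ℂ) (Φ W : Matrix m m ℂ),
      Ψ.PosDef → Φ.PosDef → V.IsHermitian → W.IsHermitian →
      ∃ C : ℝ, 0 < C ∧ ∀ p ∈ Set.Icc (0 : ℝ) 1, ∀ k l : ℕ, 1 ≤ k → l < 2 ^ k → Odd l →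
        ∀ x ∈ LiebConcavity.ancestors k l,
          ‖LiebConcavity.Y Ψ V Φ W p k l x.1 x.2 -
              (1 - |(x.2 : ℝ) - (l : ℝ) / 2 ^ (k - x.1)|) •
                LiebConcavity.source Ψ V Φ W p x.1 x.2‖ ≤
            C * (1 / 2 ^ x.1) * ‖LiebConcavity.source Ψ V Φ W p x.1 x.2‖) ∧
    -- the non-dyadic case
    (∀ p q r : ℝ, 0 ≤ q → 0 ≤ r → q + r = p → p ≤ 1 →
      (∀ k l : ℕ, q ≠ p * ((l : ℝ) / 2 ^ k)) →
      (∃! e : ℕ → ℕ, StrictMono e ∧ (∀ i, 0 < e i) ∧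
        HasSum (fun i => p * (1 / 2 ^ e i)) q) ∧
      ∀ e : ℕ → ℕ, StrictMono e → (∀ i, 0 < e i) → HasSum (fun i => p * (1 / 2 ^ e i)) q →
      ∀ (A₁ A₂ : Matrix n n ℂ) (B₁ B₂ : Matrix m m ℂ),
        A₁.PosDef → A₂.PosDef → B₁.PosDef → B₂.PosDef → ∀ t₀ ∈ Set.Icc (0 : ℝ) 1,
        Filter.Tendsto
          (fun N : ℕ => iteratedDeriv 2 (LiebConcavity.H A₁ A₂ B₁ B₂
            (p * ∑ i ∈ Finset.range N, (1 / 2 ^ e i : ℝ))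
            (p * (1 - ∑ i ∈ Finset.range N, (1 / 2 ^ e i : ℝ)))) t₀)
          Filter.atTop (nhds (iteratedDeriv 2 (LiebConcavity.H A₁ A₂ B₁ B₂ q r) t₀)) ∧
        (-iteratedDeriv 2 (LiebConcavity.H A₁ A₂ B₁ B₂ q r) t₀).PosSemidef) ∧
    -- the function `h`
    (∀ (A₁ A₂ : Matrix n n ℂ) (B₁ B₂ : Matrix m m ℂ) (K : Matrix n m ℂ),
      A₁.PosDef → A₂.PosDef → B₁.PosDef → B₂.PosDef →
      ∀ q r : ℝ, 0 ≤ q → 0 ≤ r → q + r ≤ 1 →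
        (∀ t ∈ Set.Icc (0 : ℝ) 1,
          LiebConcavity.traceFun K A₁ A₂ B₁ B₂ q r t =
            (LiebConcavity.h K A₁ A₂ B₁ B₂ q r t : ℂ) ∧
          (LiebConcavity.h K A₁ A₂ B₁ B₂ q r t : ℂ) =
            LiebConcavity.quadForm K (LiebConcavity.H A₁ A₂ B₁ᵀ B₂ᵀ q r t) ∧
          ContDiffAt ℝ 2 (LiebConcavity.h K A₁ A₂ B₁ B₂ q r) t ∧
          ((iteratedDeriv 2 (LiebConcavity.h K A₁ A₂ B₁ B₂ q r) t : ℝ) : ℂ) =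
            LiebConcavity.quadForm K
              (iteratedDeriv 2 (LiebConcavity.H A₁ A₂ B₁ᵀ B₂ᵀ q r) t) ∧
          iteratedDeriv 2 (LiebConcavity.h K A₁ A₂ B₁ B₂ q r) t ≤ 0) ∧
        ConcaveOn ℝ (Set.Icc (0 : ℝ) 1) (LiebConcavity.h K A₁ A₂ B₁ B₂ q r) ∧
        (∀ t ∈ Set.Ioo (0 : ℝ) 1,
          LiebConcavity.h K A₁ A₂ B₁ B₂ q r t - (1 - t) * LiebConcavity.h K A₁ A₂ B₁ B₂ q r 0 -
              t * LiebConcavity.h K A₁ A₂ B₁ B₂ q r 1 =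
            -t * ∫ lam in (0 : ℝ)..1, ∫ σ in (t * lam)..lam,
              (LiebConcavity.quadForm K
                (iteratedDeriv 2 (LiebConcavity.H A₁ A₂ B₁ᵀ B₂ᵀ q r) σ)).re ∧
          0 ≤ LiebConcavity.h K A₁ A₂ B₁ B₂ q r t -
              (1 - t) * LiebConcavity.h K A₁ A₂ B₁ B₂ q r 0 -
              t * LiebConcavity.h K A₁ A₂ B₁ B₂ q r 1)) := by
  refine ⟨?_, ?_, ?_, ?_, ?_⟩
  · intro A₁ A₂ B₁ B₂ hA₁ hA₂ hB₁ hB₂ q r _ _ _ t₀ ht₀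
    exact ⟨LiebConcavity.contDiffAt_H hA₁ hA₂ hB₁ hB₂ q r ht₀,
      LiebConcavity.iteratedDeriv_two_H A₁ A₂ B₁ B₂ q r t₀⟩
  · intro A₁ A₂ B₁ B₂ hA₁ hA₂ hB₁ hB₂ p hp t₀ ht₀ k l _ hl _
    have hΨ := LiebConcavity.posDef_seg hA₁ hA₂ ht₀
    have hΦ := LiebConcavity.posDef_seg hB₁ hB₂ ht₀
    have hV := hA₁.isHermitian.sub hA₂.isHermitian
    have hW := hB₁.isHermitian.sub hB₂.isHermitian
    refine ⟨?_, fun x _ => LiebConcavity.posSemidef_Y hΨ hΦ hV hW hp k l x.1 x.2, ?_⟩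
    · rw [← LiebConcavity.curvature_eq_sum_ancestors hΨ hΦ hV hW hp hl.le,
        LiebConcavity.iteratedDeriv_two_H_eq_curvature, smul_neg, smul_smul]
      norm_num
    · have hx0 : (0 : ℝ) ≤ (l : ℝ) / 2 ^ k := by positivity
      have hx1 : (l : ℝ) / 2 ^ k ≤ 1 :=
        div_le_one_of_le₀ (by exact_mod_cast hl.le) (by positivity)
      exact LiebConcavity.posSemidef_neg_iteratedDeriv_two_H hA₁ hA₂ hB₁ hB₂
        (mul_nonneg hp.1 hx0) (mul_nonneg hp.1 (sub_nonneg.2 hx1))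
        (by rw [← mul_add]; simpa using hp.2) ht₀
  · intro Ψ V Φ W hΨ hΦ _ _
    obtain ⟨C, hC, h⟩ := LiebConcavity.exists_norm_Y_sub_le (V := V) (W := W) hΨ hΦ
    exact ⟨C, hC, fun p hp k l _ _ _ x hx => h p hp k l x hx⟩
  · intro p q r hq hr hqr hp hdy
    -- `p = 0` would make `q = p * 0` dyadic, and `q = 0` as well
    have hq0 : 0 < q := hq.lt_of_ne fun h => hdy 0 0 (by simp [← h])
    have hp0 : 0 < p := by linarith
    have hsum : ∀ e : ℕ → ℕ, HasSum (fun i => p * (1 / 2 ^ e i)) q ↔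
        HasSum (fun i => (1 / 2 ^ e i : ℝ)) (q / p) := fun e => by
      have h := hasSum_mul_left_iff (f := fun i => (1 / 2 ^ e i : ℝ)) (a₁ := q / p)
        (L := SummationFilter.unconditional ℕ) hp0.ne'
      rwa [mul_div_cancel₀ _ hp0.ne'] at h
    refine ⟨?_, ?_⟩
    · obtain ⟨e, he, hpos, hs⟩ := LiebConcavity.exists_binary_expansion (div_pos hq0 hp0)
        ((div_le_one hp0).2 (by linarith))
      refine ⟨e, ⟨he, hpos, (hsum e).2 hs⟩, fun e' he' => ?_⟩
      exact LiebConcavity.binary_expansion_unique he'.1 he ((hsum e').1 he'.2.2) hs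
    · intro e _ _ hs A₁ A₂ B₁ B₂ hA₁ hA₂ hB₁ hB₂ t₀ ht₀
      refine ⟨?_, LiebConcavity.posSemidef_neg_iteratedDeriv_two_H hA₁ hA₂ hB₁ hB₂ hq hr
        (hqr.le.trans hp) ht₀⟩
      have h1 := ((hsum e).1 hs).tendsto_sum_nat
      have h2 := h1.const_mul p
      have h3 := (h1.const_sub 1).const_mul p
      have e1 : p * (q / p) = q := mul_div_cancel₀ _ hp0.ne'
      have e2 : p * (1 - q / p) = r := by rw [mul_sub, e1]; linarith
      rw [e1] at h2
      rw [e2] at h3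
      exact LiebConcavity.tendsto_iteratedDeriv_two_H hA₁ hA₂ hB₁ hB₂ ht₀ h2 h3
  · intro A₁ A₂ B₁ B₂ K hA₁ hA₂ hB₁ hB₂ q r hq hr hqr
    have hC : ∀ t ∈ Set.Icc (0 : ℝ) 1, ContDiffAt ℝ 2 (LiebConcavity.h K A₁ A₂ B₁ B₂ q r) t :=
      fun t ht => LiebConcavity.contDiffAt_h K hA₁ hA₂ hB₁ hB₂ q r ht
    have hN : ∀ t ∈ Set.Icc (0 : ℝ) 1,
        iteratedDeriv 2 (LiebConcavity.h K A₁ A₂ B₁ B₂ q r) t ≤ 0 :=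
      fun t ht => LiebConcavity.iteratedDeriv_two_h_nonpos K hA₁ hA₂ hB₁ hB₂ hq hr hqr ht
    have hconc := LiebConcavity.concaveOn_Icc_of_iteratedDeriv_two_nonpos hC hN
    refine ⟨fun t ht => ?_, hconc, fun t ht => ⟨?_, ?_⟩⟩
    · have h1 := LiebConcavity.traceFun_eq_quadForm (A₁ := A₁) (A₂ := A₂) K hB₁.isHermitian
        hB₂.isHermitian q r t
      have h2 : LiebConcavity.traceFun K A₁ A₂ B₁ B₂ q r t =
          (LiebConcavity.h K A₁ A₂ B₁ B₂ q r t : ℂ) := by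
        rw [LiebConcavity.h, h1]
        exact LiebConcavity.quadForm_eq_re K (LiebConcavity.isHermitian_H q r t)
      refine ⟨h2, h2.symm.trans h1, hC t ht, ?_, hN t ht⟩
      rw [LiebConcavity.iteratedDeriv_two_h K hA₁ hA₂ hB₁ hB₂ q r ht]
      refine (LiebConcavity.quadForm_eq_re K ?_).symm
      simpa using (LiebConcavity.posSemidef_neg_iteratedDeriv_two_H hA₁ hA₂ hB₁.transpose
        hB₂.transpose hq hr hqr ht).isHermitian.neg
    · rw [LiebConcavity.sub_chord_eq_integral hC (Set.Ioo_subset_Icc_self ht)]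
      congr 1
      refine intervalIntegral.integral_congr fun x hx => ?_
      rw [Set.uIcc_of_le zero_le_one] at hx
      refine intervalIntegral.integral_congr fun σ hσ => ?_
      refine LiebConcavity.iteratedDeriv_two_h K hA₁ hA₂ hB₁ hB₂ q r (Set.uIcc_subset_Icc ?_ hx hσ)
      exact ⟨mul_nonneg ht.1.le hx.1, mul_le_one₀ ht.2.le hx.1 hx.2⟩
    · have h1 := hconc.2 (Set.left_mem_Icc.2 zero_le_one) (Set.right_mem_Icc.2 zero_le_one)
        (sub_nonneg.2 ht.2.le) ht.1.le (sub_add_cancel 1 t)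
      simp only [smul_eq_mul, mul_zero, mul_one, zero_add] at h1
      linarith
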